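/- Throughout, an abstract polytope of rank $n$ is a partially ordered set of faces with a strictly monotone rank function, a least and a greatest face, all of whose flags (maximal chains) consist of exactly one face of each rank $-1,0,\dots,n$, which is strongly flag-connected (any two flags $\Phi,\Psi$ are joined by a sequence of successively adjacent flags that all contain $\Phi\cap\Psi$, where two flags are adjacent if they differ in exactly one face) and satisfies the diamond condition (if $J<K$ and $\mathrm{rank}(K)=\mathrm{rank}(J)+2$, there are exactly two faces strictly between $J$ and $K$). It is chiral if its automorphism group has exactly two orbits on flags and adjacent flags lie in different orbits. A polytope of rank $4$ has type $[p_1,p_2,p_3]$ if, for $j=1,2,3$, every section $G/F$ with $F<G$, $\mathrm{rank}(F)=j-2$, $\mathrm{rank}(G)=j+1$ is a $p_j$-gon. Chiral polytopes are counted up to isomorphism, with the two enantiomorphic forms of a chiral polytope counted separately; that is, one counts pairs (chiral polytope, one of its two flag orbits) up to isomorphism, or equivalently pairs (chiral polytope, base flag) up to isomorphism. **Theorem.** Let $p$ be a prime. The chiral polytopes of rank $4$ and type $[5,3,4]$ with automorphism group isomorphic to $\mathrm{PSL}(2,p)$ are the following. 1. If $p\equiv 1,9 \pmod{40}$ and $1\pm\sqrt5$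 are both squares in $\mathbb{F}_p$, there are exactly four such chiral polytopes. 2. If $p\equiv 31,39\pmod{40}$, there are exactly two such chiral polytopes. 3. For every other prime $p$ there are none. -/

import Mathlib

universe u

/-- Two flags (maximal chains) are adjacent if they differ in exactly one face. -/
def Flag.Adjacent {α : Type u} [LE α] (Φ Ψ : Flag α) : Prop :=
  ∃ F G : α, (Φ : Set α) \ Ψ = {F} ∧ (Ψ : Set α) \ Φ = {G}

/-- An abstract polytope of rank `n`. -/
structure AbstractPolytope (n : ℕ) : Type (u + 1) where
  /-- The faces of the polytope. -/
  Face : Type u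
  /-- The incidence order on the faces. -/
  [order : PartialOrder Face]
  /-- The rank function. -/
  rank : Face → ℤ
  rank_strictMono : StrictMono rank
  /-- There is a least face. -/
  exists_least : ∃ F : Face, IsBot F
  /-- There is a greatest face. -/
  exists_greatest : ∃ F : Face, IsTop F
  /-- Every flag has exactly `n + 2` faces, one of each of the ranks `-1, 0, …, n`. -/
  flag_bijOn_rank : ∀ Φ : Flag Face, Set.BijOn rank Φ (Set.Icc (-1) (n : ℤ))
  /-- Strong flag-connectedness: any two flags `Φ`, `Ψ` are joined by a sequence of successively
  adjacent flags, all of them containing `Φ ∩ Ψ`. -/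
  strongly_flag_connected : ∀ Φ Ψ : Flag Face,
    Relation.ReflTransGen
      (fun Φ₁ Φ₂ : Flag Face => Φ₁.Adjacent Φ₂ ∧ (Φ ∩ Ψ : Set Face) ⊆ Φ₂) Φ Ψ
  /-- The diamond condition. -/
  diamond : ∀ J K : Face, J < K → rank K = rank J + 2 → (Set.Ioo J K).ncard = 2

namespace AbstractPolytope

attribute [instance] AbstractPolytope.order

variable {n : ℕ}

/-- The automorphism group, under composition. (An order automorphism preserves the rank, since the
rank of a face is determined by its position in any flag containing it.) -/
abbrev AutomorphismGroup (P : AbstractPolytope.{u} n) : Type u := P.Face ≃o P.Face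

/-- A polytope is chiral if its automorphism group has exactly two orbits on the flags, and adjacent
flags lie in different orbits. -/
def IsChiral (P : AbstractPolytope.{u} n) : Prop :=
  Nat.card (MulAction.orbitRel.Quotient P.AutomorphismGroup (Flag P.Face)) = 2 ∧
    ∀ Φ Ψ : Flag P.Face, Φ.Adjacent Ψ →
      Ψ ∉ MulAction.orbit P.AutomorphismGroup Φ

/-- A polytope of rank `n` has (Schläfli) type `[p₁, …, pₙ₋₁]` if, whenever `F < G` are faces of
ranks `j - 2` and `j + 1`, the section `G / F` is a `pⱼ`-gon, that is, it has `pⱼ` vertices: there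
are exactly `pⱼ` faces of rank `j - 1` between `F` and `G`. Here `j = i + 1` for `i : Fin (n - 1)`,
so that `pⱼ = p i`. -/
def HasType (P : AbstractPolytope.{u} n) (p : Fin (n - 1) → ℕ) : Prop :=
  ∀ (i : Fin (n - 1)) (F G : P.Face), F < G →
    P.rank F = (i : ℤ) - 1 → P.rank G = (i : ℤ) + 2 →
      {H : P.Face | F < H ∧ H < G ∧ P.rank H = (i : ℤ)}.ncard = p i

end AbstractPolytope

/-- A polytope together with a base flag. An isomorphism class of chiral polytopes with a base
flag is the same as a chiral polytope with one of its two flag orbits singled out, i.e. one of the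
two enantiomorphic (left- and right-handed) forms of a chiral polytope. -/
structure BasedPolytope (n : ℕ) : Type (u + 1) where
  /-- The underlying polytope. -/
  polytope : AbstractPolytope.{u} n
  /-- The base flag. -/
  baseFlag : Flag polytope.Face

namespace BasedPolytope

variable {n : ℕ}

/-- Two based polytopes are isomorphic if some isomorphism of the polytopes carries one base flag to
the other. -/
def Iso (A B : BasedPolytope.{u} n) : Prop :=
  ∃ f : A.polytope.Face ≃o B.polytope.Face, Flag.map f A.baseFlag = B.baseFlag

theorem iso_equivalence : Equivalence (Iso (n := n)) where
  refl A := ⟨OrderIso.refl _, SetLike.coe_injective (by simp [Flag.coe_map])⟩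
  symm := by
    rintro A B ⟨f, hf⟩
    refine ⟨f.symm, SetLike.coe_injective ?_⟩
    rw [← hf, Flag.coe_map, Flag.coe_map, ← Set.image_comp]
    simp
  trans := by
    rintro A B C ⟨f, hf⟩ ⟨g, hg⟩
    refine ⟨f.trans g, SetLike.coe_injective ?_⟩
    rw [← hg, ← hf, Flag.coe_map, Flag.coe_map, Flag.coe_map, ← Set.image_comp]
    rfl

/-- Isomorphism of based polytopes as a setoid. -/
instance isoSetoid (n : ℕ) : Setoid (BasedPolytope.{u} n) := ⟨Iso, iso_equivalence⟩

end BasedPolytope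

/-- The enantiomorphic forms, up to isomorphism, of the chiral `n`-polytopes of type `p` whose
automorphism group is isomorphic to `G`. -/
def chiralForms (n : ℕ) (p : Fin (n - 1) → ℕ) (G : Type*) [Group G] :
    Set (Quotient (BasedPolytope.isoSetoid.{u} n)) :=
  {c | ∃ A : BasedPolytope.{u} n, Quotient.mk _ A = c ∧
    A.polytope.IsChiral ∧ A.polytope.HasType p ∧
    Nonempty (A.polytope.AutomorphismGroup ≃* G)}

/-! The classification is carried out on generators of the automorphism group. In a chiral
4-polytope with base flag Φ, the automorphism taking Φ to the `j`-adjacent flag of its `i`-adjacent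
flag exists for all `i`, `j`. The three basic rotations σ₁, σ₂, σ₃ have orders 5, 3, 4 for type
[5,3,4], and σ₁σ₂, σ₂σ₃, σ₁σ₂σ₃ are involutions (`isRotaryTriple_rotation`). The group with these
rotations determines the based polytope up to isomorphism (`exists_orderIso_of_mulEquiv`).
Conversely, a generating triple with ⟨σ₂, σ₃⟩ ∩ ⟨σ₁, σ₂⟩ = ⟨σ₂⟩ gives a polytope of cosets, which is
chiral when no injective endomorphism acts on the triple like a reflection
(`IsRotaryGenerators.exists_basedPolytope`). So one counts such triples in PSL(2,p) up to
automorphism.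

Lift σ₂, σ₁σ₂, σ₂σ₃ to matrices a, α, γ in SL(2,p). Orders translate into traces, and with signs
normalized one gets tr a = 1, tr α = tr γ = 0, tr(aα) = x with x² = x + 1, and tr(aγ) = w with w a
fixed square root of 2. The only remaining freedom is z = tr(αγ), and the Fricke trace identity
together with the condition on σ₁σ₂σ₃ gives z² + xwz + x² − 1 = 0
(`IsRotaryTriple.exists_hasParam`). Since 1, a, α, aα is a basis of the matrix algebra whose
structure constants depend only on x, the pair (x, z) determines the triple up to an automorphism
(`HasParam.exists_mulEquiv`); since every injective endomorphism of PSL(2,p) comes from the matrix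
algebra (`exists_eq_pslCongr`), the pair is also an invariant. Every solution (x, z) is realized by
matrices (`exists_isFrame`).

Three things remain for each solution. Mirroring replaces z by the other root of its quadratic, and
the roots are distinct, so the polytope is never regular (`HasParam.not_exists_mirror`). The
intersection property holds because ⟨σ₁, σ₂⟩ is icosahedral, with very few possible traces, while
⟨σ₂, σ₃⟩ is octahedral with four double cosets of ⟨σ₂⟩ to be tested (`IsFrame.inf_le`). The triple
generates (`IsFrame.eq_top`): a proper subgroup would contain no nontrivial unipotent, and Dickson's
count of classes of commuting elements rules it out.

Finally, completing the square gives (2z + xw)² = 2 − 2x, and 2 − 2x = 1 ∓ √5 for the two values of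
x. Existence of √2 and √5 means p ≡ ±1 modulo 8 and modulo 5. As (1 + √5)(1 − √5) = −4, both or
neither of the factors are squares if −1 is a square, and exactly one is otherwise; each square
factor contributes two values of z. -/

namespace AbstractPolytope

variable {n : ℕ} (P : AbstractPolytope.{u} n)

/-! ### Flags and adjacency -/

section Flags

variable {P}

theorem exists_flag_of_isChain {c : Set P.Face} (hc : IsChain (· ≤ ·) c) :
    ∃ Φ : Flag P.Face, c ⊆ Φ :=
  hc.exists_subset_flag

theorem rank_mem (F : P.Face) : P.rank F ∈ Set.Icc (-1) (n : ℤ) := by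
  obtain ⟨Φ, h⟩ := exists_flag_of_isChain (P := P) (c := {F}) (by simp [IsChain])
  exact (P.flag_bijOn_rank Φ).mapsTo (h rfl)

theorem eq_of_rank_eq {Φ : Flag P.Face} {F G : P.Face} (hF : F ∈ Φ) (hG : G ∈ Φ)
    (h : P.rank F = P.rank G) : F = G :=
  (P.flag_bijOn_rank Φ).injOn hF hG h

theorem le_iff_rank_le {Φ : Flag P.Face} {F G : P.Face} (hF : F ∈ Φ) (hG : G ∈ Φ) :
    F ≤ G ↔ P.rank F ≤ P.rank G := by
  refine ⟨fun h => P.rank_strictMono.monotone h, fun h => ?_⟩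
  rcases Φ.le_or_le hF hG with h' | h'
  · exact h'
  · exact (eq_of_rank_eq hF hG (le_antisymm h (P.rank_strictMono.monotone h'))).le

theorem lt_iff_rank_lt {Φ : Flag P.Face} {F G : P.Face} (hF : F ∈ Φ) (hG : G ∈ Φ) :
    F < G ↔ P.rank F < P.rank G := by
  rw [lt_iff_le_not_ge, le_iff_rank_le hF hG, le_iff_rank_le hG hF, ← lt_iff_le_not_ge]

/-- The face of rank `k` of a flag. -/
noncomputable def face (Φ : Flag P.Face) (k : ℤ) : P.Face :=
  Classical.epsilon (h := ⟨P.exists_least.choose⟩) fun F => F ∈ Φ ∧ P.rank F = k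

theorem face_spec (Φ : Flag P.Face) {k : ℤ} (hk : k ∈ Set.Icc (-1) (n : ℤ)) :
    face Φ k ∈ Φ ∧ P.rank (face Φ k) = k := by
  have := (P.flag_bijOn_rank Φ).surjOn hk
  exact Classical.epsilon_spec (p := fun F => F ∈ Φ ∧ P.rank F = k) this

theorem face_mem (Φ : Flag P.Face) {k : ℤ} (hk : k ∈ Set.Icc (-1) (n : ℤ)) : face Φ k ∈ Φ :=
  (face_spec Φ hk).1

theorem rank_face (Φ : Flag P.Face) {k : ℤ} (hk : k ∈ Set.Icc (-1) (n : ℤ)) :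
    P.rank (face Φ k) = k :=
  (face_spec Φ hk).2

theorem face_rank {Φ : Flag P.Face} {F : P.Face} (hF : F ∈ Φ) : face Φ (P.rank F) = F :=
  eq_of_rank_eq (face_mem Φ (rank_mem F)) hF (rank_face Φ (rank_mem F))

theorem eq_face {Φ : Flag P.Face} {F : P.Face} {k : ℤ} (hF : F ∈ Φ) (h : P.rank F = k) :
    F = face Φ k := by
  rw [← h, face_rank hF]

theorem face_lt_face (Φ : Flag P.Face) {k l : ℤ} (hk : k ∈ Set.Icc (-1) (n : ℤ))
    (hl : l ∈ Set.Icc (-1) (n : ℤ)) (h : k < l) : face Φ k < face Φ l := by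
  rwa [lt_iff_rank_lt (face_mem Φ hk) (face_mem Φ hl), rank_face Φ hk, rank_face Φ hl]

theorem mem_flag_iff {Φ : Flag P.Face} {F : P.Face} : F ∈ Φ ↔ face Φ (P.rank F) = F :=
  ⟨face_rank, fun h => h ▸ face_mem Φ (rank_mem F)⟩

theorem flag_ext {Φ Ψ : Flag P.Face}
    (h : ∀ k ∈ Set.Icc (-1) (n : ℤ), face Φ k = face Ψ k) : Φ = Ψ := by
  refine SetLike.ext fun F => ?_
  rw [mem_flag_iff, mem_flag_iff, h _ (rank_mem F)]

/-- The faces of ranks −1 and n carry no information: in every flag they are the least and the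
greatest face. -/
theorem flag_ext_interior {Φ Ψ : Flag P.Face}
    (h : ∀ k : Fin n, face Φ k = face Ψ k) : Φ = Ψ := by
  obtain ⟨B, hB⟩ := P.exists_least
  obtain ⟨T, hT⟩ := P.exists_greatest
  refine flag_ext fun k hk => ?_
  by_cases h0 : k = -1
  · have key : ∀ Φ : Flag P.Face, face Φ k = B := fun Φ => by
      rcases (hB (face Φ k)).eq_or_lt with h | h
      · exact h.symm
      · have := P.rank_strictMono h
        rw [rank_face Φ hk] at this
        have := (rank_mem B).1
        omega
    rw [key, key]
  by_cases h1 : k = n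
  · have key : ∀ Φ : Flag P.Face, face Φ k = T := fun Φ => by
      rcases (hT (face Φ k)).eq_or_lt with h | h
      · exact h
      · have := P.rank_strictMono h
        rw [rank_face Φ hk] at this
        have := (rank_mem T).2
        omega
    rw [key, key]
  · have hk' := hk
    rw [Set.mem_Icc] at hk'
    have := h ⟨k.toNat, by omega⟩
    rwa [show ((⟨k.toNat, by omega⟩ : Fin n) : ℤ) = k by simp; omega] at this

theorem mem_Icc_pred (i : Fin n) : (i : ℤ) - 1 ∈ Set.Icc (-1) (n : ℤ) := by
  have := i.2; constructor <;> omega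

theorem mem_Icc_self (i : Fin n) : (i : ℤ) ∈ Set.Icc (-1) (n : ℤ) := by
  have := i.2; constructor <;> omega

theorem mem_Icc_succ (i : Fin n) : (i : ℤ) + 1 ∈ Set.Icc (-1) (n : ℤ) := by
  have := i.2; constructor <;> omega

/-- A chain containing faces of all ranks is a flag. -/
def flagOfChain (c : Set P.Face) (hc : IsChain (· ≤ ·) c)
    (h : ∀ k ∈ Set.Icc (-1) (n : ℤ), ∃ F ∈ c, P.rank F = k) : Flag P.Face where
  carrier := c
  Chain' := hc
  max_chain' t ht hct := by
    refine hct.antisymm fun F hF => ?_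
    obtain ⟨G, hG, hFG⟩ := h _ (rank_mem F)
    have : G = F := by
      rcases eq_or_ne G F with h' | h'
      · exact h'
      rcases ht (hct hG) hF h' with h1 | h1
      · exact absurd hFG (P.rank_strictMono (h1.lt_of_ne h')).ne
      · exact absurd hFG (P.rank_strictMono (h1.lt_of_ne h'.symm)).ne'
    exact this ▸ hG

/-- Among the flags with the same faces of ranks `i - 1` and `i + 1` only two faces of rank `i`
occur. -/
theorem face_eq_of_ne_of_ne {Φ Ψ Χ : Flag P.Face} {i : Fin n}
    (h1 : face Φ (i - 1) = face Ψ (i - 1)) (h2 : face Φ (i + 1) = face Ψ (i + 1))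
    (h3 : face Φ (i - 1) = face Χ (i - 1)) (h4 : face Φ (i + 1) = face Χ (i + 1))
    (h5 : face Φ i ≠ face Ψ i) (h6 : face Ψ i ≠ face Χ i) : face Φ i = face Χ i := by
  have hd := P.diamond (face Φ (i - 1)) (face Φ (i + 1))
    (face_lt_face Φ (mem_Icc_pred i) (mem_Icc_succ i) (by omega))
    (by rw [rank_face Φ (mem_Icc_pred i), rank_face Φ (mem_Icc_succ i)]; ring)
  have key : ∀ Ω : Flag P.Face, face Φ (i - 1) = face Ω (i - 1) →
      face Φ (i + 1) = face Ω (i + 1) → face Ω i ∈ Set.Ioo (face Φ (i - 1)) (face Φ (i + 1)) := by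
    intro Ω ha hb
    rw [ha, hb]
    exact ⟨face_lt_face Ω (mem_Icc_pred i) (mem_Icc_self i) (by omega),
      face_lt_face Ω (mem_Icc_self i) (mem_Icc_succ i) (by omega)⟩
  obtain ⟨A, B, -, hAB⟩ := Set.ncard_eq_two.1 hd
  have kΦ := key Φ rfl rfl
  have kΨ := key Ψ h1 h2
  have kΧ := key Χ h3 h4
  rw [hAB] at kΦ kΨ kΧ
  simp only [Set.mem_insert_iff, Set.mem_singleton_iff] at kΦ kΨ kΧ
  grind

/-- The diamond between the neighbouring faces of ranks `i - 1` and `i + 1` contains exactly one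
further face, which is exchanged for the given one. -/
theorem exists_adj (Φ : Flag P.Face) (i : Fin n) :
    ∃ Ψ : Flag P.Face, face Ψ i ≠ face Φ i ∧
      ∀ k ∈ Set.Icc (-1) (n : ℤ), k ≠ i → face Ψ k = face Φ k := by
  have hd := P.diamond (face Φ (i - 1)) (face Φ (i + 1))
    (face_lt_face Φ (mem_Icc_pred i) (mem_Icc_succ i) (by omega))
    (by rw [rank_face Φ (mem_Icc_pred i), rank_face Φ (mem_Icc_succ i)]; ring)
  obtain ⟨H, ⟨hH1, hH2⟩, hH⟩ : ∃ H ∈ Set.Ioo (face Φ (i - 1)) (face Φ (i + 1)), H ≠ face Φ i := by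
    obtain ⟨A, B, hne, hAB⟩ := Set.ncard_eq_two.1 hd
    rw [hAB]
    by_cases h : A = face Φ i
    · exact ⟨B, by simp, fun h' => hne (h.trans h'.symm)⟩
    · exact ⟨A, by simp, h⟩
  have hHr : P.rank H = i := by
    have h1 := P.rank_strictMono hH1
    have h2 := P.rank_strictMono hH2
    rw [rank_face Φ (mem_Icc_pred i)] at h1
    rw [rank_face Φ (mem_Icc_succ i)] at h2
    omega
  have hcmp : ∀ F ∈ Φ, P.rank F ≠ i → F ≤ H ∨ H ≤ F := by
    intro F hF hFi
    rcases lt_or_gt_of_ne hFi with h | h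
    · left
      refine le_trans ?_ hH1.le
      rw [le_iff_rank_le hF (face_mem Φ (mem_Icc_pred i)), rank_face Φ (mem_Icc_pred i)]
      omega
    · right
      refine le_trans hH2.le ?_
      rw [le_iff_rank_le (face_mem Φ (mem_Icc_succ i)) hF, rank_face Φ (mem_Icc_succ i)]
      omega
  let Ψ : Flag P.Face := flagOfChain (insert H {F | F ∈ Φ ∧ P.rank F ≠ i}) (by
      refine IsChain.insert (fun F hF G hG h => Φ.chain_le hF.1 hG.1 h) ?_
      rintro F ⟨hF, hFi⟩ -
      exact (hcmp F hF hFi).symm) (by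
      intro k hk
      by_cases hki : k = i
      · exact ⟨H, by simp, by rw [hHr, hki]⟩
      · exact ⟨face Φ k, Or.inr ⟨face_mem Φ hk, by rwa [rank_face Φ hk]⟩, rank_face Φ hk⟩)
  have hΨ : ∀ F, F ∈ Ψ ↔ F = H ∨ (F ∈ Φ ∧ P.rank F ≠ i) := fun F => Iff.rfl
  refine ⟨Ψ, ?_, fun k hk hki => ?_⟩
  · rw [← eq_face ((hΨ H).2 (Or.inl rfl)) hHr]
    exact hH
  · symm
    exact eq_face ((hΨ _).2 (Or.inr ⟨face_mem Φ hk, by rwa [rank_face Φ hk]⟩)) (rank_face Φ hk)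

/-- The `i`-adjacent flag of a flag, which differs from it exactly in the face of rank `i`. -/
noncomputable def adj (i : Fin n) (Φ : Flag P.Face) : Flag P.Face := (exists_adj Φ i).choose

theorem face_adj_self_ne (i : Fin n) (Φ : Flag P.Face) : face (adj i Φ) i ≠ face Φ i :=
  (exists_adj Φ i).choose_spec.1

theorem face_adj {i : Fin n} (Φ : Flag P.Face) {k : ℤ} (hk : k ∈ Set.Icc (-1) (n : ℤ))
    (h : k ≠ i) : face (adj i Φ) k = face Φ k :=
  (exists_adj Φ i).choose_spec.2 k hk h

theorem eq_of_face_eq {Φ Ψ : Flag P.Face} {i : Fin n}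
    (h : ∀ k ∈ Set.Icc (-1) (n : ℤ), k ≠ i → face Ψ k = face Φ k) (hi : face Ψ i = face Φ i) :
    Ψ = Φ :=
  flag_ext fun k hk => by
    by_cases hki : k = i
    · rwa [hki]
    · exact h k hk hki

theorem eq_adj {Φ Ψ : Flag P.Face} {i : Fin n} (hne : Ψ ≠ Φ)
    (h : ∀ k ∈ Set.Icc (-1) (n : ℤ), k ≠ i → face Ψ k = face Φ k) : Ψ = adj i Φ := by
  have h1 := fun (k : ℤ) hk (hki : k ≠ i) => (h k hk hki).trans (face_adj Φ hk hki).symm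
  refine eq_of_face_eq h1 ?_
  refine face_eq_of_ne_of_ne (Ψ := Φ) (h _ (mem_Icc_pred i) (by omega))
    (h _ (mem_Icc_succ i) (by omega)) (h1 _ (mem_Icc_pred i) (by omega))
    (h1 _ (mem_Icc_succ i) (by omega)) (fun hi => hne (eq_of_face_eq h hi)) ?_
  exact (face_adj_self_ne i Φ).symm

theorem adj_ne (i : Fin n) (Φ : Flag P.Face) : adj i Φ ≠ Φ := fun h =>
  face_adj_self_ne i Φ (by rw [h])

@[simp]
theorem adj_adj (i : Fin n) (Φ : Flag P.Face) : adj i (adj i Φ) = Φ :=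
  (eq_adj (adj_ne i Φ).symm fun k hk hki => (face_adj Φ hk hki).symm).symm

/-- A change in rank `j` does not touch the diamond around rank `i` when the ranks are not
consecutive, so the two changes are independent. -/
theorem adj_comm {i j : Fin n} (h : (i : ℕ) + 1 < j) (Φ : Flag P.Face) :
    adj i (adj j Φ) = adj j (adj i Φ) := by
  have hC : adj i (adj j (adj i Φ)) = adj j Φ := by
    refine eq_adj (fun h' => ?_) fun k hk hkj => ?_
    · have := face_adj_self_ne j (adj i Φ)
      rw [← face_adj (adj j (adj i Φ)) (i := i) (mem_Icc_self j) (by omega), h',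
        face_adj Φ (mem_Icc_self j) (by omega)] at this
      exact this rfl
    · by_cases hki : k = i
      · subst hki
        have e1 : face (adj j (adj i Φ)) i = face (adj i Φ) i :=
          face_adj _ (mem_Icc_self i) (by omega)
        have a1 : ∀ l ∈ Set.Icc (-1) (n : ℤ), l ≠ i → l ≠ j →
            face (adj i (adj j (adj i Φ))) l = face Φ l := fun l hl h1 h2 => by
          rw [face_adj _ hl h1, face_adj _ hl h2, face_adj _ hl h1]
        have a2 : ∀ l ∈ Set.Icc (-1) (n : ℤ), l ≠ i → l ≠ j →
            face (adj i (adj j (adj i Φ))) l = face (adj j (adj i Φ)) l := fun l hl h1 h2 => by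
          rw [face_adj _ hl h1]
        -- Two changes at rank `i` inside the same two-element diamond restore the original face.
        refine face_eq_of_ne_of_ne (Ψ := adj j (adj i Φ))
          (a2 _ (mem_Icc_pred i) (by omega) (by omega))
          (a2 _ (mem_Icc_succ i) (by omega) (by omega))
          (a1 _ (mem_Icc_pred i) (by omega) (by omega))
          (a1 _ (mem_Icc_succ i) (by omega) (by omega)) (face_adj_self_ne i _) ?_
        rw [e1]
        exact face_adj_self_ne i Φ
      · rw [face_adj _ hk hki, face_adj _ hk hkj, face_adj _ hk hki]
  rw [← hC, adj_adj]

theorem adjacent_iff {Φ Ψ : Flag P.Face} : Φ.Adjacent Ψ ↔ ∃ i : Fin n, Ψ = adj i Φ := by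
  constructor
  · rintro ⟨F, G, hF, hG⟩
    have hF' : F ∈ Φ ∧ F ∉ Ψ := by
      have : F ∈ (Φ : Set P.Face) \ Ψ := hF ▸ rfl
      exact this
    have hne : ∀ k ∈ Set.Icc (-1) (n : ℤ), k ≠ P.rank F → face Ψ k = face Φ k := by
      intro k hk hkF
      have : face Φ k ∈ Ψ := by
        by_contra h
        have h2 : face Φ k ∈ (Φ : Set P.Face) \ Ψ := ⟨face_mem Φ hk, h⟩
        rw [hF, Set.mem_singleton_iff] at h2
        exact hkF (by rw [← h2, rank_face Φ hk])
      exact (eq_face this (rank_face Φ hk)).symm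
    by_contra! hcon
    refine hF'.2 ?_
    have : Φ = Ψ := flag_ext_interior fun i => by
      by_cases hi : (i : ℤ) = P.rank F
      · by_contra hne'
        refine hcon i (eq_adj (fun h => hne' (by rw [h])) fun k hk hki => ?_)
        exact hne k hk (by rwa [← hi])
      · exact (hne i (mem_Icc_self i) hi).symm
    exact this ▸ hF'.1
  · rintro ⟨i, rfl⟩
    have key : ∀ Φ : Flag P.Face, (Φ : Set P.Face) \ (adj i Φ : Flag P.Face) = {face Φ i} := by
      intro Φ
      ext F
      simp only [Set.mem_sdiff, SetLike.mem_coe, Set.mem_singleton_iff]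
      constructor
      · rintro ⟨h1, h2⟩
        by_contra h3
        refine h2 (mem_flag_iff.2 ?_)
        rw [face_adj Φ (rank_mem F), face_rank h1]
        intro h
        exact h3 (eq_face h1 h)
      · rintro rfl
        refine ⟨face_mem Φ (mem_Icc_self i), fun h => ?_⟩
        rw [mem_flag_iff, rank_face Φ (mem_Icc_self i)] at h
        exact face_adj_self_ne i Φ h
    refine ⟨face Φ i, face (adj i Φ) i, key Φ, ?_⟩
    have := key (adj i Φ)
    rwa [adj_adj] at this

/-- Strong flag-connectedness as an induction principle: `Ψ` is reached from `Φ` by replacing only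
faces of ranks in which `Φ` and `Ψ` differ. -/
theorem flag_induction {Φ Ψ : Flag P.Face} (p : Flag P.Face → Prop) (h0 : p Φ)
    (hs : ∀ (Χ : Flag P.Face) (i : Fin n), face Φ i ≠ face Ψ i → p Χ → p (adj i Χ)) : p Ψ := by
  have key : ∀ Χ, Relation.ReflTransGen
      (fun Φ₁ Φ₂ : Flag P.Face => Φ₁.Adjacent Φ₂ ∧ (Φ ∩ Ψ : Set P.Face) ⊆ Φ₂) Φ Χ →
      p Χ ∧ (Φ ∩ Ψ : Set P.Face) ⊆ Χ := by
    intro Χ h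
    induction h with
    | refl => exact ⟨h0, Set.inter_subset_left⟩
    | tail _ h ih =>
      obtain ⟨hadj, hsub⟩ := h
      obtain ⟨i, rfl⟩ := adjacent_iff.1 hadj
      refine ⟨hs _ i (fun he => ?_) ih.1, hsub⟩
      have hm : face Φ i ∈ (Φ ∩ Ψ : Set P.Face) :=
        ⟨face_mem Φ (mem_Icc_self i), he ▸ face_mem Ψ (mem_Icc_self i)⟩
      have h1 := eq_face (ih.2 hm) (rank_face Φ (mem_Icc_self i))
      have h2 := eq_face (hsub hm) (rank_face Φ (mem_Icc_self i))
      exact face_adj_self_ne i _ (h2.symm.trans h1)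
  exact (key Ψ (P.strongly_flag_connected Φ Ψ)).1

end Flags

/-! ### Isomorphisms and their rigidity -/

section Iso

variable {P} {Q : AbstractPolytope.{u} n}

theorem mem_map {f : P.Face ≃o Q.Face} {Φ : Flag P.Face} {F : P.Face} :
    f F ∈ Flag.map f Φ ↔ F ∈ Φ := by
  rw [← SetLike.mem_coe, Flag.coe_map, f.injective.mem_set_image, SetLike.mem_coe]

/-- This reads the rank off from the order alone, which is why order isomorphisms preserve it. -/
theorem rank_add_one_eq_ncard {Φ : Flag P.Face} {F : P.Face} (hF : F ∈ Φ) :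
    (((Φ : Set P.Face) ∩ Set.Iio F).ncard : ℤ) = P.rank F + 1 := by
  have h : Set.BijOn P.rank ((Φ : Set P.Face) ∩ Set.Iio F) (Set.Ico (-1) (P.rank F)) := by
    refine ⟨fun G hG => ⟨(rank_mem G).1, P.rank_strictMono hG.2⟩,
      (P.flag_bijOn_rank Φ).injOn.mono Set.inter_subset_left, fun k hk => ?_⟩
    have hk' : k ∈ Set.Icc (-1) (n : ℤ) := ⟨hk.1, hk.2.le.trans (rank_mem F).2⟩
    refine ⟨face Φ k, ⟨face_mem Φ hk', ?_⟩, rank_face Φ hk'⟩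
    rw [Set.mem_Iio, lt_iff_rank_lt (face_mem Φ hk') hF, rank_face Φ hk']
    exact hk.2
  rw [← h.injOn.ncard_image, h.image_eq, ← Finset.coe_Ico, Set.ncard_coe_finset,
    Int.card_Ico]
  have := (rank_mem F).1
  omega

@[simp]
theorem rank_apply (f : P.Face ≃o Q.Face) (F : P.Face) : Q.rank (f F) = P.rank F := by
  obtain ⟨Φ, h⟩ := exists_flag_of_isChain (P := P) (c := {F}) (by simp [IsChain])
  have hF : F ∈ Φ := h rfl
  have h1 := rank_add_one_eq_ncard hF
  have h2 := rank_add_one_eq_ncard (mem_map (f := f).2 hF)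
  rw [Flag.coe_map, ← OrderIso.image_Iio, ← Set.image_inter f.injective,
    Set.ncard_image_of_injective _ f.injective] at h2
  omega

theorem face_map (f : P.Face ≃o Q.Face) (Φ : Flag P.Face) {k : ℤ}
    (hk : k ∈ Set.Icc (-1) (n : ℤ)) : face (Flag.map f Φ) k = f (face Φ k) :=
  (eq_face (mem_map.2 (face_mem Φ hk)) (by rw [rank_apply, rank_face Φ hk])).symm

theorem map_adj (f : P.Face ≃o Q.Face) (i : Fin n) (Φ : Flag P.Face) :
    Flag.map f (adj i Φ) = adj i (Flag.map f Φ) := by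
  refine eq_adj (fun h => adj_ne i Φ ((Flag.map f).injective h)) fun k hk hki => ?_
  rw [face_map f _ hk, face_map f _ hk, face_adj Φ hk hki]

theorem smul_adj (g : P.AutomorphismGroup) (i : Fin n) (Φ : Flag P.Face) :
    g • adj i Φ = adj i (g • Φ) :=
  map_adj g i Φ

theorem face_smul (g : P.AutomorphismGroup) (Φ : Flag P.Face) {k : ℤ}
    (hk : k ∈ Set.Icc (-1) (n : ℤ)) : face (g • Φ) k = g (face Φ k) :=
  face_map g Φ hk

/-- Isomorphisms commute with `adj`, and all flags are reached from one by adjacencies; so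
automorphisms act freely on flags. -/
theorem eq_of_map_eq {f g : P.Face ≃o Q.Face} {Φ : Flag P.Face}
    (h : Flag.map f Φ = Flag.map g Φ) : f = g := by
  have key : ∀ Ψ : Flag P.Face, Flag.map f Ψ = Flag.map g Ψ := fun Ψ =>
    flag_induction (Φ := Φ) (fun Ψ => Flag.map f Ψ = Flag.map g Ψ) h
      fun Χ i _ hΧ => by rw [map_adj, map_adj, hΧ]
  ext F
  obtain ⟨Φ, h⟩ := exists_flag_of_isChain (P := P) (c := {F}) (by simp [IsChain])
  have hF : F ∈ Φ := h rfl
  refine eq_of_rank_eq (Φ := Flag.map f Φ) (mem_map.2 hF) ?_ (by simp)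
  rw [key]
  exact mem_map.2 hF

theorem eq_of_smul_eq {g h : P.AutomorphismGroup} {Φ : Flag P.Face} (H : g • Φ = h • Φ) : g = h :=
  eq_of_map_eq H

end Iso

end AbstractPolytope

/-! ### Rotations of a chiral polytope -/

namespace AbstractPolytope

variable {n : ℕ} {P Q : AbstractPolytope.{u} n}

section Rotations

theorem IsChiral.adj_ne_smul (hP : P.IsChiral) (i : Fin n) (Φ : Flag P.Face)
    (g : P.AutomorphismGroup) : adj i Φ ≠ g • Φ := fun h =>
  hP.2 Φ (adj i Φ) (adjacent_iff.2 ⟨i, rfl⟩) ⟨g, h.symm⟩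

theorem IsChiral.smul_eq_or_smul_eq (hP : P.IsChiral) (i : Fin n) (Φ Ψ : Flag P.Face) :
    (∃ g : P.AutomorphismGroup, g • Φ = Ψ) ∨ ∃ g : P.AutomorphismGroup, g • Φ = adj i Ψ := by
  obtain ⟨x, y, -, hxy⟩ := Nat.card_eq_two_iff.1 hP.1
  let q : Flag P.Face → MulAction.orbitRel.Quotient P.AutomorphismGroup (Flag P.Face) :=
    fun Φ => Quotient.mk _ Φ
  have hq : ∀ Φ Ψ, q Φ = q Ψ → ∃ g : P.AutomorphismGroup, g • Φ = Ψ := fun Φ Ψ h => by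
    obtain ⟨g, hg⟩ := Quotient.exact h.symm
    exact ⟨g, hg⟩
  have hmem : ∀ z, z = x ∨ z = y := fun z => by
    have : z ∈ ({x, y} : Set _) := hxy ▸ Set.mem_univ z
    simpa using this
  have hne : q (adj i Φ) ≠ q Φ := fun h => by
    obtain ⟨g, hg⟩ := hq _ _ h.symm
    exact hP.adj_ne_smul i Φ g hg.symm
  have : q Φ = q Ψ ∨ q (adj i Φ) = q Ψ := by
    have h1 := hmem (q Φ)
    have h2 := hmem (q Ψ)
    have h3 := hmem (q (adj i Φ))
    grind
  rcases this with h | h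
  · exact Or.inl (hq _ _ h)
  · obtain ⟨g, hg⟩ := hq _ _ h
    exact Or.inr ⟨g, by rw [← hg, smul_adj, adj_adj]⟩

/-- With only two orbits and adjacent flags in different ones, two adjacency steps return to the
orbit of the starting flag. -/
theorem IsChiral.exists_rotation (hP : P.IsChiral) (Φ : Flag P.Face) (i j : Fin n) :
    ∃ g : P.AutomorphismGroup, g • Φ = adj j (adj i Φ) := by
  rcases hP.smul_eq_or_smul_eq j Φ (adj i Φ) with ⟨g, hg⟩ | h
  · exact absurd hg.symm (hP.adj_ne_smul i Φ g)
  · exact h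

/-- The rotation about the base flag `Φ` that moves `Φ` to the `j`-adjacent flag of its
`i`-adjacent flag. -/
noncomputable def rotation (hP : P.IsChiral) (Φ : Flag P.Face) (i j : Fin n) :
    P.AutomorphismGroup :=
  (hP.exists_rotation Φ i j).choose

variable (hP : P.IsChiral) (Φ : Flag P.Face)

theorem rotation_smul (i j : Fin n) : rotation hP Φ i j • Φ = adj j (adj i Φ) :=
  (hP.exists_rotation Φ i j).choose_spec

theorem rotation_smul_adj (i j : Fin n) : rotation hP Φ i j • adj j Φ = adj i Φ := by
  rw [smul_adj, rotation_smul, adj_adj]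

@[simp]
theorem rotation_self (i : Fin n) : rotation hP Φ i i = 1 :=
  eq_of_smul_eq (Φ := Φ) (by rw [rotation_smul, adj_adj, one_smul])

/-- Automorphisms commute with `adj`, so `rotation i j` multiplies like the product ρᵢρⱼ of two
reflections, although the reflections themselves are not automorphisms here. -/
theorem rotation_mul (i j k : Fin n) :
    rotation hP Φ i j * rotation hP Φ j k = rotation hP Φ i k :=
  eq_of_smul_eq (Φ := Φ) (by
    rw [mul_smul, rotation_smul, smul_adj, rotation_smul_adj, rotation_smul])

theorem rotation_inv (i j : Fin n) : (rotation hP Φ i j)⁻¹ = rotation hP Φ j i :=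
  inv_eq_of_mul_eq_one_right (by rw [rotation_mul, rotation_self])

theorem rotation_sq {i j : Fin n} (h : (i : ℕ) + 1 < j) : rotation hP Φ i j ^ 2 = 1 :=
  eq_of_smul_eq (Φ := Φ) (by
    rw [pow_two, mul_smul, rotation_smul, smul_adj, smul_adj, rotation_smul, adj_comm h, adj_adj,
      adj_adj, one_smul])

theorem face_rotation_smul {i j : Fin n} {k : ℤ} (hk : k ∈ Set.Icc (-1) (n : ℤ)) (hi : k ≠ i)
    (hj : k ≠ j) : rotation hP Φ i j (face Φ k) = face Φ k := by
  rw [← face_smul _ _ hk, rotation_smul, face_adj _ hk hj, face_adj _ hk hi]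

/-- Strong flag-connectedness joins Φ to its image under `g` by changes in ranks outside `J` only.
Every two steps of the path multiply by a rotation on the right, and chirality excludes a path of
odd length. -/
theorem mem_closure_rotation {J : Set (Fin n)} {g : P.AutomorphismGroup}
    (h : ∀ j ∈ J, g (face Φ j) = face Φ j) :
    g ∈ Subgroup.closure {τ | ∃ i j, i ∉ J ∧ j ∉ J ∧ rotation hP Φ i j = τ} := by
  set K := Subgroup.closure {τ | ∃ i j, i ∉ J ∧ j ∉ J ∧ rotation hP Φ i j = τ} with hK
  have key := flag_induction (Φ := Φ) (Ψ := g • Φ)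
    (fun Χ => (∃ h ∈ K, Χ = h • Φ) ∨ ∃ h ∈ K, ∃ k ∉ J, Χ = h • adj k Φ)
    (Or.inl ⟨1, K.one_mem, (one_smul _ _).symm⟩) (by
      rintro Χ i hi hΧ
      have hiJ : i ∉ J := fun hiJ => hi (by rw [face_smul g Φ (mem_Icc_self i), h i hiJ])
      rcases hΧ with ⟨h, hh, rfl⟩ | ⟨h, hh, k, hk, rfl⟩
      · exact Or.inr ⟨h, hh, i, hiJ, by rw [smul_adj]⟩
      · refine Or.inl ⟨h * rotation hP Φ k i,
          K.mul_mem hh (Subgroup.subset_closure ⟨k, i, hk, hiJ, rfl⟩), ?_⟩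
        rw [mul_smul, rotation_smul, smul_adj, smul_adj, smul_adj])
  rcases key with ⟨h, hh, e⟩ | ⟨h, hh, k, hk, e⟩
  · rwa [eq_of_smul_eq e]
  · refine absurd ?_ (hP.adj_ne_smul k Φ (h⁻¹ * g))
    rw [mul_smul, e, inv_smul_smul]

/-- The powers of the rotation act simply transitively on the vertices of the polygonal section.
Freeness uses chirality: a power fixing the base vertex could otherwise only be the reflection to
the `j`-adjacent flag. Transitivity is flag-connectedness inside the section. -/
theorem orderOf_rotation {p : Fin (n - 1) → ℕ} (hp : P.HasType p) (m : Fin (n - 1)) {i j : Fin n}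
    (hi : (i : ℕ) = m) (hj : (j : ℕ) = m + 1) : orderOf (rotation hP Φ i j) = p m := by
  set σ := rotation hP Φ i j with hσ
  have hn := j.2
  have hpred := mem_Icc_pred i
  have hsucc := mem_Icc_succ j
  rw [← hp m (face Φ (i - 1)) (face Φ (j + 1))
    (face_lt_face Φ hpred hsucc (by omega)) (by rw [rank_face Φ hpred, hi])
    (by rw [rank_face Φ hsucc, hj]; push_cast; ring), ← Nat.card_zpowers]
  rw [Nat.card_congr (Equiv.refl _), ← SetLike.coe_sort_coe, Nat.card_coe_set_eq]
  have hfix : ∀ g ∈ Subgroup.zpowers σ, ∀ k ∈ Set.Icc (-1) (n : ℤ), k ≠ i → k ≠ j →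
      g (face Φ k) = face Φ k := by
    rintro g ⟨z, rfl⟩ k hk hki hkj
    have h1 : σ ∈ MulAction.stabilizer P.AutomorphismGroup (face Φ k) :=
      face_rotation_smul hP Φ hk hki hkj
    exact (MulAction.stabilizer P.AutomorphismGroup (face Φ k)).zpow_mem h1 z
  have hbij : Set.BijOn (fun g : P.AutomorphismGroup => g (face Φ i)) (Subgroup.zpowers σ)
      {H | face Φ (i - 1) < H ∧ H < face Φ (j + 1) ∧ P.rank H = (m : ℤ)} := by
    refine ⟨fun g hg => ⟨?_, ?_, ?_⟩, fun g hg h hh e => ?_, fun H hH => ?_⟩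
    · rw [← hfix g hg _ hpred (by omega) (by omega)]
      exact g.lt_iff_lt.2 (face_lt_face Φ hpred (mem_Icc_self i) (by omega))
    · rw [← hfix g hg _ hsucc (by omega) (by omega)]
      exact g.lt_iff_lt.2 (face_lt_face Φ (mem_Icc_self i) hsucc (by omega))
    · rw [rank_apply, rank_face Φ (mem_Icc_self i), hi]
    · have hk : h⁻¹ * g ∈ Subgroup.zpowers σ :=
        (Subgroup.zpowers σ).mul_mem ((Subgroup.zpowers σ).inv_mem hh) hg
      have hki : (h⁻¹ * g) (face Φ i) = face Φ i := by
        have e' : g (face Φ i) = h (face Φ i) := e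
        change h.symm (g (face Φ i)) = _
        rw [e', OrderIso.symm_apply_apply]
      by_contra hne
      refine hP.adj_ne_smul j Φ (h⁻¹ * g) (eq_adj (fun h1 => hne ?_) fun k hk' hkj => ?_).symm
      · exact (inv_mul_eq_one.1 (eq_of_smul_eq (h1.trans (one_smul _ Φ).symm))).symm
      · rw [face_smul _ _ hk']
        by_cases hki' : k = i
        · rw [hki', hki]
        · exact hfix _ hk k hk' hki' hkj
    · obtain ⟨h1, h2, h3⟩ := hH
      obtain ⟨Ψ, hΨ⟩ := exists_flag_of_isChain (P := P)
        (c := insert H {F | F ∈ Φ ∧ P.rank F ≠ i ∧ P.rank F ≠ j}) (by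
          refine IsChain.insert (fun F hF G hG h => Φ.chain_le hF.1 hG.1 h) ?_
          rintro F ⟨hF, hFi, hFj⟩ -
          rcases lt_or_gt_of_ne hFi with h | h
          · right
            refine le_trans ?_ h1.le
            rw [le_iff_rank_le hF (face_mem Φ hpred), rank_face Φ hpred]
            omega
          · left
            refine le_trans h2.le ?_
            rw [le_iff_rank_le (face_mem Φ hsucc) hF, rank_face Φ hsucc]
            omega)
      have hΨH : H = face Ψ i := eq_face (hΨ (Or.inl rfl)) (by rw [h3, hi])
      have hΨk : ∀ k : Fin n, k ≠ i → k ≠ j → face Φ k = face Ψ k := fun k hki hkj =>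
        eq_face (hΨ (Or.inr ⟨face_mem Φ (mem_Icc_self k), by
          rw [rank_face Φ (mem_Icc_self k)]; omega, by
          rw [rank_face Φ (mem_Icc_self k)]; omega⟩)) (rank_face Φ (mem_Icc_self k))
      have hadj : σ • adj j Φ = adj i Φ := rotation_smul_adj hP Φ i j
      have hσm := Subgroup.mem_zpowers σ
      have key := flag_induction (Φ := Φ) (Ψ := Ψ)
        (fun Χ => ∃ g ∈ Subgroup.zpowers σ, Χ = g • Φ ∨ Χ = g • adj j Φ)
        ⟨1, Subgroup.one_mem _, Or.inl (one_smul _ _).symm⟩ (by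
          rintro Χ k hk ⟨g, hg, hΧ⟩
          have hkij : k = i ∨ k = j := by
            by_contra! h
            exact hk (hΨk k h.1 h.2)
          rcases hkij with rfl | rfl
          · rcases hΧ with rfl | rfl
            · exact ⟨g * σ, Subgroup.mul_mem _ hg hσm, Or.inr (by
                rw [mul_smul, hadj, smul_adj])⟩
            · refine ⟨g * σ⁻¹, Subgroup.mul_mem _ hg (Subgroup.inv_mem _ hσm), Or.inl ?_⟩
              rw [← inv_smul_eq_iff.2 hadj.symm, ← mul_smul, smul_adj, adj_adj]
          · rcases hΧ with rfl | rfl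
            · exact ⟨g, hg, Or.inr (by rw [smul_adj])⟩
            · exact ⟨g, hg, Or.inl (by rw [smul_adj, adj_adj])⟩)
      obtain ⟨g, hg, hΨ'⟩ := key
      refine ⟨g, hg, ?_⟩
      rw [hΨH]
      rcases hΨ' with h | h
      · rw [h, face_smul _ _ (mem_Icc_self i)]
      · rw [h, face_smul _ _ (mem_Icc_self i), face_adj _ (mem_Icc_self i) (by omega)]
  rw [← hbij.image_eq, hbij.injOn.ncard_image]

end Rotations

/-! ### Reconstructing a based polytope from its rotations -/

section Transfer

variable (hP : P.IsChiral) (hQ : Q.IsChiral) (Φ : Flag P.Face) (Ψ : Flag Q.Face)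

/-- In rank at least 3 some proper rank differs from those of `F` and `G`. If a flag through both
lies in the wrong orbit, changing its face of that rank moves it to the right one without disturbing
`F` and `G`. -/
theorem exists_apply_face_eq (hP : P.IsChiral) (hn : 3 ≤ n) (Φ : Flag P.Face) {F G : P.Face}
    (h : F ≤ G) :
    ∃ g : P.AutomorphismGroup, g (face Φ (P.rank F)) = F ∧ g (face Φ (P.rank G)) = G := by
  obtain ⟨Χ, hΧ⟩ := exists_flag_of_isChain (P := P) (c := {F, G}) (IsChain.pair h)
  have hF : F ∈ Χ := hΧ (by simp)
  have hG : G ∈ Χ := hΧ (by simp)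
  obtain ⟨i, hiF, hiG⟩ : ∃ i : Fin n, P.rank F ≠ i ∧ P.rank G ≠ i := by
    by_contra! hcon
    have h0 := hcon ⟨0, by omega⟩
    have h1 := hcon ⟨1, by omega⟩
    have h2 := hcon ⟨2, by omega⟩
    simp only [Nat.cast_zero, Nat.cast_one, Nat.cast_ofNat] at h0 h1 h2
    grind
  rcases hP.smul_eq_or_smul_eq i Φ Χ with ⟨g, hg⟩ | ⟨g, hg⟩
  · refine ⟨g, ?_, ?_⟩ <;>
      rw [← face_smul _ _ (rank_mem _), hg, face_rank (by assumption)]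
  · refine ⟨g, ?_, ?_⟩ <;>
      rw [← face_smul _ _ (rank_mem _), hg, face_adj _ (rank_mem _) (by assumption),
        face_rank (by assumption)]

/-- The map on faces induced by a homomorphism of automorphism groups that matches the rotations
about the base flags. -/
noncomputable def transfer (hn : 3 ≤ n) (θ : P.AutomorphismGroup →* Q.AutomorphismGroup)
    (F : P.Face) : Q.Face :=
  θ (exists_apply_face_eq hP hn Φ (le_refl F)).choose (face Ψ (P.rank F))

variable {hP hQ Φ Ψ} {θ : P.AutomorphismGroup →* Q.AutomorphismGroup}

/-- Face stabilizers are generated by rotations avoiding the rank, and these are matched by `θ`.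
This makes `transfer` independent of the chosen automorphism. -/
theorem map_apply_face_eq (hθ : ∀ i j, θ (rotation hP Φ i j) = rotation hQ Ψ i j) {k : ℤ}
    (hk : k ∈ Set.Icc (-1) (n : ℤ)) {g : P.AutomorphismGroup} (h : g (face Φ k) = face Φ k) :
    θ g (face Ψ k) = face Ψ k := by
  have h1 := mem_closure_rotation hP Φ (J := {j | (j : ℤ) = k}) (g := g) (by
    rintro j rfl
    exact h)
  have h2 : Subgroup.closure {τ | ∃ i j, i ∉ {j : Fin n | (j : ℤ) = k} ∧
      j ∉ {j : Fin n | (j : ℤ) = k} ∧ rotation hP Φ i j = τ} ≤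
      (MulAction.stabilizer Q.AutomorphismGroup (face Ψ k)).comap θ := by
    rw [Subgroup.closure_le]
    rintro _ ⟨i, j, hi, hj, rfl⟩
    simp only [Subgroup.coe_comap, Set.mem_preimage, SetLike.mem_coe,
      MulAction.mem_stabilizer_iff, hθ]
    exact face_rotation_smul hQ Ψ hk (Ne.symm hi) (Ne.symm hj)
  exact h2 h1

theorem transfer_apply (hn : 3 ≤ n) (hθ : ∀ i j, θ (rotation hP Φ i j) = rotation hQ Ψ i j) {k : ℤ}
    (hk : k ∈ Set.Icc (-1) (n : ℤ)) (g : P.AutomorphismGroup) :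
    transfer hP Φ Ψ hn θ (g (face Φ k)) = θ g (face Ψ k) := by
  have hr : P.rank (g (face Φ k)) = k := by rw [rank_apply, rank_face Φ hk]
  have h := (exists_apply_face_eq hP hn Φ (le_refl (g (face Φ k)))).choose_spec.1
  unfold transfer
  set h' := (exists_apply_face_eq hP hn Φ (le_refl (g (face Φ k)))).choose
  rw [hr] at h ⊢
  have := map_apply_face_eq hθ hk (g := g⁻¹ * h') (by
    change g.symm (h' (face Φ k)) = _
    rw [h, OrderIso.symm_apply_apply])
  rw [map_mul, map_inv] at this
  change (θ g).symm (θ h' (face Ψ k)) = _ at this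
  rw [← OrderIso.symm_apply_eq, this]

theorem transfer_monotone (hn : 3 ≤ n)
    (hθ : ∀ i j, θ (rotation hP Φ i j) = rotation hQ Ψ i j) :
    Monotone (transfer hP Φ Ψ hn θ) := by
  intro F G h
  obtain ⟨g, hF, hG⟩ := exists_apply_face_eq hP hn Φ h
  rw [← hF, ← hG, transfer_apply hn hθ (rank_mem _), transfer_apply hn hθ (rank_mem _)]
  refine (θ g).monotone ?_
  rw [le_iff_rank_le (face_mem Ψ (rank_mem _)) (face_mem Ψ (rank_mem _)),
    rank_face Ψ (rank_mem _), rank_face Ψ (rank_mem _)]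
  exact P.rank_strictMono.monotone h

theorem transfer_transfer (hn : 3 ≤ n) (θ : P.AutomorphismGroup ≃* Q.AutomorphismGroup)
    (hθ : ∀ i j, θ (rotation hP Φ i j) = rotation hQ Ψ i j) (F : P.Face) :
    transfer hQ Ψ Φ hn (θ.symm : Q.AutomorphismGroup →* P.AutomorphismGroup)
      (transfer hP Φ Ψ hn (θ : P.AutomorphismGroup →* Q.AutomorphismGroup) F) = F := by
  obtain ⟨g, hF, -⟩ := exists_apply_face_eq hP hn Φ (le_refl F)
  rw [← hF, transfer_apply hn hθ (rank_mem _), transfer_apply (hQ := hP) hn _ (rank_mem _)]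
  · simp
  · intro i j
    change θ.symm _ = _
    rw [MulEquiv.symm_apply_eq, hθ]

/-- A chiral polytope with a base flag is determined by its automorphism group with the rotations
about the base flag. -/
theorem exists_orderIso_of_mulEquiv (hn : 3 ≤ n)
    (θ : P.AutomorphismGroup ≃* Q.AutomorphismGroup)
    (hθ : ∀ i j, θ (rotation hP Φ i j) = rotation hQ Ψ i j) :
    ∃ f : P.Face ≃o Q.Face, Flag.map f Φ = Ψ := by
  have hθ' : ∀ i j, θ.symm (rotation hQ Ψ i j) = rotation hP Φ i j := fun i j => by
    rw [MulEquiv.symm_apply_eq, hθ]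
  let f : P.Face ≃o Q.Face := Equiv.toOrderIso
    { toFun := transfer hP Φ Ψ hn (θ : P.AutomorphismGroup →* Q.AutomorphismGroup)
      invFun := transfer hQ Ψ Φ hn (θ.symm : Q.AutomorphismGroup →* P.AutomorphismGroup)
      left_inv := transfer_transfer hn θ hθ
      right_inv := transfer_transfer hn θ.symm hθ' }
    (transfer_monotone hn hθ) (transfer_monotone hn hθ')
  refine ⟨f, flag_ext fun k hk => ?_⟩
  rw [face_map f Φ hk]
  change transfer hP Φ Ψ hn (θ : P.AutomorphismGroup →* Q.AutomorphismGroup) (face Φ k) = _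
  have := transfer_apply (θ := (θ : P.AutomorphismGroup →* Q.AutomorphismGroup)) hn hθ hk 1
  simpa using this

/-- The isomorphism of automorphism groups induced by an isomorphism of polytopes. -/
def automorphismGroupCongr (f : P.Face ≃o Q.Face) : P.AutomorphismGroup ≃* Q.AutomorphismGroup where
  toFun g := (f.symm.trans g).trans f
  invFun g := (f.trans g).trans f.symm
  left_inv g := by ext; simp
  right_inv g := by ext; simp
  map_mul' g h := by ext; simp [RelIso.mul_apply]

theorem automorphismGroupCongr_rotation (f : P.Face ≃o Q.Face) (hf : Flag.map f Φ = Ψ)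
    (i j : Fin n) :
    automorphismGroupCongr f (rotation hP Φ i j) = rotation hQ Ψ i j := by
  refine eq_of_smul_eq (Φ := Ψ) ?_
  rw [rotation_smul, ← hf, ← map_adj, ← map_adj, ← rotation_smul hP]
  refine SetLike.coe_injective ?_
  rw [Flag.coe_smul, Flag.coe_map, Flag.coe_map, Flag.coe_smul]
  ext F
  simp only [Set.mem_smul_set, Set.mem_image, automorphismGroupCongr]
  constructor
  · rintro ⟨_, ⟨G, hG, rfl⟩, rfl⟩
    refine ⟨_, ⟨G, hG, rfl⟩, ?_⟩
    simp
  · rintro ⟨_, ⟨G, hG, rfl⟩, rfl⟩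
    refine ⟨_, ⟨G, hG, rfl⟩, ?_⟩
    simp

end Transfer

end AbstractPolytope

/-! ### Coset geometries -/

/-- A family of subgroups whose cosets, with incidence given by nonempty intersection, form a
partially ordered set. -/
structure CosetGeometry (G : Type u) [Group G] (m : ℕ) where
  /-- The subgroups. -/
  subgroup : Fin m → Subgroup G
  -- This factorization is transitivity of incidence: cosets of `subgroup i` and `subgroup k` that
  -- meet a common coset of `subgroup j` meet each other inside it.
  factor : ∀ i j k, i < j → j < k → ∀ g ∈ subgroup j,
    ∃ a ∈ subgroup i ⊓ subgroup j, ∃ b ∈ subgroup j ⊓ subgroup k, g = a * b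

namespace CosetGeometry

variable {G : Type u} [Group G] {m : ℕ} (Γ : CosetGeometry G m)

/-- The cosets of the subgroups. -/
def Face : Type u := Σ k : Fin m, G ⧸ Γ.subgroup k

variable {Γ}

/-- The index of the subgroup of which a face is a coset. -/
def idx (x : Γ.Face) : Fin m := x.1

variable (Γ)

/-- The coset of `g`. -/
def coset (k : Fin m) (g : G) : Γ.Face := ⟨k, (g : G ⧸ Γ.subgroup k)⟩

variable {Γ}

@[simp] theorem idx_coset (k : Fin m) (g : G) : idx (Γ.coset k g) = k := rfl

theorem coset_eq_coset {k : Fin m} {g h : G} : Γ.coset k g = Γ.coset k h ↔ g⁻¹ * h ∈ Γ.subgroup k := by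
  rw [← QuotientGroup.eq]
  exact ⟨fun h => eq_of_heq (Sigma.mk.inj h).2, fun h => by unfold coset; rw [h]⟩

theorem exists_eq_coset (x : Γ.Face) : ∃ g, x = Γ.coset (idx x) g := by
  obtain ⟨k, c⟩ := x
  obtain ⟨g, rfl⟩ := QuotientGroup.mk_surjective c
  exact ⟨g, rfl⟩

theorem exists_coset_eq_coset_eq_coset_eq {i j k : Fin m} (hij : i < j) (hjk : j < k) {g h : G}
    (e : Γ.coset j g = Γ.coset j h) :
    ∃ c, Γ.coset i c = Γ.coset i g ∧ Γ.coset j c = Γ.coset j g ∧ Γ.coset k c = Γ.coset k h := by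
  obtain ⟨a, ⟨ha, ha'⟩, b, ⟨hb, hb'⟩, hab⟩ := Γ.factor i j k hij hjk _ (coset_eq_coset.1 e)
  refine ⟨g * a, coset_eq_coset.2 ?_, coset_eq_coset.2 ?_, coset_eq_coset.2 ?_⟩
  · simpa using ha
  · simpa using ha'
  · rwa [show (g * a)⁻¹ * h = b by rw [mul_inv_rev, mul_assoc, hab]; group]

instance : PartialOrder Γ.Face where
  le x y := idx x ≤ idx y ∧ ∃ g, Γ.coset (idx x) g = x ∧ Γ.coset (idx y) g = y
  le_refl x := by
    obtain ⟨g, hg⟩ := exists_eq_coset x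
    exact ⟨le_rfl, g, hg.symm, hg.symm⟩
  le_antisymm x y := by
    rintro ⟨h1, g, hx, hy⟩ ⟨h2, -⟩
    rw [← hx, ← hy, le_antisymm h1 h2]
  le_trans x y z := by
    rintro ⟨h1, g, hx, hy⟩ ⟨h2, h, hy', hz⟩
    refine ⟨h1.trans h2, ?_⟩
    rcases h1.eq_or_lt with e | h1
    · exact ⟨h, by rw [← hx, e]; exact hy'.trans hy.symm, hz⟩
    rcases h2.eq_or_lt with e | h2
    · exact ⟨g, hx, by rw [← hz, ← e]; exact hy.trans hy'.symm⟩
    obtain ⟨c, hc1, -, hc3⟩ := exists_coset_eq_coset_eq_coset_eq h1 h2 (hy.trans hy'.symm)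
    exact ⟨c, hc1.trans hx, hc3.trans hz⟩

theorem coset_le_coset {k l : Fin m} (h : k ≤ l) (g : G) : Γ.coset k g ≤ Γ.coset l g := ⟨h, g, rfl, rfl⟩

theorem eq_of_le_of_idx_eq {x y : Γ.Face} (h : x ≤ y) (e : idx x = idx y) : x = y := by
  obtain ⟨-, g, hx, hy⟩ := h
  rw [← hx, ← hy, e]

theorem idx_strictMono : StrictMono (idx : Γ.Face → Fin m) := fun _ _ h =>
  h.le.1.lt_of_ne fun e => h.ne (eq_of_le_of_idx_eq h.le e)

theorem eq_of_mem_flag {Φ : Flag Γ.Face} {x y : Γ.Face} (hx : x ∈ Φ) (hy : y ∈ Φ)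
    (e : idx x = idx y) : x = y := by
  rcases Φ.le_or_le hx hy with h | h
  · exact eq_of_le_of_idx_eq h e
  · exact (eq_of_le_of_idx_eq h e.symm).symm

theorem le_of_mem_flag {Φ : Flag Γ.Face} {x y : Γ.Face} (hx : x ∈ Φ) (hy : y ∈ Φ)
    (e : idx x ≤ idx y) : x ≤ y := by
  rcases Φ.le_or_le hx hy with h | h
  · exact h
  · exact (eq_of_le_of_idx_eq h (le_antisymm h.1 e)).ge

/-- If index `k` were missing, an element common to the nearest cosets below and above it would give
a coset of index `k` comparable with the whole flag, against maximality. -/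
theorem exists_mem_flag_idx (Φ : Flag Γ.Face) (k : Fin m) : ∃ x ∈ Φ, idx x = k := by
  by_contra! hcon
  have key : ∀ x : Γ.Face, idx x = k → (∀ y ∈ Φ, idx y < k → y ≤ x) →
      (∀ y ∈ Φ, k < idx y → x ≤ y) → False := by
    intro x hx h1 h2
    refine hcon x (Flag.mem_iff_forall_le_or_ge.2 fun y hy => ?_) hx
    rcases lt_or_gt_of_ne (hcon y hy) with h | h
    · exact Or.inr (h1 y hy h)
    · exact Or.inl (h2 y hy h)
  have hlow : (∃ y ∈ Φ, idx y < k) → ∃ y ∈ Φ, idx y < k ∧ ∀ z ∈ Φ, idx z < k → z ≤ y := by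
    rintro ⟨y, hy, hyk⟩
    obtain ⟨_, ⟨z, ⟨hz, hzk⟩, rfl⟩, hmax⟩ := WellFounded.has_min
      (wellFounded_gt : WellFounded ((· > ·) : Fin m → Fin m → Prop))
      (idx '' {y : Γ.Face | y ∈ Φ ∧ idx y < k}) ⟨_, y, ⟨hy, hyk⟩, rfl⟩
    exact ⟨z, hz, hzk, fun w hw hwk =>
      le_of_mem_flag hw hz (not_lt.1 (hmax _ ⟨w, ⟨hw, hwk⟩, rfl⟩))⟩
  have hhigh : (∃ y ∈ Φ, k < idx y) → ∃ y ∈ Φ, k < idx y ∧ ∀ z ∈ Φ, k < idx z → y ≤ z := by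
    rintro ⟨y, hy, hyk⟩
    obtain ⟨_, ⟨z, ⟨hz, hzk⟩, rfl⟩, hmin⟩ := WellFounded.has_min
      (wellFounded_lt : WellFounded ((· < ·) : Fin m → Fin m → Prop))
      (idx '' {y : Γ.Face | y ∈ Φ ∧ k < idx y}) ⟨_, y, ⟨hy, hyk⟩, rfl⟩
    exact ⟨z, hz, hzk, fun w hw hwk =>
      le_of_mem_flag hz hw (not_lt.1 (hmin _ ⟨w, ⟨hw, hwk⟩, rfl⟩))⟩
  by_cases h1 : ∃ y ∈ Φ, idx y < k <;> by_cases h2 : ∃ y ∈ Φ, k < idx y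
  · obtain ⟨y, hy, hyk, hymax⟩ := hlow h1
    obtain ⟨z, hz, hzk, hzmin⟩ := hhigh h2
    obtain ⟨-, g, hgy, hgz⟩ := le_of_mem_flag hy hz (hyk.trans hzk).le
    refine key (Γ.coset k g) rfl (fun w hw hwk => (hymax w hw hwk).trans ?_)
      fun w hw hwk => le_trans ?_ (hzmin w hw hwk)
    · rw [← hgy]
      exact coset_le_coset hyk.le g
    · rw [← hgz]
      exact coset_le_coset hzk.le g
  · obtain ⟨y, hy, hyk, hymax⟩ := hlow h1
    obtain ⟨g, hg⟩ := exists_eq_coset y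
    refine key (Γ.coset k g) rfl (fun w hw hwk => (hymax w hw hwk).trans ?_)
      fun w hw hwk => absurd ⟨w, hw, hwk⟩ h2
    rw [hg]
    exact coset_le_coset hyk.le g
  · obtain ⟨y, hy, hyk, hymin⟩ := hhigh h2
    obtain ⟨g, hg⟩ := exists_eq_coset y
    refine key (Γ.coset k g) rfl (fun w hw hwk => absurd ⟨w, hw, hwk⟩ h1)
      fun w hw hwk => le_trans ?_ (hymin w hw hwk)
    rw [hg]
    exact coset_le_coset hyk.le g
  · exact key (Γ.coset k 1) rfl (fun w hw hwk => absurd ⟨w, hw, hwk⟩ h1)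
      fun w hw hwk => absurd ⟨w, hw, hwk⟩ h2

/-- The faces of rank `j` between two incident faces are counted by a cyclic transversal. -/
theorem ncard_between {x y : Γ.Face} (hxy : x ≤ y) {j : Fin m} (hxj : idx x < j) (hjy : j < idx y)
    {s : G} (hs : s ∈ Γ.subgroup (idx x) ⊓ Γ.subgroup (idx y))
    (h1 : ∀ a ∈ Γ.subgroup (idx x) ⊓ Γ.subgroup (idx y),
      ∃ c ∈ Subgroup.zpowers s, c⁻¹ * a ∈ Γ.subgroup j)
    (h2 : ∀ c ∈ Subgroup.zpowers s, c ∈ Γ.subgroup j → c = 1) :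
    {z | x < z ∧ z < y ∧ idx z = j}.ncard = orderOf s := by
  obtain ⟨-, g, hgx, hgy⟩ := hxy
  have hbij : Set.BijOn (fun c => Γ.coset j (g * c)) (Subgroup.zpowers s)
      {z | x < z ∧ z < y ∧ idx z = j} := by
    refine ⟨fun c hc => ⟨?_, ?_, rfl⟩, fun c hc d hd e => ?_, fun z hz => ?_⟩
    · have hc' := (Subgroup.zpowers_le.2 hs hc).1
      refine lt_of_le_of_ne ?_ fun e => hxj.ne (by rw [e]; rfl)
      rw [← hgx, coset_eq_coset.2 (show g⁻¹ * (g * c) ∈ _ by simpa using hc')]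
      exact coset_le_coset hxj.le _
    · have hc' := (Subgroup.zpowers_le.2 hs hc).2
      refine lt_of_le_of_ne ?_ fun e => hjy.ne (by rw [← e]; rfl)
      rw [← hgy, coset_eq_coset.2 (show g⁻¹ * (g * c) ∈ _ by simpa using hc')]
      exact coset_le_coset hjy.le _
    · have := coset_eq_coset.1 e
      rw [show (g * c)⁻¹ * (g * d) = c⁻¹ * d by group] at this
      exact inv_mul_eq_one.1
        (h2 _ (Subgroup.mul_mem _ (Subgroup.inv_mem _ hc) hd) this)
    · obtain ⟨hz1, hz2, hz3⟩ := hz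
      obtain ⟨-, a, hax, haz⟩ := hz1.le
      obtain ⟨-, b, hbz, hby⟩ := hz2.le
      rw [hz3] at haz hbz
      obtain ⟨d, hdx, hdz, hdy⟩ := exists_coset_eq_coset_eq_coset_eq hxj hjy (haz.trans hbz.symm)
      obtain ⟨c, hc, hc'⟩ := h1 (g⁻¹ * d) ⟨coset_eq_coset.1 (by rw [hdx, hax, hgx]),
        coset_eq_coset.1 (by rw [hdy, hby, hgy])⟩
      refine ⟨c, hc, ?_⟩
      change Γ.coset j (g * c) = z
      rw [← haz, ← hdz, coset_eq_coset, mul_inv_rev, mul_assoc]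
      exact hc'
  rw [← hbij.image_eq, hbij.injOn.ncard_image, ← Nat.card_zpowers]
  rfl

/-- The flag formed by the cosets of the group elements `a k`. -/
def flagOf (a : Fin m → G)
    (ha : ∀ k l, k < l → ∃ g, Γ.coset k g = Γ.coset k (a k) ∧ Γ.coset l g = Γ.coset l (a l)) :
    Flag Γ.Face where
  carrier := Set.range fun k => Γ.coset k (a k)
  Chain' := by
    rintro _ ⟨k, rfl⟩ _ ⟨l, rfl⟩ hne
    rcases lt_trichotomy k l with h | h | h
    · exact Or.inl ⟨h.le, ha k l h⟩
    · exact absurd (by rw [h]) hne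
    · exact Or.inr ⟨h.le, ha l k h⟩
  max_chain' t ht hct := by
    refine hct.antisymm fun x hx => ⟨idx x, ?_⟩
    rcases ht.total (hct ⟨idx x, rfl⟩) hx with h | h
    · exact eq_of_le_of_idx_eq h rfl
    · exact (eq_of_le_of_idx_eq h rfl).symm

section FlagOf

variable {a b : Fin m → G}
  {ha : ∀ k l, k < l → ∃ g, Γ.coset k g = Γ.coset k (a k) ∧ Γ.coset l g = Γ.coset l (a l)}
  {hb : ∀ k l, k < l → ∃ g, Γ.coset k g = Γ.coset k (b k) ∧ Γ.coset l g = Γ.coset l (b l)}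

theorem coset_mem_flagOf (k : Fin m) : Γ.coset k (a k) ∈ flagOf a ha := ⟨k, rfl⟩

theorem mem_flagOf {x : Γ.Face} : x ∈ flagOf a ha ↔ x = Γ.coset (idx x) (a (idx x)) := by
  constructor
  · rintro ⟨k, rfl⟩
    rfl
  · intro h
    rw [h]
    exact coset_mem_flagOf _

theorem eq_flagOf {Φ : Flag Γ.Face} (h : ∀ k, Γ.coset k (a k) ∈ Φ) : Φ = flagOf a ha := by
  refine SetLike.coe_injective ((flagOf a ha).max_chain' Φ.Chain' ?_).symm
  rintro _ ⟨k, rfl⟩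
  exact h k

theorem flagOf_adjacent {i : Fin m} (h : ∀ k, k ≠ i → Γ.coset k (a k) = Γ.coset k (b k))
    (hi : Γ.coset i (a i) ≠ Γ.coset i (b i)) : (flagOf a ha).Adjacent (flagOf b hb) := by
  refine ⟨Γ.coset i (a i), Γ.coset i (b i), ?_, ?_⟩
  · ext x
    simp only [Set.mem_sdiff, SetLike.mem_coe, mem_flagOf, Set.mem_singleton_iff]
    constructor
    · rintro ⟨h1, h2⟩
      by_cases hx : idx x = i
      · rw [h1, hx]
      · exact absurd (h1.trans (h _ hx)) h2
    · rintro rfl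
      exact ⟨rfl, hi⟩
  · ext x
    simp only [Set.mem_sdiff, SetLike.mem_coe, mem_flagOf, Set.mem_singleton_iff]
    constructor
    · rintro ⟨h1, h2⟩
      by_cases hx : idx x = i
      · rw [h1, hx]
      · exact absurd (h1.trans (h _ hx).symm) h2
    · rintro rfl
      exact ⟨rfl, hi.symm⟩

theorem subset_flagOf_of_agree {i : Fin m} (h : ∀ k, k ≠ i → Γ.coset k (a k) = Γ.coset k (b k))
    {S : Set Γ.Face} (hS : S ⊆ flagOf a ha) (hi : ∀ x ∈ S, idx x ≠ i) : S ⊆ flagOf b hb :=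
  fun x hx => mem_flagOf.2 ((mem_flagOf.1 (hS hx)).trans (h _ (hi x hx)))

end FlagOf

instance : MulAction G Γ.Face where
  smul g x := ⟨x.1, g • x.2⟩
  one_smul x := Sigma.ext rfl (heq_of_eq (one_smul G x.2))
  mul_smul g h x := Sigma.ext rfl (heq_of_eq (mul_smul g h x.2))

@[simp] theorem smul_coset (g : G) (k : Fin m) (h : G) :
    g • Γ.coset k h = Γ.coset k (g * h) := rfl

@[simp] theorem idx_smul (g : G) (x : Γ.Face) : idx (g • x) = idx x := rfl

theorem smul_le_smul_of_le (g : G) {x y : Γ.Face} (h : x ≤ y) : g • x ≤ g • y := by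
  obtain ⟨h1, h, hx, hy⟩ := h
  refine ⟨h1, g * h, ?_, ?_⟩
  · rw [idx_smul, ← smul_coset, hx]
  · rw [idx_smul, ← smul_coset, hy]

variable (Γ)

/-- The action of a group element on the cosets by multiplication on the left. -/
def translate : G →* (Γ.Face ≃o Γ.Face) where
  toFun g := Equiv.toOrderIso (MulAction.toPerm g) (fun _ _ h => smul_le_smul_of_le g h)
    fun _ _ h => smul_le_smul_of_le g⁻¹ h
  map_one' := by ext x; exact one_smul G x
  map_mul' g h := by ext x; exact mul_smul g h x

variable {Γ}

@[simp] theorem translate_coset (g : G) (k : Fin m) (h : G) :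
    Γ.translate g (Γ.coset k h) = Γ.coset k (g * h) := rfl

theorem map_translate_flagOf {a b : Fin m → G}
    {ha : ∀ k l, k < l → ∃ g, Γ.coset k g = Γ.coset k (a k) ∧ Γ.coset l g = Γ.coset l (a l)}
    {hb : ∀ k l, k < l → ∃ g, Γ.coset k g = Γ.coset k (b k) ∧ Γ.coset l g = Γ.coset l (b l)} {g : G}
    (h : ∀ k, b k = g * a k) : Flag.map (Γ.translate g) (flagOf a ha) = flagOf b hb := by
  refine eq_flagOf fun k => ⟨Γ.coset k (a k), coset_mem_flagOf k, ?_⟩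
  rw [translate_coset, h]

end CosetGeometry

/-! ### Rotary generators and the intersections of the face stabilizers -/

/-- The relations say that `s` inverts `r`, so the generated group is a quotient of a dihedral
group. -/
theorem exists_zpow_of_mem_closure_pair {G : Type*} [Group G] {r s : G} (hs : s ^ 2 = 1)
    (hrs : (r * s) ^ 2 = 1) {g : G} (hg : g ∈ Subgroup.closure {r, s}) :
    ∃ k : ℤ, g = r ^ k ∨ g = r ^ k * s := by
  have hs' : s * s = 1 := by rw [← pow_two, hs]
  have hsi : s⁻¹ = s := inv_eq_of_mul_eq_one_right hs'
  have hconj : s * r * s⁻¹ = r⁻¹ := by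
    rw [hsi]
    refine (inv_eq_of_mul_eq_one_right ?_).symm
    rw [← hrs, pow_two]; group
  have hk : ∀ k : ℤ, s * r ^ k = r ^ (-k) * s := fun k => by
    have := conj_zpow (i := k) (a := s) (b := r)
    rw [hconj, inv_zpow, ← zpow_neg] at this
    rw [this, inv_mul_cancel_right]
  induction hg using Subgroup.closure_induction with
  | mem x hx =>
    rcases hx with rfl | rfl
    · exact ⟨1, Or.inl (by simp)⟩
    · exact ⟨0, Or.inr (by simp)⟩
  | one => exact ⟨0, Or.inl (by simp)⟩
  | mul x y _ _ ihx ihy =>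
    obtain ⟨k, rfl | rfl⟩ := ihx <;> obtain ⟨l, rfl | rfl⟩ := ihy
    · exact ⟨k + l, Or.inl (by rw [zpow_add])⟩
    · exact ⟨k + l, Or.inr (by rw [zpow_add, mul_assoc])⟩
    · exact ⟨k - l, Or.inr (by rw [mul_assoc, hk, ← mul_assoc, ← zpow_add, sub_eq_add_neg])⟩
    · exact ⟨k - l, Or.inl (by
        rw [mul_assoc, ← mul_assoc s, hk, mul_assoc, hs', mul_one, ← zpow_add, sub_eq_add_neg])⟩
  | inv x _ ih =>
    obtain ⟨k, rfl | rfl⟩ := ih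
    · exact ⟨-k, Or.inl (by rw [zpow_neg])⟩
    · exact ⟨k, Or.inr (by rw [mul_inv_rev, hsi, ← zpow_neg, hk, neg_neg])⟩

theorem eq_one_of_mem_zpowers_of_coprime {G : Type*} [Group G] {r s g : G}
    (h : (orderOf r).Coprime (orderOf s)) (hr : g ∈ Subgroup.zpowers r)
    (hs : g ∈ Subgroup.zpowers s) : g = 1 := by
  rw [← orderOf_eq_one_iff]
  refine Nat.dvd_one.1 (h ▸ Nat.dvd_gcd ?_ ?_)
  · exact orderOf_dvd_of_mem_zpowers hr
  · exact orderOf_dvd_of_mem_zpowers hs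

/-- The relations between the distinguished generators of the rotation group of a chiral
`4`-polytope of type `[5, 3, 4]`. -/
structure IsRotaryTriple {G : Type*} [Group G] (σ₁ σ₂ σ₃ : G) : Prop where
  orderOf_fst : orderOf σ₁ = 5
  orderOf_snd : orderOf σ₂ = 3
  orderOf_thd : orderOf σ₃ = 4
  sq_fst_snd : (σ₁ * σ₂) ^ 2 = 1
  sq_snd_thd : (σ₂ * σ₃) ^ 2 = 1
  sq_fst_snd_thd : (σ₁ * σ₂ * σ₃) ^ 2 = 1

/-- A generating triple with the intersection property. -/
structure IsRotaryGenerators {G : Type*} [Group G] (σ₁ σ₂ σ₃ : G) : Prop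
    extends IsRotaryTriple σ₁ σ₂ σ₃ where
  closure_eq_top : Subgroup.closure {σ₁, σ₂, σ₃} = ⊤
  inf_le : Subgroup.closure {σ₂, σ₃} ⊓ Subgroup.closure {σ₁, σ₂} ≤ Subgroup.zpowers σ₂

namespace IsRotaryGenerators

open Subgroup

variable {G : Type u} [Group G] {σ₁ σ₂ σ₃ : G} (h : IsRotaryGenerators σ₁ σ₂ σ₃)
include h

theorem fst_ne_one : σ₁ ≠ 1 := fun e => by
  have := h.orderOf_fst; rw [e, orderOf_one] at this; omega

theorem snd_ne_one : σ₂ ≠ 1 := fun e => by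
  have := h.orderOf_snd; rw [e, orderOf_one] at this; omega

theorem thd_ne_one : σ₃ ≠ 1 := fun e => by
  have := h.orderOf_thd; rw [e, orderOf_one] at this; omega

theorem sq_thd_fst_snd : (σ₃ * (σ₁ * σ₂)) ^ 2 = 1 := by
  have := h.sq_fst_snd_thd
  rw [pow_two] at this ⊢
  have h2 : σ₃ * (σ₁ * σ₂ * σ₃ * (σ₁ * σ₂ * σ₃)) * σ₃⁻¹ = 1 := by rw [this]; group
  rw [← h2]; group

theorem sq_fst_snd_thd' : (σ₁ * (σ₂ * σ₃)) ^ 2 = 1 := by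
  rw [← mul_assoc]; exact h.sq_fst_snd_thd

theorem fst_snd_eq : σ₁ * σ₂ = σ₂⁻¹ * σ₁⁻¹ := by
  rw [← mul_inv_rev]; exact eq_inv_of_mul_eq_one_left (by rw [← pow_two, h.sq_fst_snd])

theorem snd_thd_eq : σ₂ * σ₃ = σ₃⁻¹ * σ₂⁻¹ := by
  rw [← mul_inv_rev]; exact eq_inv_of_mul_eq_one_left (by rw [← pow_two, h.sq_snd_thd])

theorem inv_fst_snd_thd : (σ₁ * σ₂ * σ₃)⁻¹ = σ₁ * σ₂ * σ₃ :=
  inv_eq_of_mul_eq_one_left (by rw [← pow_two, h.sq_fst_snd_thd])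

theorem fst_snd_eq_thd_mul : σ₁ * σ₂ = σ₃ * (σ₁ * σ₂ * σ₃) := by
  rw [← h.inv_fst_snd_thd, mul_inv_rev, mul_inv_cancel_left, mul_inv_rev, ← h.fst_snd_eq]

theorem snd_thd_eq_mul_fst : σ₂ * σ₃ = σ₁ * σ₂ * σ₃ * σ₁ := by
  rw [← h.inv_fst_snd_thd, mul_assoc, mul_inv_rev, inv_mul_cancel_right, mul_inv_rev,
    ← h.snd_thd_eq]

theorem mem_closure_thd {g : G} (hg : g ∈ closure {σ₃, σ₁ * σ₂}) :
    ∃ k : ℤ, g = σ₃ ^ k ∨ g = σ₃ ^ k * (σ₁ * σ₂) :=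
  exists_zpow_of_mem_closure_pair h.sq_fst_snd h.sq_thd_fst_snd hg

theorem mem_closure_fst {g : G} (hg : g ∈ closure {σ₁, σ₂ * σ₃}) :
    ∃ k : ℤ, g = σ₁ ^ k ∨ g = σ₁ ^ k * (σ₂ * σ₃) :=
  exists_zpow_of_mem_closure_pair h.sq_snd_thd h.sq_fst_snd_thd' hg

-- The subscripts 0 to 3 below refer to the stabilizers of the base faces of these ranks: ⟨σ₂, σ₃⟩,
-- ⟨σ₃, σ₁σ₂⟩, ⟨σ₁, σ₂σ₃⟩ and ⟨σ₁, σ₂⟩. The middle two are dihedral.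
omit h in
theorem mem₀_snd : σ₂ ∈ closure {σ₂, σ₃} := subset_closure (by simp)
omit h in
theorem mem₀_thd : σ₃ ∈ closure {σ₂, σ₃} := subset_closure (by simp)
omit h in
theorem mem₁_thd : σ₃ ∈ closure {σ₃, σ₁ * σ₂} := subset_closure (by simp)
omit h in
theorem mem₁_fst_snd : σ₁ * σ₂ ∈ closure {σ₃, σ₁ * σ₂} := subset_closure (by simp)
omit h in
theorem mem₂_fst : σ₁ ∈ closure {σ₁, σ₂ * σ₃} := subset_closure (by simp)
omit h in
theorem mem₂_snd_thd : σ₂ * σ₃ ∈ closure {σ₁, σ₂ * σ₃} := subset_closure (by simp)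
omit h in
theorem mem₃_fst : σ₁ ∈ closure {σ₁, σ₂} := subset_closure (by simp)
omit h in
theorem mem₃_snd : σ₂ ∈ closure {σ₁, σ₂} := subset_closure (by simp)
omit h in
theorem mem₁_fst_snd_thd : σ₁ * σ₂ * σ₃ ∈ closure {σ₃, σ₁ * σ₂} :=
  mul_mem mem₁_fst_snd mem₁_thd
omit h in
theorem mem₂_fst_snd_thd : σ₁ * σ₂ * σ₃ ∈ closure {σ₁, σ₂ * σ₃} := by
  rw [mul_assoc]; exact mul_mem mem₂_fst mem₂_snd_thd

theorem eq_one_fst_snd {k l : ℤ} (e : σ₁ ^ k = σ₂ ^ l) : σ₁ ^ k = 1 :=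
  eq_one_of_mem_zpowers_of_coprime (r := σ₁) (s := σ₂)
    (by rw [h.orderOf_fst, h.orderOf_snd]; norm_num) ⟨k, rfl⟩ ⟨l, e.symm⟩

theorem eq_one_fst_thd {k l : ℤ} (e : σ₁ ^ k = σ₃ ^ l) : σ₁ ^ k = 1 :=
  eq_one_of_mem_zpowers_of_coprime (r := σ₁) (s := σ₃)
    (by rw [h.orderOf_fst, h.orderOf_thd]; norm_num) ⟨k, rfl⟩ ⟨l, e.symm⟩

theorem eq_one_snd_thd {k l : ℤ} (e : σ₂ ^ k = σ₃ ^ l) : σ₂ ^ k = 1 :=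
  eq_one_of_mem_zpowers_of_coprime (r := σ₂) (s := σ₃)
    (by rw [h.orderOf_snd, h.orderOf_thd]; norm_num) ⟨k, rfl⟩ ⟨l, e.symm⟩

/-- Such a power lies in ⟨σ₂⟩ by the intersection property, and the orders 3 and 4 are coprime. -/
theorem thd_zpow_eq_one_of_mem₃ {k : ℤ} (hk : σ₃ ^ k ∈ closure {σ₁, σ₂}) : σ₃ ^ k = 1 := by
  obtain ⟨l, hl⟩ := h.inf_le ⟨zpow_mem mem₀_thd k, hk⟩
  exact hl.symm.trans (h.eq_one_snd_thd hl)

theorem fst_zpow_eq_one_of_mem₀ {k : ℤ} (hk : σ₁ ^ k ∈ closure {σ₂, σ₃}) : σ₁ ^ k = 1 := by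
  obtain ⟨l, hl⟩ := h.inf_le ⟨hk, zpow_mem mem₃_fst k⟩
  exact h.eq_one_fst_snd hl.symm

theorem fst_snd_notMem₀ : σ₁ * σ₂ ∉ closure {σ₂, σ₃} := fun hm =>
  h.fst_ne_one (by
    simpa using h.fst_zpow_eq_one_of_mem₀ (k := 1)
      (by simpa using (mul_mem_cancel_right mem₀_snd).1 hm))

theorem snd_thd_notMem₃ : σ₂ * σ₃ ∉ closure {σ₁, σ₂} := fun hm =>
  h.thd_ne_one (by
    simpa using h.thd_zpow_eq_one_of_mem₃ (k := 1)
      (by simpa using (mul_mem_cancel_left mem₃_snd).1 hm))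

theorem snd_zpow_eq_one_of_mem₁ {k : ℤ} (hk : σ₂ ^ k ∈ closure {σ₃, σ₁ * σ₂}) : σ₂ ^ k = 1 := by
  obtain ⟨l, hl | hl⟩ := h.mem_closure_thd hk
  · exact h.eq_one_snd_thd hl
  · refine absurd ?_ h.fst_snd_notMem₀
    rw [← mul_mem_cancel_left (zpow_mem mem₀_thd l), ← hl]
    exact zpow_mem mem₀_snd k

theorem snd_zpow_eq_one_of_mem₂ {k : ℤ} (hk : σ₂ ^ k ∈ closure {σ₁, σ₂ * σ₃}) : σ₂ ^ k = 1 := by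
  obtain ⟨l, hl | hl⟩ := h.mem_closure_fst hk
  · exact hl.trans (h.eq_one_fst_snd hl.symm)
  · refine absurd ?_ h.snd_thd_notMem₃
    rw [← mul_mem_cancel_left (zpow_mem mem₃_fst l), ← hl]
    exact zpow_mem mem₃_snd k

theorem snd_thd_notMem₁ : σ₂ * σ₃ ∉ closure {σ₃, σ₁ * σ₂} := fun hm =>
  h.snd_ne_one (by
    simpa using h.snd_zpow_eq_one_of_mem₁ (k := 1)
      (by simpa using (mul_mem_cancel_right mem₁_thd).1 hm))

theorem fst_snd_notMem₂ : σ₁ * σ₂ ∉ closure {σ₁, σ₂ * σ₃} := fun hm =>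
  h.snd_ne_one (by
    simpa using h.snd_zpow_eq_one_of_mem₂ (k := 1)
      (by simpa using (mul_mem_cancel_left mem₂_fst).1 hm))

theorem thd_zpow_eq_one_of_mem₂ {k : ℤ} (hk : σ₃ ^ k ∈ closure {σ₁, σ₂ * σ₃}) : σ₃ ^ k = 1 := by
  obtain ⟨l, hl | hl⟩ := h.mem_closure_fst hk
  · exact hl.trans (h.eq_one_fst_thd hl.symm)
  · have e : σ₃ ^ (k - 1) = σ₁ ^ l * σ₂ := by rw [zpow_sub_one, hl]; group
    have e1 := h.thd_zpow_eq_one_of_mem₃ (k := k - 1)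
      (e ▸ mul_mem (zpow_mem mem₃_fst l) mem₃_snd)
    rw [e] at e1
    have e2 : σ₁ ^ (-l) = σ₂ ^ (1 : ℤ) := by
      rw [zpow_neg, zpow_one]; exact inv_eq_of_mul_eq_one_right e1
    refine absurd ?_ h.snd_ne_one
    rw [← zpow_one σ₂, ← e2, h.eq_one_fst_snd e2]

theorem fst_zpow_eq_one_of_mem₁ {k : ℤ} (hk : σ₁ ^ k ∈ closure {σ₃, σ₁ * σ₂}) : σ₁ ^ k = 1 := by
  obtain ⟨l, hl | hl⟩ := h.mem_closure_thd hk
  · exact h.eq_one_fst_thd hl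
  · have e : σ₁ ^ (k + 1) = σ₃ ^ l * σ₂⁻¹ := by rw [zpow_add_one, hl, h.fst_snd_eq]; group
    have e1 := h.fst_zpow_eq_one_of_mem₀ (k := k + 1)
      (e ▸ mul_mem (zpow_mem mem₀_thd l) (inv_mem mem₀_snd))
    rw [e] at e1
    have e2 : σ₂ ^ (1 : ℤ) = σ₃ ^ l := by rw [zpow_one]; exact (mul_inv_eq_one.1 e1).symm
    exact absurd (by simpa using h.eq_one_snd_thd e2) h.snd_ne_one

/-- The remaining pairwise intersections all follow from the single assumption `inf_le`: elements of
the dihedral stabilizers have an explicit form, and the coprime orders eliminate the unwanted ones.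
-/
theorem inf₀₁ : closure {σ₂, σ₃} ⊓ closure {σ₃, σ₁ * σ₂} ≤ zpowers σ₃ := fun g hg => by
  obtain ⟨k, rfl | rfl⟩ := h.mem_closure_thd hg.2
  · exact ⟨k, rfl⟩
  · exact absurd ((mul_mem_cancel_left (zpow_mem mem₀_thd k)).1 hg.1) h.fst_snd_notMem₀

theorem inf₀₂ : closure {σ₂, σ₃} ⊓ closure {σ₁, σ₂ * σ₃} ≤ zpowers (σ₂ * σ₃) := fun g hg => by
  obtain ⟨k, rfl | rfl⟩ := h.mem_closure_fst hg.2
  · rw [h.fst_zpow_eq_one_of_mem₀ hg.1]; exact one_mem _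
  · rw [h.fst_zpow_eq_one_of_mem₀ ((mul_mem_cancel_right (mul_mem mem₀_snd mem₀_thd)).1 hg.1),
      one_mul]
    exact mem_zpowers _

theorem inf₁₂ : closure {σ₃, σ₁ * σ₂} ⊓ closure {σ₁, σ₂ * σ₃} ≤ zpowers (σ₁ * σ₂ * σ₃) :=
  fun g hg => by
  obtain ⟨k, rfl | rfl⟩ := h.mem_closure_thd hg.1
  · rw [h.thd_zpow_eq_one_of_mem₂ hg.2]; exact one_mem _
  · have h2 : _ ∈ closure {σ₁, σ₂ * σ₃} := hg.2
    have e : σ₃ ^ k * (σ₁ * σ₂) = σ₃ ^ (k + 1) * (σ₁ * σ₂ * σ₃) := by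
      rw [zpow_add_one, mul_assoc, ← h.fst_snd_eq_thd_mul]
    rw [e] at h2 ⊢
    rw [h.thd_zpow_eq_one_of_mem₂ ((mul_mem_cancel_right mem₂_fst_snd_thd).1 h2), one_mul]
    exact mem_zpowers _

theorem inf₁₃ : closure {σ₃, σ₁ * σ₂} ⊓ closure {σ₁, σ₂} ≤ zpowers (σ₁ * σ₂) := fun g hg => by
  obtain ⟨k, rfl | rfl⟩ := h.mem_closure_thd hg.1
  · rw [h.thd_zpow_eq_one_of_mem₃ hg.2]; exact one_mem _
  · rw [h.thd_zpow_eq_one_of_mem₃ ((mul_mem_cancel_right (mul_mem mem₃_fst mem₃_snd)).1 hg.2),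
      one_mul]
    exact mem_zpowers _

theorem inf₂₃ : closure {σ₁, σ₂ * σ₃} ⊓ closure {σ₁, σ₂} ≤ zpowers σ₁ := fun g hg => by
  obtain ⟨k, rfl | rfl⟩ := h.mem_closure_fst hg.1
  · exact ⟨k, rfl⟩
  · exact absurd ((mul_mem_cancel_left (zpow_mem mem₃_fst k)).1 hg.2) h.snd_thd_notMem₃

/-- The reflection-like elements whose quotients are the rotations. -/
def turn (_ : IsRotaryGenerators σ₁ σ₂ σ₃) : Fin 4 → G := ![σ₁ * σ₂ * σ₃, σ₂ * σ₃, σ₃, 1]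

/-- The stabilizers of the faces of the base flag, by increasing rank. -/
def stab (_ : IsRotaryGenerators σ₁ σ₂ σ₃) : Fin 6 → Subgroup G :=
  ![⊤, closure {σ₂, σ₃}, closure {σ₃, σ₁ * σ₂}, closure {σ₁, σ₂ * σ₃}, closure {σ₁, σ₂}, ⊤]

/-- `turn i` stands for ρᵢρ₃, so the quotients are the rotations ρᵢρⱼ. This is the algebraic form of
strong flag-connectedness: an element stabilizing the base faces with ranks in `J` is a product of
rotations that avoid `J`. -/
theorem mem_closure_turn (J : Fin 4 → Prop) (u : G)
    (hu : ∀ k : Fin 4, J k → u ∈ h.stab k.succ.castSucc) :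
    u ∈ closure {τ | ∃ i j, ¬ J i ∧ ¬ J j ∧ τ = h.turn i * (h.turn j)⁻¹} := by
  set K := closure {τ | ∃ i j, ¬ J i ∧ ¬ J j ∧ τ = h.turn i * (h.turn j)⁻¹}
  have hK : ∀ i j, ¬ J i → ¬ J j → h.turn i * (h.turn j)⁻¹ ∈ K := fun i j hi hj =>
    subset_closure ⟨i, j, hi, hj, rfl⟩
  have k01 : ¬ J 0 → ¬ J 1 → σ₁ ∈ K := fun hi hj => by
    have := hK 0 1 hi hj
    simpa [turn, mul_assoc] using this
  have k12 : ¬ J 1 → ¬ J 2 → σ₂ ∈ K := fun hi hj => by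
    have := hK 1 2 hi hj
    simpa [turn, mul_assoc] using this
  have k23 : ¬ J 2 → ¬ J 3 → σ₃ ∈ K := fun hi hj => by
    have := hK 2 3 hi hj
    simpa [turn, mul_assoc] using this
  have k02 : ¬ J 0 → ¬ J 2 → σ₁ * σ₂ ∈ K := fun hi hj => by
    have := hK 0 2 hi hj
    simpa [turn, mul_assoc] using this
  have k13 : ¬ J 1 → ¬ J 3 → σ₂ * σ₃ ∈ K := fun hi hj => by
    have := hK 1 3 hi hj
    simpa [turn, mul_assoc] using this
  have k03 : ¬ J 0 → ¬ J 3 → σ₁ * σ₂ * σ₃ ∈ K := fun hi hj => by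
    have := hK 0 3 hi hj
    simpa [turn, mul_assoc] using this
  have u0 : J 0 → u ∈ closure {σ₂, σ₃} := hu 0
  have u1 : J 1 → u ∈ closure {σ₃, σ₁ * σ₂} := hu 1
  have u2 : J 2 → u ∈ closure {σ₁, σ₂ * σ₃} := hu 2
  have u3 : J 3 → u ∈ closure {σ₁, σ₂} := hu 3
  have hpair : ∀ {r s : G}, r ∈ K → s ∈ K → u ∈ closure {r, s} → u ∈ K := fun hr hs hu =>
    (closure_le K).2 (by rintro x (rfl | rfl) <;> assumption) hu
  have hz : ∀ {r : G}, r ∈ K → u ∈ zpowers r → u ∈ K := fun hr hu => zpowers_le.2 hr hu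
  have c01 : J 0 → J 1 → u ∈ zpowers σ₃ := fun a b => h.inf₀₁ ⟨u0 a, u1 b⟩
  have c02 : J 0 → J 2 → u ∈ zpowers (σ₂ * σ₃) := fun a b => h.inf₀₂ ⟨u0 a, u2 b⟩
  have c03 : J 0 → J 3 → u ∈ zpowers σ₂ := fun a b => h.inf_le ⟨u0 a, u3 b⟩
  have c12 : J 1 → J 2 → u ∈ zpowers (σ₁ * σ₂ * σ₃) := fun a b => h.inf₁₂ ⟨u1 a, u2 b⟩
  have c13 : J 1 → J 3 → u ∈ zpowers (σ₁ * σ₂) := fun a b => h.inf₁₃ ⟨u1 a, u3 b⟩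
  have c23 : J 2 → J 3 → u ∈ zpowers σ₁ := fun a b => h.inf₂₃ ⟨u2 a, u3 b⟩
  -- Three proper base faces already have trivial common stabilizer.
  have d1 : J 0 → J 1 → J 2 → u ∈ K := fun a b c => by
    obtain ⟨k, hk : σ₃ ^ k = u⟩ := c01 a b
    rw [← hk] at u0 u1 u2 u3 ⊢
    rw [show σ₃ ^ k = 1 from h.thd_zpow_eq_one_of_mem₂ (u2 c)]; exact one_mem K
  have d2 : J 0 → J 1 → J 3 → u ∈ K := fun a b c => by
    obtain ⟨k, hk : σ₃ ^ k = u⟩ := c01 a b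
    rw [← hk] at u0 u1 u2 u3 ⊢
    rw [show σ₃ ^ k = 1 from h.thd_zpow_eq_one_of_mem₃ (u3 c)]; exact one_mem K
  have d3 : J 0 → J 2 → J 3 → u ∈ K := fun a b c => by
    obtain ⟨k, hk : σ₁ ^ k = u⟩ := c23 b c
    rw [← hk] at u0 u1 u2 u3 ⊢
    rw [show σ₁ ^ k = 1 from h.fst_zpow_eq_one_of_mem₀ (u0 a)]; exact one_mem K
  have d4 : J 1 → J 2 → J 3 → u ∈ K := fun a b c => by
    obtain ⟨k, hk : σ₁ ^ k = u⟩ := c23 b c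
    rw [← hk] at u0 u1 u2 u3 ⊢
    rw [show σ₁ ^ k = 1 from h.fst_zpow_eq_one_of_mem₁ (u1 a)]; exact one_mem K
  have dtop : σ₁ ∈ K → σ₂ ∈ K → σ₃ ∈ K → u ∈ K := fun a b c => by
    have : closure {σ₁, σ₂, σ₃} ≤ K :=
      (closure_le K).2 (by rintro x (rfl | rfl | rfl) <;> assumption)
    rw [h.closure_eq_top] at this
    exact this (mem_top u)
  by_cases j0 : J 0 <;> by_cases j1 : J 1 <;> by_cases j2 : J 2 <;> by_cases j3 : J 3
  · exact d1 j0 j1 j2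
  · exact d1 j0 j1 j2
  · exact d2 j0 j1 j3
  · exact hz (k23 j2 j3) (c01 j0 j1)
  · exact d3 j0 j2 j3
  · exact hz (k13 j1 j3) (c02 j0 j2)
  · exact hz (k12 j1 j2) (c03 j0 j3)
  · exact hpair (k12 j1 j2) (k23 j2 j3) (u0 j0)
  · exact d4 j1 j2 j3
  · exact hz (k03 j0 j3) (c12 j1 j2)
  · exact hz (k02 j0 j2) (c13 j1 j3)
  · exact hpair (k23 j2 j3) (k02 j0 j2) (u1 j1)
  · exact hz (k01 j0 j1) (c23 j2 j3)
  · exact hpair (k01 j0 j1) (k13 j1 j3) (u2 j2)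
  · exact hpair (k01 j0 j1) (k12 j1 j2) (u3 j3)
  · exact dtop (k01 j0 j1) (k12 j1 j2) (k23 j2 j3)

end IsRotaryGenerators

/-! ### Flags of the coset geometry -/

namespace IsRotaryGenerators

open Subgroup CosetGeometry

variable {G : Type u} [Group G] {σ₁ σ₂ σ₃ : G} (h : IsRotaryGenerators σ₁ σ₂ σ₃)
include h

theorem mem_closure_thd' {g : G} (hg : g ∈ closure {σ₃, σ₁ * σ₂}) :
    ∃ k : ℤ, g = σ₃ ^ k ∨ g = σ₁ * σ₂ * σ₃ ^ k := by
  obtain ⟨k, hk | hk⟩ := h.mem_closure_thd (inv_mem hg)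
  · exact ⟨-k, Or.inl (by rw [zpow_neg, ← hk, inv_inv])⟩
  · refine ⟨-k, Or.inr ?_⟩
    rw [← inv_inv g, hk, mul_inv_rev, zpow_neg, mul_inv_rev, h.fst_snd_eq]

theorem mem_closure_fst' {g : G} (hg : g ∈ closure {σ₁, σ₂ * σ₃}) :
    ∃ k : ℤ, g = σ₁ ^ k ∨ g = σ₂ * σ₃ * σ₁ ^ k := by
  obtain ⟨k, hk | hk⟩ := h.mem_closure_fst (inv_mem hg)
  · exact ⟨-k, Or.inl (by rw [zpow_neg, ← hk, inv_inv])⟩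
  · refine ⟨-k, Or.inr ?_⟩
    rw [← inv_inv g, hk, mul_inv_rev, zpow_neg, mul_inv_rev, h.snd_thd_eq]

/-- The coset geometry of the face stabilizers. -/
def geometry : CosetGeometry G 6 where
  subgroup := h.stab
  factor i j k hij hjk g hg := by
    -- Indices 0 and 5 carry the whole group, so the factorization is only at stake for the four
    -- triples of proper faces, whose middle group is dihedral.
    have key : ∀ i j k : Fin 6, i < j → j < k → i = 0 ∨ k = 5 ∨ (i = 1 ∧ j = 2 ∧ k = 3) ∨
      (i = 1 ∧ j = 2 ∧ k = 4) ∨ (i = 1 ∧ j = 3 ∧ k = 4) ∨ (i = 2 ∧ j = 3 ∧ k = 4) := by decide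
    rcases key i j k hij hjk with rfl | rfl | ⟨rfl, rfl, rfl⟩ | ⟨rfl, rfl, rfl⟩ | ⟨rfl, rfl, rfl⟩ |
      ⟨rfl, rfl, rfl⟩
    · exact ⟨g, ⟨mem_top g, hg⟩, 1, one_mem _, (mul_one g).symm⟩
    · exact ⟨1, one_mem _, g, ⟨hg, mem_top g⟩, (one_mul g).symm⟩
    · obtain ⟨k, rfl | rfl⟩ := h.mem_closure_thd hg
      · exact ⟨_, ⟨zpow_mem mem₀_thd k, zpow_mem mem₁_thd k⟩, 1, one_mem _, (mul_one _).symm⟩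
      · refine ⟨_, ⟨zpow_mem mem₀_thd (k + 1), zpow_mem mem₁_thd (k + 1)⟩, _,
          ⟨mem₁_fst_snd_thd, mem₂_fst_snd_thd⟩, ?_⟩
        rw [zpow_add_one, mul_assoc (σ₃ ^ k), ← h.fst_snd_eq_thd_mul]
    · obtain ⟨k, rfl | rfl⟩ := h.mem_closure_thd hg
      · exact ⟨_, ⟨zpow_mem mem₀_thd k, zpow_mem mem₁_thd k⟩, 1, one_mem _, (mul_one _).symm⟩
      · exact ⟨_, ⟨zpow_mem mem₀_thd k, zpow_mem mem₁_thd k⟩, _,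
          ⟨mem₁_fst_snd, mul_mem mem₃_fst mem₃_snd⟩, rfl⟩
    · obtain ⟨k, rfl | rfl⟩ := h.mem_closure_fst' hg
      · exact ⟨1, one_mem _, _, ⟨zpow_mem mem₂_fst k, zpow_mem mem₃_fst k⟩, (one_mul _).symm⟩
      · exact ⟨_, ⟨mul_mem mem₀_snd mem₀_thd, mem₂_snd_thd⟩, _,
          ⟨zpow_mem mem₂_fst k, zpow_mem mem₃_fst k⟩, rfl⟩
    · obtain ⟨k, rfl | rfl⟩ := h.mem_closure_fst' hg
      · exact ⟨1, one_mem _, _, ⟨zpow_mem mem₂_fst k, zpow_mem mem₃_fst k⟩, (one_mul _).symm⟩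
      · refine ⟨_, ⟨mem₁_fst_snd_thd, mem₂_fst_snd_thd⟩, _,
          ⟨zpow_mem mem₂_fst (1 + k), zpow_mem mem₃_fst (1 + k)⟩, ?_⟩
        rw [zpow_one_add, h.snd_thd_eq_mul_fst]
        group

/-- The shift of the facet of an odd flag. -/
def shift (_ : IsRotaryGenerators σ₁ σ₂ σ₃) (k : Fin 6) : G := if k = 4 then σ₁ * σ₂ * σ₃ else 1

theorem coset_eq_iff {k : Fin 6} {a b : G} :
    h.geometry.coset k a = h.geometry.coset k b ↔ a⁻¹ * b ∈ h.stab k :=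
  coset_eq_coset

/-- Because of this, `even g` and `odd (g * turn i)` differ exactly in rank `i`. The index
`i.succ.castSucc` is `i + 1`, since index 0 belongs to rank −1. As `turn 3 = 1`, the flag `odd g` is
the 3-adjacent flag of `even g`. -/
theorem turn_mul_shift_mem (i : Fin 4) (k : Fin 6) :
    h.turn i * h.shift k ∈ h.stab k ↔ k ≠ i.succ.castSucc := by
  have e0 : σ₁ * σ₂ * σ₃ * (σ₁ * σ₂ * σ₃) = 1 := by rw [← pow_two, h.sq_fst_snd_thd]
  have e1 : σ₂ * σ₃ * (σ₁ * σ₂ * σ₃) = σ₁⁻¹ := by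
    refine eq_inv_of_mul_eq_one_right ?_
    rw [← e0]; group
  have n0 : σ₁ * σ₂ * σ₃ ∉ closure {σ₂, σ₃} := fun hm =>
    h.fst_snd_notMem₀ ((mul_mem_cancel_right mem₀_thd).1 hm)
  have n2 : σ₃ ∉ closure {σ₁, σ₂ * σ₃} := fun hm => h.thd_ne_one (by
    simpa using h.thd_zpow_eq_one_of_mem₂ (k := 1) (by simpa using hm))
  have n3 : σ₁ * σ₂ * σ₃ ∉ closure {σ₁, σ₂} := fun hm =>
    h.snd_thd_notMem₃ ((mul_mem_cancel_left mem₃_fst).1 (by rwa [← mul_assoc]))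
  fin_cases k <;> fin_cases i <;> simp only [turn, stab, shift] <;> simp
  · exact n0
  · exact mul_mem mem₀_snd mem₀_thd
  · exact mem₀_thd
  · exact mem₁_fst_snd_thd
  · exact h.snd_thd_notMem₁
  · exact mem₁_thd
  · exact mem₂_fst_snd_thd
  · exact mem₂_snd_thd
  · exact n2
  · rw [e0]; exact one_mem _
  · rw [e1]; exact inv_mem mem₃_fst
  · rw [← h.fst_snd_eq_thd_mul]; exact mul_mem mem₃_fst mem₃_snd
  · exact n3

/-- The flag of the cosets of a group element. -/
def even (g : G) : Flag h.geometry.Face := flagOf (fun _ => g) fun _ _ _ => ⟨g, rfl, rfl⟩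

/-- Two indices leave some proper rank `i` unused, and outside that rank the odd flag consists of
cosets of the single element `g * (turn i)⁻¹`. -/
theorem exists_coset_eq_shift (g : G) (k l : Fin 6) (hkl : k < l) :
    ∃ c, h.geometry.coset k c = h.geometry.coset k (g * h.shift k) ∧
      h.geometry.coset l c = h.geometry.coset l (g * h.shift l) := by
  have key : ∀ i : Fin 4, ∀ k, k ≠ i.succ.castSucc →
      h.geometry.coset k (g * (h.turn i)⁻¹) = h.geometry.coset k (g * h.shift k) := by
    intro i k hk
    rw [h.coset_eq_iff]
    simpa using (h.turn_mul_shift_mem i k).2 hk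
  obtain ⟨i, hi, hi'⟩ : ∃ i : Fin 4, k ≠ i.succ.castSucc ∧ l ≠ i.succ.castSucc := by
    clear key; revert k l; decide
  exact ⟨_, key i k hi, key i l hi'⟩

/-- The flags that are adjacent to flags of cosets of a group element. -/
def odd (g : G) : Flag h.geometry.Face :=
  flagOf (fun k => g * h.shift k) (h.exists_coset_eq_shift g)

theorem coset_turn (g : G) (i : Fin 4) (k : Fin 6) :
    h.geometry.coset k g = h.geometry.coset k (g * h.turn i * h.shift k) ↔
      k ≠ i.succ.castSucc := by
  rw [h.coset_eq_iff, ← h.turn_mul_shift_mem i k]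
  simp [mul_assoc]

theorem even_adjacent (g : G) (i : Fin 4) : (h.even g).Adjacent (h.odd (g * h.turn i)) :=
  flagOf_adjacent (i := i.succ.castSucc) (fun k hk => (h.coset_turn g i k).2 hk)
    fun e => (h.coset_turn g i _).1 e rfl

theorem odd_adjacent (g : G) (i : Fin 4) : (h.odd (g * h.turn i)).Adjacent (h.even g) :=
  flagOf_adjacent (i := i.succ.castSucc) (fun k hk => ((h.coset_turn g i k).2 hk).symm)
    fun e => (h.coset_turn g i _).1 e.symm rfl

/-- One element represents the faces of ranks 0, 1, 2. The facet is then fixed up to the dihedral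
group ⟨σ₁, σ₂σ₃⟩ modulo ⟨σ₁⟩, which leaves two choices. -/
theorem flag_cases (Φ : Flag h.geometry.Face) : ∃ g, Φ = h.even g ∨ Φ = h.odd g := by
  choose x hx hxk using exists_mem_flag_idx Φ
  have hle : ∀ k l, k ≤ l → ∃ g, h.geometry.coset k g = x k ∧ h.geometry.coset l g = x l := by
    intro k l hkl
    obtain ⟨-, g, h1, h2⟩ := le_of_mem_flag (hx k) (hx l) (by rwa [hxk, hxk])
    rw [hxk] at h1 h2
    exact ⟨g, h1, h2⟩
  obtain ⟨a, ha1, ha2⟩ := hle 1 2 (by decide)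
  obtain ⟨b, hb2, hb3⟩ := hle 2 3 (by decide)
  obtain ⟨d, hd3, hd4⟩ := hle 3 4 (by decide)
  obtain ⟨e, he, -⟩ := hle 0 0 le_rfl
  obtain ⟨f, hf, -⟩ := hle 5 5 le_rfl
  obtain ⟨c, hc1, hc2, hc3⟩ := exists_coset_eq_coset_eq_coset_eq (Γ := h.geometry) (i := 1)
    (j := 2) (k := 3) (by decide) (by decide) (ha2.trans hb2.symm)
  have hc0 : h.geometry.coset 0 c = x 0 := by
    rw [← he, h.coset_eq_iff]; exact mem_top _
  have hc5 : h.geometry.coset 5 c = x 5 := by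
    rw [← hf, h.coset_eq_iff]; exact mem_top _
  rw [ha1] at hc1
  rw [ha2] at hc2
  rw [hb3] at hc3
  have hm := (h.coset_eq_iff (k := 3)).1 (hc3.trans hd3.symm)
  refine ⟨c, ?_⟩
  obtain ⟨k, hk | hk⟩ := h.mem_closure_fst' hm
  · left
    have hc4 : h.geometry.coset 4 c = x 4 := by
      rw [← hd4, h.coset_eq_iff, hk]; exact zpow_mem mem₃_fst k
    refine eq_flagOf fun k => ?_
    have : h.geometry.coset k c = x k := by
      fin_cases k <;> assumption
    exact this ▸ hx k
  · right
    have hc4 : h.geometry.coset 4 (c * (σ₁ * σ₂ * σ₃)) = x 4 := by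
      rw [← hd4, h.coset_eq_iff, mul_inv_rev, mul_assoc, hk, h.inv_fst_snd_thd,
        h.snd_thd_eq_mul_fst, ← h.inv_fst_snd_thd]
      have : (σ₁ * σ₂ * σ₃)⁻¹ * ((σ₁ * σ₂ * σ₃)⁻¹ * σ₁ * σ₁ ^ k) = σ₁ ^ (1 + k) := by
        nth_rw 2 [h.inv_fst_snd_thd]
        rw [zpow_one_add]; group
      rw [this]
      exact zpow_mem mem₃_fst _
    refine eq_flagOf fun k => ?_
    have : h.geometry.coset k (c * h.shift k) = x k := by
      fin_cases k <;> simpa [shift]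
    exact this ▸ hx k

/-- Each rotation in `mem_closure_turn` is a path of two adjacencies, from an even flag through an
odd one to an even one, keeping all common faces. Odd ends are first moved to even flags by one
adjacency. -/
theorem strongly_flag_connected (Φ Ψ : Flag h.geometry.Face) :
    Relation.ReflTransGen (fun Φ₁ Φ₂ : Flag h.geometry.Face =>
      Φ₁.Adjacent Φ₂ ∧ (Φ ∩ Ψ : Set h.geometry.Face) ⊆ Φ₂) Φ Ψ := by
  by_cases hne : Φ = Ψ
  · rw [hne]
  set S : Set h.geometry.Face := Φ ∩ Ψ with hS
  let J : Fin 4 → Prop := fun i => ∃ x ∈ S, idx x = i.succ.castSucc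
  have hJ : ∀ i, ¬ J i → ∀ x ∈ S, idx x ≠ i.succ.castSucc := fun i hi x hx e => hi ⟨x, hx, e⟩
  have sub1 : ∀ g i, ¬ J i → S ⊆ h.even g → S ⊆ h.odd (g * h.turn i) := fun g i hi hg =>
    subset_flagOf_of_agree (fun k hk => (h.coset_turn g i k).2 hk) hg (hJ i hi)
  have sub2 : ∀ g i, ¬ J i → S ⊆ h.odd (g * h.turn i) → S ⊆ h.even g := fun g i hi hg =>
    subset_flagOf_of_agree (fun k hk => ((h.coset_turn g i k).2 hk).symm) hg (hJ i hi)
  have heven : ∀ g g', S ⊆ h.even g → S ⊆ h.even g' → Relation.ReflTransGen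
      (fun Φ₁ Φ₂ : Flag h.geometry.Face => Φ₁.Adjacent Φ₂ ∧ S ⊆ Φ₂) (h.even g) (h.even g') := by
    intro g g' hg hg'
    have hmem := h.mem_closure_turn J (g⁻¹ * g') (by
      rintro k ⟨x, hx, hxk⟩
      rw [← h.coset_eq_iff, ← hxk]
      exact (mem_flagOf.1 (hg hx)).symm.trans (mem_flagOf.1 (hg' hx)))
    have step : ∀ g i j, ¬ J i → ¬ J j → S ⊆ h.even g → Relation.ReflTransGen
        (fun Φ₁ Φ₂ : Flag h.geometry.Face => Φ₁.Adjacent Φ₂ ∧ S ⊆ Φ₂) (h.even g)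
        (h.even (g * (h.turn i * (h.turn j)⁻¹))) ∧
        S ⊆ h.even (g * (h.turn i * (h.turn j)⁻¹)) := by
      intro g i j hi hj hg
      have e : g * h.turn i = g * (h.turn i * (h.turn j)⁻¹) * h.turn j := by group
      have s1 := sub1 g i hi hg
      have s2 := sub2 _ j hj (e ▸ s1)
      exact ⟨(Relation.ReflTransGen.single ⟨h.even_adjacent g i, s1⟩).tail
        ⟨by rw [e]; exact h.odd_adjacent _ j, s2⟩, s2⟩
    have main : ∀ u ∈ closure {τ | ∃ i j, ¬ J i ∧ ¬ J j ∧ τ = h.turn i * (h.turn j)⁻¹},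
        Relation.ReflTransGen
        (fun Φ₁ Φ₂ : Flag h.geometry.Face => Φ₁.Adjacent Φ₂ ∧ S ⊆ Φ₂) (h.even g)
        (h.even (g * u)) ∧ S ⊆ h.even (g * u) := by
      intro u hu
      induction hu using Subgroup.closure_induction_right with
      | one => rw [mul_one]; exact ⟨Relation.ReflTransGen.refl, hg⟩
      | mul_right x _ y hy ih =>
        obtain ⟨i, j, hi, hj, rfl⟩ := hy
        obtain ⟨s1, s2⟩ := step (g * x) i j hi hj ih.2
        rw [← mul_assoc]
        exact ⟨ih.1.trans s1, s2⟩
      | mul_inv_cancel x _ y hy ih =>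
        obtain ⟨i, j, hi, hj, rfl⟩ := hy
        obtain ⟨s1, s2⟩ := step (g * x) j i hj hi ih.2
        rw [← mul_assoc, mul_inv_rev, inv_inv]
        exact ⟨ih.1.trans s1, s2⟩
    have := (main _ hmem).1
    rwa [mul_inv_cancel_left] at this
  -- Distinct flags differ in some proper rank, which is free for the first and last step at odd
  -- flags.
  obtain ⟨i, hi⟩ : ∃ i, ¬ J i := by
    by_contra! hcon
    refine hne (SetLike.coe_injective (Φ.max_chain' Ψ.Chain' fun x hx => ?_))
    obtain ⟨y, hy, hyx⟩ := exists_mem_flag_idx Ψ (idx x)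
    have hxy : x = y := by
      by_cases h0 : idx x = 0 ∨ idx x = 5
      · obtain ⟨a, ha⟩ := exists_eq_coset x
        obtain ⟨b, hb⟩ := exists_eq_coset y
        rw [ha, hb, hyx, h.coset_eq_iff]
        rcases h0 with h0 | h0 <;> rw [h0] <;> exact mem_top _
      · obtain ⟨i, hi⟩ : ∃ i : Fin 4, idx x = i.succ.castSucc := by
          generalize idx x = k at h0
          revert k; decide
        obtain ⟨z, hz, hzi⟩ := hcon i
        rw [eq_of_mem_flag hx hz.1 (hi.trans hzi.symm),
          eq_of_mem_flag hz.2 hy (hzi.trans (hi.symm.trans hyx.symm))]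
    exact hxy ▸ hy
  have hΦ : S ⊆ Φ := Set.inter_subset_left
  have hΨ : S ⊆ Ψ := Set.inter_subset_right
  obtain ⟨g', hΨg⟩ : ∃ g', S ⊆ h.even g' ∧ Relation.ReflTransGen
      (fun Φ₁ Φ₂ : Flag h.geometry.Face => Φ₁.Adjacent Φ₂ ∧ S ⊆ Φ₂) (h.even g') Ψ := by
    obtain ⟨g, rfl | rfl⟩ := h.flag_cases Ψ
    · exact ⟨g, hΨ, Relation.ReflTransGen.refl⟩
    · have e : g = g * (h.turn i)⁻¹ * h.turn i := by group
      refine ⟨g * (h.turn i)⁻¹, sub2 _ i hi (e ▸ hΨ), Relation.ReflTransGen.single ⟨?_, hΨ⟩⟩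
      nth_rw 2 [e]
      exact h.even_adjacent _ i
  obtain ⟨g, rfl | rfl⟩ := h.flag_cases Φ
  · exact (heven g g' hΦ hΨg.1).trans hΨg.2
  · have e : g = g * (h.turn i)⁻¹ * h.turn i := by group
    have s := sub2 (g * (h.turn i)⁻¹) i hi (e ▸ hΦ)
    refine (Relation.ReflTransGen.single ⟨?_, s⟩).trans ((heven _ g' s hΨg.1).trans hΨg.2)
    nth_rw 1 [e]
    exact h.odd_adjacent _ i

end IsRotaryGenerators

/-! ### The coset polytope and its chirality -/

namespace IsRotaryGenerators

open Subgroup CosetGeometry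

variable {G : Type u} [Group G] {σ₁ σ₂ σ₃ : G} (h : IsRotaryGenerators σ₁ σ₂ σ₃)
include h

/-- The powers of `s` are a transversal of the cosets of `stab j` in `stab i ⊓ stab k`. -/
def IsTransversal (i j k : Fin 6) (s : G) : Prop :=
  s ∈ h.stab i ⊓ h.stab k ∧
    (∀ a ∈ h.stab i ⊓ h.stab k, ∃ c ∈ zpowers s, c⁻¹ * a ∈ h.stab j) ∧
    ∀ c ∈ zpowers s, c ∈ h.stab j → c = 1

theorem isTransversal_of_sq {i j k : Fin 6} {s : G} (hs : s ^ 2 = 1)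
    (hm : s ∈ h.stab i ⊓ h.stab k) (hj : s ∉ h.stab j)
    (ha : ∀ a ∈ h.stab i ⊓ h.stab k, a ∈ h.stab j ∨ s⁻¹ * a ∈ h.stab j) :
    orderOf s = 2 ∧ h.IsTransversal i j k s := by
  have h2 : orderOf s = 2 := orderOf_eq_prime hs fun e => hj (e ▸ one_mem _)
  refine ⟨h2, hm, fun a haa => ?_, ?_⟩
  · rcases ha a haa with h' | h'
    · exact ⟨1, one_mem _, by simpa⟩
    · exact ⟨s, mem_zpowers s, h'⟩
  · rintro _ ⟨k, rfl⟩ hk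
    change s ^ k ∈ _ at hk
    change s ^ k = 1
    rcases Int.even_or_odd' k with ⟨l, rfl | rfl⟩
    · rw [zpow_mul]; norm_cast; rw [hs, one_zpow]
    · refine absurd ?_ hj
      rw [zpow_add_one, zpow_mul] at hk
      norm_cast at hk
      rwa [hs, one_zpow, one_mul] at hk

/-- This supplies the diamond condition: the involution is σ₁σ₂ or σ₂σ₃, according to the rank. -/
theorem exists_isTransversal_two (i : Fin 4) :
    ∃ s, orderOf s = 2 ∧ h.IsTransversal i.castSucc.castSucc i.succ.castSucc i.succ.succ s := by
  have hz : ∀ {s a : G} {k : Fin 6}, s ^ 2 = 1 → a ∈ zpowers s →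
      a ∈ h.stab k ∨ s⁻¹ * a ∈ h.stab k := by
    rintro s _ k hs ⟨z, rfl⟩
    change s ^ z ∈ _ ∨ s⁻¹ * s ^ z ∈ _
    rcases Int.even_or_odd' z with ⟨l, rfl | rfl⟩
    · left
      rw [zpow_mul]; norm_cast; rw [hs, one_zpow]; exact one_mem _
    · right
      rw [zpow_add_one, zpow_mul]; norm_cast; rw [hs, one_zpow, one_mul, inv_mul_cancel]
      exact one_mem _
  fin_cases i
  · refine ⟨_, h.isTransversal_of_sq h.sq_fst_snd ⟨mem_top _, mem₁_fst_snd⟩ h.fst_snd_notMem₀ ?_⟩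
    rintro a ⟨-, ha⟩
    obtain ⟨k, rfl | rfl⟩ := h.mem_closure_thd' ha
    · exact Or.inl (zpow_mem mem₀_thd k)
    · exact Or.inr (by rw [inv_mul_cancel_left]; exact zpow_mem mem₀_thd k)
  · exact ⟨_, h.isTransversal_of_sq h.sq_snd_thd ⟨mul_mem mem₀_snd mem₀_thd, mem₂_snd_thd⟩
      h.snd_thd_notMem₁ fun a ha => hz h.sq_snd_thd (h.inf₀₂ ha)⟩
  · exact ⟨_, h.isTransversal_of_sq h.sq_fst_snd ⟨mem₁_fst_snd, mul_mem mem₃_fst mem₃_snd⟩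
      h.fst_snd_notMem₂ fun a ha => hz h.sq_fst_snd (h.inf₁₃ ha)⟩
  · refine ⟨_, h.isTransversal_of_sq h.sq_snd_thd ⟨mem₂_snd_thd, mem_top _⟩ h.snd_thd_notMem₃ ?_⟩
    rintro a ⟨ha, -⟩
    obtain ⟨k, rfl | rfl⟩ := h.mem_closure_fst' ha
    · exact Or.inl (zpow_mem mem₃_fst k)
    · exact Or.inr (by rw [inv_mul_cancel_left]; exact zpow_mem mem₃_fst k)

/-- This supplies the Schläfli type: σ₁, σ₂, σ₃ permute the vertices of the polygonal sections
cyclically. -/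
theorem exists_isTransversal_type (i : Fin 3) :
    ∃ s, orderOf s = ![5, 3, 4] i ∧
      h.IsTransversal i.castSucc.castSucc.castSucc i.succ.castSucc.castSucc i.succ.succ.succ s := by
  fin_cases i
  · refine ⟨σ₁, h.orderOf_fst, ⟨mem_top _, mem₂_fst⟩, ?_, ?_⟩
    · rintro a ⟨-, ha⟩
      obtain ⟨k, rfl | rfl⟩ := h.mem_closure_fst ha
      · exact ⟨_, zpow_mem (mem_zpowers _) k, by rw [inv_mul_cancel]; exact one_mem _⟩
      · exact ⟨_, zpow_mem (mem_zpowers _) k, by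
          rw [inv_mul_cancel_left]; exact mul_mem mem₀_snd mem₀_thd⟩
    · rintro _ ⟨k, rfl⟩ hk
      exact h.fst_zpow_eq_one_of_mem₀ hk
  · refine ⟨σ₂, h.orderOf_snd, ⟨mem₀_snd, mem₃_snd⟩, fun a ha => ?_, ?_⟩
    · exact ⟨a, h.inf_le ha, by rw [inv_mul_cancel]; exact one_mem _⟩
    · rintro _ ⟨k, rfl⟩ hk
      exact h.snd_zpow_eq_one_of_mem₁ hk
  · refine ⟨σ₃, h.orderOf_thd, ⟨mem₁_thd, mem_top _⟩, ?_, ?_⟩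
    · rintro a ⟨ha, -⟩
      obtain ⟨k, rfl | rfl⟩ := h.mem_closure_thd ha
      · exact ⟨_, zpow_mem (mem_zpowers _) k, by rw [inv_mul_cancel]; exact one_mem _⟩
      · refine ⟨_, zpow_mem (mem_zpowers _) (k + 1), ?_⟩
        have e : σ₃ ^ k * (σ₁ * σ₂) = σ₃ ^ (k + 1) * (σ₁ * σ₂ * σ₃) := by
          rw [zpow_add_one, mul_assoc, ← h.fst_snd_eq_thd_mul]
        rw [e, inv_mul_cancel_left]
        exact mem₂_fst_snd_thd
    · rintro _ ⟨k, rfl⟩ hk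
      exact h.thd_zpow_eq_one_of_mem₂ hk

/-- The polytope of cosets of the face stabilizers. -/
def toPolytope : AbstractPolytope.{u} 4 where
  Face := h.geometry.Face
  rank x := ((idx x : ℕ) : ℤ) - 1
  rank_strictMono x y hxy := by
    have := idx_strictMono hxy
    rw [Fin.lt_def] at this
    change ((idx x : ℕ) : ℤ) - 1 < ((idx y : ℕ) : ℤ) - 1
    omega
  exists_least := by
    refine ⟨h.geometry.coset 0 1, fun x => ⟨Fin.zero_le _, ?_⟩⟩
    obtain ⟨g, hg⟩ := exists_eq_coset x
    exact ⟨g, h.coset_eq_iff.2 (mem_top _), hg.symm⟩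
  exists_greatest := by
    refine ⟨h.geometry.coset 5 1, fun x => ⟨Fin.le_last _, ?_⟩⟩
    obtain ⟨g, hg⟩ := exists_eq_coset x
    exact ⟨g, hg.symm, h.coset_eq_iff.2 (mem_top _)⟩
  flag_bijOn_rank Φ := by
    refine ⟨fun x _ => ?_, fun x hx y hy e => eq_of_mem_flag hx hy (Fin.ext ?_), fun k hk => ?_⟩
    · have := (idx x).2
      constructor <;> push_cast <;> omega
    · simp only at e
      omega
    · rw [Set.mem_Icc] at hk
      push_cast at hk
      obtain ⟨x, hx, hxk⟩ := exists_mem_flag_idx Φ ⟨(k + 1).toNat, by omega⟩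
      refine ⟨x, hx, ?_⟩
      simp only [hxk]
      omega
  strongly_flag_connected := h.strongly_flag_connected
  diamond x y hxy hr := by
    have hxy' : (idx y : ℕ) = idx x + 2 := by omega
    have hy := (idx y).2
    obtain ⟨s, hs, h1, h2, h3⟩ := h.exists_isTransversal_two ⟨idx x, by omega⟩
    set i : Fin 4 := ⟨idx x, by omega⟩ with hi
    have hix : i.castSucc.castSucc = idx x := Fin.ext rfl
    have hiy : i.succ.succ = idx y := Fin.ext (by simp [hi, hxy'])
    rw [hix, hiy] at h1 h2
    have hj : (i.succ.castSucc : ℕ) = idx x + 1 := by simp [hi]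
    have := ncard_between hxy.le (j := i.succ.castSucc) (by rw [Fin.lt_def]; omega)
      (by rw [Fin.lt_def]; omega) h1 h2 h3
    rw [← hs, ← this]
    congr 1
    ext z
    constructor
    · rintro ⟨hz1, hz2⟩
      refine ⟨hz1, hz2, Fin.ext ?_⟩
      have k1 := idx_strictMono hz1
      have k2 := idx_strictMono hz2
      rw [Fin.lt_def] at k1 k2
      omega
    · rintro ⟨hz1, hz2, -⟩
      exact ⟨hz1, hz2⟩

theorem ncard_between_eq (i : Fin 3) {x y : h.geometry.Face} (hxy : x < y)
    (hx : (idx x : ℕ) = i) (hy : (idx y : ℕ) = i + 3) :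
    {z | x < z ∧ z < y ∧ idx z = i.succ.castSucc.castSucc}.ncard = ![5, 3, 4] i := by
  obtain ⟨s, hs, h1, h2, h3⟩ := h.exists_isTransversal_type i
  have hix : i.castSucc.castSucc.castSucc = idx x := Fin.ext (by simp; omega)
  have hiy : i.succ.succ.succ = idx y := Fin.ext (by simp; omega)
  rw [hix, hiy] at h1 h2
  have hj : (i.succ.castSucc.castSucc : ℕ) = i + 1 := by simp
  rw [← hs]
  exact ncard_between hxy.le (by rw [Fin.lt_def]; omega) (by rw [Fin.lt_def]; omega) h1 h2 h3

theorem hasType_toPolytope : h.toPolytope.HasType ![5, 3, 4] := by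
  intro (i : Fin 3) x y hxy hx hy
  have hx' : ((idx (Γ := h.geometry) x : ℕ) : ℤ) - 1 = (i : ℤ) - 1 := hx
  have hy' : ((idx (Γ := h.geometry) y : ℕ) : ℤ) - 1 = (i : ℤ) + 2 := hy
  rw [← h.ncard_between_eq i (x := x) (y := y) hxy (by omega) (by omega)]
  congr 1
  ext z
  refine and_congr_right fun _ => and_congr_right fun _ => ?_
  change ((idx (Γ := h.geometry) z : ℕ) : ℤ) - 1 = (i : ℤ) ↔ _
  have hj : (i.succ.castSucc.castSucc : ℕ) = i + 1 := by simp
  rw [Fin.ext_iff, hj]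
  omega

open AbstractPolytope

/-- The coset of a group element as a face of the polytope. -/
def cosetFace (k : Fin 6) (g : G) : h.toPolytope.Face := h.geometry.coset k g

/-- The flag of the cosets of a group element. -/
def evenFlag (g : G) : Flag h.toPolytope.Face := h.even g

/-- The flags that are adjacent to flags of cosets of a group element. -/
def oddFlag (g : G) : Flag h.toPolytope.Face := h.odd g

theorem cosetFace_eq_iff {k : Fin 6} {a b : G} :
    h.cosetFace k a = h.cosetFace k b ↔ a⁻¹ * b ∈ h.stab k :=
  h.coset_eq_iff

theorem flag_eq_evenFlag_or (Φ : Flag h.toPolytope.Face) :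
    ∃ g, Φ = h.evenFlag g ∨ Φ = h.oddFlag g := h.flag_cases Φ

theorem face_evenFlag (g : G) (k : Fin 6) :
    face (h.evenFlag g) (((k : ℕ) : ℤ) - 1) = h.cosetFace k g :=
  (eq_face (P := h.toPolytope) (Φ := h.evenFlag g) (show h.geometry.coset k _ ∈ h.even g from coset_mem_flagOf k) rfl).symm

theorem face_oddFlag (g : G) (k : Fin 6) :
    face (h.oddFlag g) (((k : ℕ) : ℤ) - 1) = h.cosetFace k (g * h.shift k) :=
  (eq_face (P := h.toPolytope) (Φ := h.oddFlag g) (show h.geometry.coset k _ ∈ h.odd g from coset_mem_flagOf k) rfl).symm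

/-- Agreement in ranks 0, 1, 2 forces the two elements to coincide; agreement in the facets would
then put σ₁σ₂σ₃ into ⟨σ₁, σ₂⟩. -/
theorem evenFlag_ne_oddFlag (g g' : G) : h.evenFlag g ≠ h.oddFlag g' := by
  intro e
  have e' : ∀ k, g⁻¹ * (g' * h.shift k) ∈ h.stab k := fun k => by
    rw [← h.cosetFace_eq_iff, ← face_evenFlag, e, face_oddFlag]
  have h0 : g⁻¹ * g' ∈ h.stab 1 := by simpa [shift] using e' 1
  have h1 : g⁻¹ * g' ∈ h.stab 2 := by simpa [shift] using e' 2
  have h2 : g⁻¹ * g' ∈ h.stab 3 := by simpa [shift] using e' 3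
  obtain ⟨k, hk : σ₃ ^ k = _⟩ := h.inf₀₁ ⟨h0, h1⟩
  rw [← hk] at h2
  have hgg : g = g' := by
    rw [← inv_mul_eq_one, ← hk, h.thd_zpow_eq_one_of_mem₂ h2]
  subst hgg
  have h4 := e' 4
  rw [inv_mul_cancel_left] at h4
  refine h.snd_thd_notMem₃ ?_
  rw [← mul_mem_cancel_left (mem₃_fst (σ₂ := σ₂)), ← mul_assoc]
  exact h4

theorem adj_evenFlag (g : G) (i : Fin 4) :
    adj i (h.evenFlag g) = h.oddFlag (g * h.turn i) := by
  refine (eq_adj (h.evenFlag_ne_oddFlag _ _).symm fun k hk hki => ?_).symm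
  rw [Set.mem_Icc] at hk
  push_cast at hk
  obtain ⟨l, rfl⟩ : ∃ l : Fin 6, k = ((l : ℕ) : ℤ) - 1 :=
    ⟨⟨(k + 1).toNat, by omega⟩, by simp; omega⟩
  rw [face_oddFlag, face_evenFlag]
  refine ((h.coset_turn g i l).2 ?_).symm
  rintro rfl
  simp at hki

theorem adj_oddFlag (g : G) (i : Fin 4) :
    adj i (h.oddFlag g) = h.evenFlag (g * (h.turn i)⁻¹) := by
  rw [← adj_adj i (h.evenFlag (g * (h.turn i)⁻¹)), adj_evenFlag, inv_mul_cancel_right]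

/-- The action of the group on the polytope. -/
def act : G →* h.toPolytope.AutomorphismGroup := h.geometry.translate

theorem act_smul_evenFlag (g g' : G) : h.act g • h.evenFlag g' = h.evenFlag (g * g') :=
  (map_translate_flagOf fun _ => rfl : Flag.map (h.geometry.translate g) (h.even g') = h.even _)

theorem act_smul_oddFlag (g g' : G) : h.act g • h.oddFlag g' = h.oddFlag (g * g') :=
  (map_translate_flagOf fun _ => mul_assoc _ _ _ :
    Flag.map (h.geometry.translate g) (h.odd g') = h.odd _)

theorem evenFlag_injective : Function.Injective h.evenFlag := by
  intro g g' e
  have e' : ∀ k, g⁻¹ * g' ∈ h.stab k := fun k => by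
    rw [← h.cosetFace_eq_iff, ← face_evenFlag, e, face_evenFlag]
  obtain ⟨k, hk : σ₃ ^ k = _⟩ := h.inf₀₁ ⟨e' 1, e' 2⟩
  have h2 := e' 3
  rw [← hk] at h2
  rw [← inv_mul_eq_one, ← hk, h.thd_zpow_eq_one_of_mem₂ h2]

theorem oddFlag_injective : Function.Injective h.oddFlag := fun a b e => by
  have := h.adj_oddFlag a 0
  rw [e, h.adj_oddFlag] at this
  exact (mul_right_cancel (h.evenFlag_injective this)).symm

theorem act_injective : Function.Injective h.act := fun g g' e => by
  have h1 := h.act_smul_evenFlag g 1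
  have h2 := h.act_smul_evenFlag g' 1
  rw [e, h2] at h1
  simpa using (h.evenFlag_injective h1).symm

theorem closure_turn : closure {τ | ∃ i j, τ = h.turn i * (h.turn j)⁻¹} = ⊤ :=
  (eq_top_iff' _).2 fun u => by
    have := h.mem_closure_turn (fun _ => False) u (by simp)
    simpa using this

/-- Automorphisms commute with `adj`, so one that reverses the parity of one flag reverses it
everywhere. -/
theorem exists_smul_evenFlag_eq_oddFlag {f : h.toPolytope.AutomorphismGroup} {c : G}
    (hf : f • h.evenFlag 1 = h.oddFlag c) (u : G) : ∃ v, f • h.evenFlag u = h.oddFlag v := by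
  have step : ∀ g v i j, f • h.evenFlag g = h.oddFlag v →
      f • h.evenFlag (g * (h.turn i * (h.turn j)⁻¹)) =
        h.oddFlag (v * (h.turn i)⁻¹ * h.turn j) := by
    intro g v i j hv
    rw [← mul_assoc, ← h.adj_oddFlag, ← h.adj_evenFlag, ← h.adj_evenFlag, ← h.adj_oddFlag, ← hv,
      smul_adj, smul_adj]
  have hu : u ∈ closure {τ | ∃ i j, τ = h.turn i * (h.turn j)⁻¹} := by
    rw [h.closure_turn]; exact mem_top u
  induction hu using Subgroup.closure_induction_right with
  | one => exact ⟨c, hf⟩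
  | mul_right x _ y hy ih =>
    obtain ⟨i, j, rfl⟩ := hy
    obtain ⟨v, hv⟩ := ih
    exact ⟨_, step x v i j hv⟩
  | mul_inv_cancel x _ y hy ih =>
    obtain ⟨i, j, rfl⟩ := hy
    obtain ⟨v, hv⟩ := ih
    rw [mul_inv_rev, inv_inv]
    exact ⟨_, step x v j i hv⟩

/-- An automorphism moving an even flag to an odd flag induces the endomorphism of the group that
mirrors the generators. -/
theorem exists_mirror {f : h.toPolytope.AutomorphismGroup} {c : G}
    (hf : f • h.evenFlag 1 = h.oddFlag c) :
    ∃ ψ : G →* G, Function.Injective ψ ∧ ψ σ₁ = σ₁⁻¹ ∧ ψ σ₂ = σ₁ ^ 2 * σ₂ ∧ ψ σ₃ = σ₃ := by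
  -- After a translation, `f` takes the base flag to its 0-adjacent flag, so `f` is the reflection
  -- ρ₀. Conjugation by it inverts σ₁ = ρ₀ρ₁, sends σ₂ = ρ₁ρ₂ to σ₁²σ₂ and fixes σ₃ = ρ₂ρ₃.
  wlog hc : c = σ₁ * σ₂ * σ₃ generalizing f c
  · refine this (f := h.act (σ₁ * σ₂ * σ₃ * c⁻¹) * f) (c := σ₁ * σ₂ * σ₃) ?_ rfl
    rw [mul_smul, hf, h.act_smul_oddFlag, inv_mul_cancel_right]
  choose v hv using h.exists_smul_evenFlag_eq_oddFlag hf
  have hact : ∀ u, f * h.act u * f⁻¹ = h.act (v u * c⁻¹) := fun u => by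
    refine eq_of_smul_eq (Φ := h.oddFlag c) ?_
    rw [h.act_smul_oddFlag, inv_mul_cancel_right, ← hf, mul_smul, inv_smul_smul, mul_smul,
      h.act_smul_evenFlag, mul_one, hv]
  -- The mirror map is conjugation by `f`, pulled back along the injective action.
  let ψ : G →* G :=
    { toFun := fun u => v u * c⁻¹
      map_one' := h.act_injective (by rw [← hact]; simp)
      map_mul' := fun a b => h.act_injective (by
        rw [map_mul h.act (v a * c⁻¹), ← hact, ← hact, ← hact, map_mul]; group) }
  have hψ : ∀ u, f * h.act u * f⁻¹ = h.act (ψ u) := hact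
  have hτ : ∀ i j, ψ (h.turn i * (h.turn j)⁻¹) = c * (h.turn i)⁻¹ * h.turn j * c⁻¹ := by
    intro i j
    change v _ * c⁻¹ = _
    congr 1
    refine h.oddFlag_injective ?_
    have e1 : h.evenFlag (h.turn i * (h.turn j)⁻¹) = adj j (adj i (h.evenFlag 1)) := by
      rw [h.adj_evenFlag, h.adj_oddFlag, one_mul]
    have e2 : h.oddFlag (c * (h.turn i)⁻¹ * h.turn j) = adj j (adj i (h.oddFlag c)) := by
      rw [h.adj_oddFlag, h.adj_evenFlag]
    rw [← hv, e1, e2, smul_adj, smul_adj, hf]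
  have e0 := h.inv_fst_snd_thd
  refine ⟨ψ, fun a b e => h.act_injective ?_, ?_, ?_, ?_⟩
  · have := (hψ a).trans ((congrArg h.act e).trans (hψ b).symm)
    simpa using this
  · have := hτ 0 1
    rw [hc] at this
    simp only [turn] at this
    simpa [mul_assoc] using this
  · have := hτ 1 2
    rw [hc] at this
    simp only [turn] at this
    have e1 : σ₂ * σ₃ * σ₃⁻¹ = σ₂ := by group
    have e2 : σ₁ * σ₂ * σ₃ * (σ₂ * σ₃)⁻¹ * σ₃ * (σ₁ * σ₂ * σ₃)⁻¹ = σ₁ * (σ₁ * σ₂)⁻¹ := by group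
    have e3 : (σ₁ * σ₂)⁻¹ = σ₁ * σ₂ := by rw [mul_inv_rev, h.fst_snd_eq]
    simp only [Matrix.cons_val] at this
    rw [e1, e2, e3] at this
    rw [this, pow_two, mul_assoc]
  · have := hτ 2 3
    rw [hc] at this
    simp only [turn, Matrix.cons_val, inv_one, mul_one] at this
    have e1 : σ₁ * σ₂ * σ₃ * σ₃⁻¹ = σ₁ * σ₂ := by group
    rw [e1, e0] at this
    rw [this]
    have e2 := h.sq_fst_snd
    rw [pow_two] at e2
    rw [← mul_assoc, e2, one_mul]

variable (hmirror : ¬ ∃ ψ : G →* G, Function.Injective ψ ∧ ψ σ₁ = σ₁⁻¹ ∧ ψ σ₂ = σ₁ ^ 2 * σ₂ ∧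
  ψ σ₃ = σ₃)
include hmirror

theorem smul_evenFlag_ne_oddFlag (f : h.toPolytope.AutomorphismGroup) (g g' : G) :
    f • h.evenFlag g ≠ h.oddFlag g' := fun e =>
  hmirror (h.exists_mirror (f := f * h.act g) (c := g')
    (by rw [mul_smul, h.act_smul_evenFlag, mul_one, e]))

theorem isChiral_toPolytope : h.toPolytope.IsChiral := by
  have hne := h.smul_evenFlag_ne_oddFlag hmirror
  constructor
  · rw [Nat.card_eq_two_iff]
    refine ⟨Quotient.mk _ (h.evenFlag 1), Quotient.mk _ (h.oddFlag 1), fun e => ?_, ?_⟩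
    · obtain ⟨f, hf⟩ := Quotient.exact e.symm
      exact hne f _ _ hf
    · refine Set.eq_univ_of_forall fun q => ?_
      induction q using Quotient.inductionOn with
      | h Φ =>
      obtain ⟨g, rfl | rfl⟩ := h.flag_eq_evenFlag_or Φ
      · refine Or.inl (Quotient.sound ⟨h.act g, ?_⟩)
        have := h.act_smul_evenFlag g 1
        rwa [mul_one] at this
      · refine Or.inr (Quotient.sound ⟨h.act g, ?_⟩)
        have := h.act_smul_oddFlag g 1
        rwa [mul_one] at this
  · rintro Φ Ψ hadj ⟨f, hf⟩
    obtain ⟨i, rfl⟩ := (adjacent_iff).1 hadj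
    obtain ⟨g, rfl | rfl⟩ := h.flag_eq_evenFlag_or Φ
    · rw [h.adj_evenFlag] at hf
      exact hne f _ _ hf
    · rw [h.adj_oddFlag] at hf
      refine hne f⁻¹ _ _ (inv_smul_eq_iff.2 hf.symm)

/-- The automorphism group of the polytope of cosets. -/
noncomputable def actEquiv : G ≃* h.toPolytope.AutomorphismGroup :=
  MulEquiv.ofBijective h.act ⟨h.act_injective, fun f => by
    obtain ⟨g, hg | hg⟩ := h.flag_eq_evenFlag_or
      (f • h.evenFlag 1)
    · refine ⟨g, eq_of_smul_eq (Φ := h.evenFlag 1) ?_⟩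
      rw [h.act_smul_evenFlag, hg, mul_one]
    · exact absurd hg (h.smul_evenFlag_ne_oddFlag hmirror f _ _)⟩

theorem actEquiv_turn (i j : Fin 4) :
    h.actEquiv hmirror (h.turn i * (h.turn j)⁻¹) =
      rotation (h.isChiral_toPolytope hmirror) (h.evenFlag 1) i j := by
  refine eq_of_smul_eq (Φ := h.evenFlag 1) ?_
  rw [rotation_smul, h.adj_evenFlag, h.adj_oddFlag, one_mul]
  exact (h.act_smul_evenFlag _ _).trans (by rw [mul_one])

/-- A group with generators satisfying the intersection property and without a mirror endomorphism
is the automorphism group of a chiral polytope with the generators as distinguished rotations. -/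
theorem exists_basedPolytope :
    ∃ (A : BasedPolytope.{u} 4) (hA : A.polytope.IsChiral),
      A.polytope.HasType ![5, 3, 4] ∧ ∃ θ : A.polytope.AutomorphismGroup ≃* G,
        θ (rotation hA A.baseFlag 0 1) = σ₁ ∧ θ (rotation hA A.baseFlag 1 2) = σ₂ ∧
          θ (rotation hA A.baseFlag 2 3) = σ₃ := by
  refine ⟨⟨h.toPolytope, h.evenFlag 1⟩, h.isChiral_toPolytope hmirror, h.hasType_toPolytope,
    (h.actEquiv hmirror).symm, ?_, ?_, ?_⟩
  · rw [MulEquiv.symm_apply_eq, ← h.actEquiv_turn hmirror]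
    simp [turn, mul_assoc]
  · rw [MulEquiv.symm_apply_eq, ← h.actEquiv_turn hmirror]
    simp [turn]
  · rw [MulEquiv.symm_apply_eq, ← h.actEquiv_turn hmirror]
    simp [turn]

end IsRotaryGenerators

/-! ### Traces in SL(2, K) and orders in PSL(2, K) -/

namespace PSLTwo

open scoped MatrixGroups
open Matrix

variable {K : Type*} [Field K]

/-- The projection from `SL(2, K)` to `PSL(2, K)`. -/
def proj : SL(2, K) →* PSL(2, K) := QuotientGroup.mk' _

theorem exists_proj (σ : PSL(2, K)) : ∃ A, proj A = σ := QuotientGroup.mk'_surjective _ σ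

/-- The trace of an element of `SL(2, K)`. -/
def tr (A : SL(2, K)) : K := trace A.1

theorem val_mul (A B : SL(2, K)) : (A * B).1 = A.1 * B.1 := rfl

theorem val_neg (A : SL(2, K)) : (-A).1 = -A.1 := rfl

theorem val_one : (1 : SL(2, K)).1 = 1 := rfl

theorem val_pow (A : SL(2, K)) (n : ℕ) : (A ^ n).1 = A.1 ^ n := rfl

theorem eq_one_or_eq_neg_one_of_val_eq_smul {r : K} {A : SL(2, K)} (h : A.1 = r • 1) :
    A = 1 ∨ A = -1 := by
  have hd := A.2
  rw [h, det_smul, det_one, mul_one, Fintype.card_fin, sq_eq_one_iff] at hd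
  rcases hd with rfl | rfl
  · exact Or.inl (Subtype.ext (by rw [h, one_smul, val_one]))
  · exact Or.inr (Subtype.ext (by rw [h, neg_one_smul, val_neg, val_one]))

theorem mem_center_iff {A : SL(2, K)} : A ∈ Subgroup.center SL(2, K) ↔ A = 1 ∨ A = -1 := by
  rw [Matrix.SpecialLinearGroup.mem_center_iff]
  constructor
  · rintro ⟨r, hr, h⟩
    exact eq_one_or_eq_neg_one_of_val_eq_smul (r := r) (by rw [← h, smul_one_eq_diagonal]; rfl)
  · rintro (rfl | rfl)
    · exact ⟨1, one_pow _, by simp⟩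
    · exact ⟨-1, by simp, by rw [scalar_apply, val_neg, val_one, ← diagonal_one, diagonal_neg]⟩

theorem proj_eq_one_iff {A : SL(2, K)} : proj A = 1 ↔ A = 1 ∨ A = -1 := by
  rw [← mem_center_iff]
  exact QuotientGroup.eq_one_iff A

theorem proj_eq_proj_iff {A B : SL(2, K)} : proj A = proj B ↔ A = B ∨ A = -B := by
  rw [← mul_inv_eq_one, ← map_inv, ← map_mul, proj_eq_one_iff, mul_inv_eq_one,
    mul_inv_eq_iff_eq_mul, neg_one_mul]

@[simp] theorem proj_neg (A : SL(2, K)) : proj (-A) = proj A := proj_eq_proj_iff.2 (Or.inr rfl)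

@[simp] theorem tr_neg (A : SL(2, K)) : tr (-A) = -tr A := by
  rw [tr, val_neg, trace_neg]; rfl

theorem tr_mul_comm (A B : SL(2, K)) : tr (A * B) = tr (B * A) := by
  rw [tr, val_mul, trace_mul_comm]; rfl

theorem val_inv (A : SL(2, K)) : (A⁻¹).1 = tr A • 1 - A.1 := by
  change adjugate A.1 = _
  rw [adjugate_fin_two]
  ext i j
  fin_cases i <;> fin_cases j <;> simp [tr, trace_fin_two]

theorem tr_one : tr (1 : SL(2, K)) = 2 := by
  rw [tr, val_one, trace_one]; simp

@[simp] theorem tr_inv (A : SL(2, K)) : tr A⁻¹ = tr A := by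
  rw [tr, val_inv, trace_sub, trace_smul, trace_one]
  simp only [Fintype.card_fin, smul_eq_mul]
  rw [← tr]; push_cast; ring

theorem val_mul_self (A : SL(2, K)) : A.1 * A.1 = tr A • A.1 - 1 := by
  have h : (A * A⁻¹).1 = 1 := by rw [mul_inv_cancel]; rfl
  rw [val_mul, val_inv, mul_sub, mul_smul_comm, mul_one] at h
  rw [← h]; abel

theorem tr_mul_add (A B : SL(2, K)) : tr (A * B) + tr (A⁻¹ * B) = tr A * tr B := by
  have h : A.1 * B.1 + (A⁻¹).1 * B.1 = tr A • B.1 := by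
    rw [val_inv, sub_mul, smul_mul_assoc, one_mul]; abel
  have := congrArg trace h
  rw [trace_add, trace_smul] at this
  exact this

/-- By Cayley–Hamilton every power is a combination of the matrix and 1, with Chebyshev polynomials
of the trace as coefficients. -/
theorem val_pow_two (A : SL(2, K)) : (A ^ 2).1 = tr A • A.1 - (1 : K) • 1 := by
  rw [val_pow, pow_two, val_mul_self, one_smul]

theorem val_pow_three (A : SL(2, K)) : (A ^ 3).1 = (tr A ^ 2 - 1) • A.1 - tr A • 1 := by
  rw [pow_succ, val_mul, val_pow_two, sub_mul, smul_mul_assoc, val_mul_self, one_smul, one_mul]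
  module

theorem val_pow_four (A : SL(2, K)) :
    (A ^ 4).1 = (tr A ^ 3 - 2 * tr A) • A.1 - (tr A ^ 2 - 1) • 1 := by
  rw [pow_succ, val_mul, val_pow_three, sub_mul, smul_mul_assoc, val_mul_self, smul_mul_assoc,
    one_mul]
  module

theorem val_pow_five (A : SL(2, K)) :
    (A ^ 5).1 = (tr A ^ 4 - 3 * tr A ^ 2 + 1) • A.1 - (tr A ^ 3 - 2 * tr A) • 1 := by
  rw [pow_succ, val_mul, val_pow_four, sub_mul, smul_mul_assoc, val_mul_self, smul_mul_assoc,
    one_mul]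
  module

/-- Here `A` is not scalar, so a combination of `A` and 1 is scalar only if `A` does not occur.
Applied to powers, this turns orders in PSL(2, K) into equations for the trace. -/
theorem proj_eq_one_iff_of_val_eq {A B : SL(2, K)} {c d : K} (hA : proj A ≠ 1)
    (h : B.1 = c • A.1 - d • 1) : proj B = 1 ↔ c = 0 := by
  constructor
  · intro hB
    by_contra hc
    obtain ⟨r, hr⟩ : ∃ r : K, B.1 = r • 1 := by
      rcases proj_eq_one_iff.1 hB with rfl | rfl
      · exact ⟨1, by rw [one_smul, val_one]⟩
      · exact ⟨-1, by rw [neg_one_smul, val_neg, val_one]⟩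
    refine hA (proj_eq_one_iff.2 (eq_one_or_eq_neg_one_of_val_eq_smul (r := c⁻¹ * (r + d)) ?_))
    rw [mul_smul, add_smul, ← hr, h, sub_add_cancel, smul_smul, inv_mul_cancel₀ hc, one_smul]
  · rintro rfl
    rw [zero_smul, zero_sub, ← neg_smul] at h
    exact proj_eq_one_iff.2 (eq_one_or_eq_neg_one_of_val_eq_smul h)

theorem proj_pow_two_eq_one_iff {A : SL(2, K)} (hA : proj A ≠ 1) : proj A ^ 2 = 1 ↔ tr A = 0 := by
  rw [← map_pow, proj_eq_one_iff_of_val_eq hA (val_pow_two A)]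

theorem proj_pow_three_eq_one_iff {A : SL(2, K)} (hA : proj A ≠ 1) :
    proj A ^ 3 = 1 ↔ tr A ^ 2 = 1 := by
  rw [← map_pow, proj_eq_one_iff_of_val_eq hA (val_pow_three A), sub_eq_zero]

theorem proj_pow_four_eq_one_iff {A : SL(2, K)} (hA : proj A ≠ 1) :
    proj A ^ 4 = 1 ↔ tr A = 0 ∨ tr A ^ 2 = 2 := by
  rw [← map_pow, proj_eq_one_iff_of_val_eq hA (val_pow_four A),
    show tr A ^ 3 - 2 * tr A = tr A * (tr A ^ 2 - 2) by ring, mul_eq_zero, sub_eq_zero]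

theorem proj_pow_five_eq_one_iff {A : SL(2, K)} (hA : proj A ≠ 1) :
    proj A ^ 5 = 1 ↔ tr A ^ 2 = tr A + 1 ∨ tr A ^ 2 = -tr A + 1 := by
  rw [← map_pow, proj_eq_one_iff_of_val_eq hA (val_pow_five A),
    show tr A ^ 4 - 3 * tr A ^ 2 + 1 = (tr A ^ 2 - (tr A + 1)) * (tr A ^ 2 - (-tr A + 1)) by ring,
    mul_eq_zero, sub_eq_zero, sub_eq_zero]

theorem tr_sq_of_proj_eq_one {A : SL(2, K)} (hA : proj A = 1) : tr A = 2 ∨ tr A = -2 := by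
  rcases proj_eq_one_iff.1 hA with rfl | rfl
  · exact Or.inl tr_one
  · exact Or.inr (by rw [tr_neg, tr_one])

theorem orderOf_proj_eq_two {A : SL(2, K)} (h2 : (2 : K) ≠ 0) (h : tr A = 0) :
    orderOf (proj A) = 2 := by
  have hA : proj A ≠ 1 := fun hA => by
    rcases tr_sq_of_proj_eq_one hA with e | e <;> rw [h] at e
    · exact h2 e.symm
    · exact h2 (by linear_combination e)
  exact orderOf_eq_prime ((proj_pow_two_eq_one_iff hA).2 h) hA

theorem orderOf_proj_eq_three {A : SL(2, K)} (h3 : (3 : K) ≠ 0) (h : tr A ^ 2 = 1) :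
    orderOf (proj A) = 3 := by
  have hA : proj A ≠ 1 := fun hA => h3 (by
    rcases tr_sq_of_proj_eq_one hA with e | e <;> rw [e] at h <;> linear_combination h)
  exact orderOf_eq_prime ((proj_pow_three_eq_one_iff hA).2 h) hA

theorem orderOf_proj_eq_four {A : SL(2, K)} (h2 : (2 : K) ≠ 0) (h : tr A ^ 2 = 2) :
    orderOf (proj A) = 4 := by
  have h0 : tr A ≠ 0 := fun e => h2 (by rw [← h, e]; ring)
  have hA : proj A ≠ 1 := fun hA => h2 (by
    rcases tr_sq_of_proj_eq_one hA with e | e <;> rw [e] at h <;> linear_combination h)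
  have := orderOf_eq_prime_pow (p := 2) (n := 1) (x := proj A)
    (by rw [pow_one, proj_pow_two_eq_one_iff hA]; exact h0)
    (by norm_num; exact (proj_pow_four_eq_one_iff hA).2 (Or.inr h))
  simpa using this

theorem orderOf_proj_eq_five {A : SL(2, K)} (h5 : (5 : K) ≠ 0)
    (h : tr A ^ 2 = tr A + 1 ∨ tr A ^ 2 = -tr A + 1) : orderOf (proj A) = 5 := by
  have : Fact (Nat.Prime 5) := ⟨by norm_num⟩
  have hA : proj A ≠ 1 := fun hA => by
    have h' : (tr A ^ 2 - tr A - 1) * (tr A ^ 2 + tr A - 1) = 0 := by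
      rcases h with h | h <;> rw [h] <;> ring
    rcases tr_sq_of_proj_eq_one hA with e | e <;> rw [e] at h' <;>
      exact h5 (by linear_combination h')
  exact orderOf_eq_prime ((proj_pow_five_eq_one_iff hA).2 h) hA

/-- Fricke's identity, made homogeneous by determinants: in this form it is a polynomial identity in
the twelve entries, with no side conditions. -/
theorem det_trace_identity (A B C : Matrix (Fin 2) (Fin 2) K) :
    trace (A * B * C) * trace (A * C * B) = trace A ^ 2 * det B * det C +
      trace B ^ 2 * det A * det C + trace C ^ 2 * det A * det B + trace (A * B) ^ 2 * det C +
      trace (B * C) ^ 2 * det A + trace (A * C) ^ 2 * det B -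
      trace A * trace B * trace (A * B) * det C - trace B * trace C * trace (B * C) * det A -
      trace A * trace C * trace (A * C) * det B +
      trace (A * B) * trace (B * C) * trace (A * C) - 4 * det A * det B * det C := by
  simp only [det_fin_two, trace_fin_two, mul_apply, Fin.sum_univ_two]
  ring

/-- The product of the two triple traces of three elements of `SL(2, K)`. -/
theorem tr_mul_mul_mul_tr_mul_mul (A B C : SL(2, K)) :
    tr (A * B * C) * tr (A * C * B) = tr A ^ 2 + tr B ^ 2 + tr C ^ 2 + tr (A * B) ^ 2 +
      tr (B * C) ^ 2 + tr (A * C) ^ 2 - tr A * tr B * tr (A * B) - tr B * tr C * tr (B * C) -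
      tr A * tr C * tr (A * C) + tr (A * B) * tr (B * C) * tr (A * C) - 4 := by
  have h := det_trace_identity A.1 B.1 C.1
  rw [A.2, B.2, C.2] at h
  simp only [tr, val_mul]
  rw [h]
  ring

/-- The sum of the two triple traces of three elements of `SL(2, K)`. -/
theorem tr_mul_mul_add_tr_mul_mul (A B C : SL(2, K)) :
    tr (A * B * C) + tr (A * C * B) = tr A * tr (B * C) + tr B * tr (A * C) + tr C * tr (A * B) -
      tr A * tr B * tr C := by
  simp only [tr, val_mul, trace_fin_two, mul_apply, Fin.sum_univ_two]
  ring

end PSLTwo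

/-! ### The parameters of a rotary triple -/

namespace PSLTwo

open scoped MatrixGroups
open Matrix

variable {K : Type*} [Field K]

/-- The trace conditions on lifts `a`, `α`, `γ` to `SL(2, K)` of the elements `σ₂`, `σ₁σ₂` and
`σ₂σ₃` of a rotary triple. -/
structure IsFrame (a α γ : SL(2, K)) (w x z : K) : Prop where
  tr_a : tr a = 1
  tr_α : tr α = 0
  tr_γ : tr γ = 0
  tr_aα : tr (a * α) = x
  tr_aγ : tr (a * γ) = w
  tr_αγ : tr (α * γ) = z
  -- Since tr a = 1 means a⁻¹ = 1 − a, this says tr(αa⁻¹γ) = 0, that is, the square of σ₁σ₂σ₃ is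
  -- trivial.
  tr_αaγ : tr (α * a * γ) = z

/-- The parameters of a triple of elements of `PSL(2, K)`. -/
def HasParam (σ₁ σ₂ σ₃ : PSL(2, K)) (w x z : K) : Prop :=
  ∃ a α γ : SL(2, K), IsFrame a α γ w x z ∧ proj a = σ₂ ∧ proj α = σ₁ * σ₂ ∧ proj γ = σ₂ * σ₃

namespace IsFrame

variable {a α γ : SL(2, K)} {w x z : K}

theorem tr_aαγ (h : IsFrame a α γ w x z) : tr (a * α * γ) = 0 := by
  have := tr_mul_mul_add_tr_mul_mul α a γ
  rw [h.tr_αaγ, h.tr_α, h.tr_a, h.tr_γ, h.tr_αγ, mul_assoc α γ a, tr_mul_comm α (γ * a),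
    tr_mul_comm (γ * a) α, ← mul_assoc, tr_mul_comm (α * γ) a, ← mul_assoc] at this
  linear_combination this

/-- One of the two triple traces of α, a, γ vanishes, so Fricke's formula for their product becomes
an equation between w, x and z. -/
theorem relation (h : IsFrame a α γ w x z) (hw : w ^ 2 = 2) :
    z ^ 2 + x * w * z + x ^ 2 - 1 = 0 := by
  have := tr_mul_mul_mul_tr_mul_mul α a γ
  rw [tr_mul_comm (α * γ) a, ← mul_assoc, h.tr_aαγ, tr_mul_comm α a, h.tr_α, h.tr_a, h.tr_γ,
    h.tr_αγ, h.tr_aα, h.tr_aγ] at this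
  linear_combination -hw - this

end IsFrame

theorem orderOf_eq_of_mul_eq_one {G : Type*} [Group G] {g h : G} (e : g * h = 1) :
    orderOf g = orderOf h := by
  rw [eq_inv_of_mul_eq_one_left e, orderOf_inv]

theorem tr_inv_mul (A B : SL(2, K)) : tr (A⁻¹ * B) = tr A * tr B - tr (A * B) := by
  rw [← tr_mul_add]; ring

theorem tr_mul_inv_mul (A B C : SL(2, K)) :
    tr (A * B⁻¹ * C) = tr B * tr (A * C) - tr (A * B * C) := by
  rw [tr_mul_comm (A * B⁻¹) C, ← mul_assoc, tr_mul_comm (C * A), tr_inv_mul, tr_mul_comm B (C * A),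
    mul_assoc, tr_mul_comm C A, tr_mul_comm C (A * B)]

/-- A rotary triple has parameters; the sign of the square root `w` of `2` is arbitrary. -/
theorem _root_.IsRotaryTriple.exists_hasParam {σ₁ σ₂ σ₃ : PSL(2, K)}
    (h : IsRotaryTriple σ₁ σ₂ σ₃) :
    (2 : K) ≠ 0 ∧ (∃ w : K, w ^ 2 = 2) ∧ ∀ w : K, w ^ 2 = 2 →
      ∃ x z : K, x ^ 2 = x + 1 ∧ z ^ 2 + x * w * z + x ^ 2 - 1 = 0 ∧ HasParam σ₁ σ₂ σ₃ w x z := by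
  have n1 : σ₁ * σ₂ ≠ 1 := fun e => by
    have := orderOf_eq_of_mul_eq_one e
    rw [h.orderOf_fst, h.orderOf_snd] at this
    omega
  have n2 : σ₂ * σ₃ ≠ 1 := fun e => by
    have := orderOf_eq_of_mul_eq_one e
    rw [h.orderOf_snd, h.orderOf_thd] at this
    omega
  have n3 : σ₁ * σ₂ * σ₃ ≠ 1 := fun e => by
    have e1 := orderOf_eq_of_mul_eq_one e
    have e2 := orderOf_dvd_of_pow_eq_one h.sq_fst_snd
    rw [e1, h.orderOf_thd] at e2
    omega
  have m1 : σ₁ ≠ 1 := fun e => by have := h.orderOf_fst; rw [e, orderOf_one] at this; omega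
  have m2 : σ₂ ≠ 1 := fun e => by have := h.orderOf_snd; rw [e, orderOf_one] at this; omega
  have m3 : σ₃ ≠ 1 := fun e => by have := h.orderOf_thd; rw [e, orderOf_one] at this; omega
  obtain ⟨a, ha, hta⟩ : ∃ a, proj a = σ₂ ∧ tr a = 1 := by
    obtain ⟨a, rfl⟩ := exists_proj σ₂
    have : tr a ^ 2 = 1 := (proj_pow_three_eq_one_iff m2).1 (h.orderOf_snd ▸ pow_orderOf_eq_one _)
    rcases sq_eq_one_iff.1 this with e | e
    · exact ⟨a, rfl, e⟩
    · exact ⟨-a, proj_neg a, by rw [tr_neg, e, neg_neg]⟩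
  obtain ⟨α₀, hα₀⟩ := exists_proj (σ₁ * σ₂)
  obtain ⟨γ₀, hγ₀⟩ := exists_proj (σ₂ * σ₃)
  have htα₀ : tr α₀ = 0 := (proj_pow_two_eq_one_iff (hα₀ ▸ n1)).1 (hα₀ ▸ h.sq_fst_snd)
  have htγ₀ : tr γ₀ = 0 := (proj_pow_two_eq_one_iff (hγ₀ ▸ n2)).1 (hγ₀ ▸ h.sq_snd_thd)
  -- The element a⁻¹α is a lift of a conjugate of σ₁. Order 5 allows x² = x + 1 or x² = −x + 1; the
  -- sign of α is chosen to obtain the former.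
  obtain ⟨α, hα, htα, hx⟩ : ∃ α, proj α = σ₁ * σ₂ ∧ tr α = 0 ∧
      tr (a * α) ^ 2 = tr (a * α) + 1 := by
    have e : proj (a⁻¹ * α₀) = σ₂⁻¹ * σ₁ * σ₂ := by
      rw [map_mul, map_inv, ha, hα₀, mul_assoc]
    have e1 : proj (a⁻¹ * α₀) ≠ 1 := fun h1 => m1 (by
      rw [e] at h1
      simpa [mul_eq_one_iff_eq_inv] using h1)
    have e5 : proj (a⁻¹ * α₀) ^ 5 = 1 := by
      have := conj_pow (i := 5) (a := σ₂⁻¹) (b := σ₁)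
      rw [inv_inv] at this
      rw [e, this, ← h.orderOf_fst, pow_orderOf_eq_one]
      simp
    have := (proj_pow_five_eq_one_iff e1).1 e5
    rw [tr_inv_mul, htα₀, mul_zero, zero_sub] at this
    rcases this with e | e
    · refine ⟨-α₀, by rw [proj_neg, hα₀], by rw [tr_neg, htα₀, neg_zero], ?_⟩
      rw [mul_neg, tr_neg]
      exact e
    · exact ⟨α₀, hα₀, htα₀, by linear_combination e⟩
  have e3 : proj (a⁻¹ * γ₀) = σ₃ := by
    rw [map_mul, map_inv, ha, hγ₀, inv_mul_cancel_left]
  have hw : tr (a * γ₀) ^ 2 = 2 ∧ tr (a * γ₀) ≠ 0 := by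
    have e4 : tr (a⁻¹ * γ₀) = -tr (a * γ₀) := by rw [tr_inv_mul, htγ₀, mul_zero, zero_sub]
    have h0 : tr (a⁻¹ * γ₀) ≠ 0 := fun h0 => by
      have := (proj_pow_two_eq_one_iff (e3 ▸ m3)).2 h0
      rw [e3] at this
      have := orderOf_dvd_of_pow_eq_one this
      rw [h.orderOf_thd] at this
      omega
    have := ((proj_pow_four_eq_one_iff (A := a⁻¹ * γ₀) (e3 ▸ m3)).1
      (by rw [e3, ← h.orderOf_thd, pow_orderOf_eq_one])).resolve_left h0
    rw [e4] at this h0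
    exact ⟨by rw [← this]; ring, fun e => h0 (by rw [e, neg_zero])⟩
  refine ⟨fun h2 => hw.2 (by simpa [h2] using hw.1), ⟨_, hw.1⟩, fun w hww => ?_⟩
  -- The sign of γ absorbs the choice between the two square roots of 2.
  obtain ⟨γ, hγ, htγ, hγw⟩ : ∃ γ, proj γ = σ₂ * σ₃ ∧ tr γ = 0 ∧ tr (a * γ) = w := by
    rcases sq_eq_sq_iff_eq_or_eq_neg.1 (hw.1.trans hww.symm) with e | e
    · exact ⟨γ₀, hγ₀, htγ₀, e⟩
    · exact ⟨-γ₀, by rw [proj_neg, hγ₀], by rw [tr_neg, htγ₀, neg_zero],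
        by rw [mul_neg, tr_neg, e, neg_neg]⟩
  have e6 : proj (α * a⁻¹ * γ) = σ₁ * σ₂ * σ₃ := by
    rw [map_mul, map_mul, map_inv, hα, ha, hγ]; group
  have h6 : tr (α * a⁻¹ * γ) = 0 :=
    (proj_pow_two_eq_one_iff (e6 ▸ n3)).1 (e6 ▸ h.sq_fst_snd_thd)
  have hf : IsFrame a α γ w (tr (a * α)) (tr (α * γ)) :=
    ⟨hta, htα, htγ, rfl, hγw, rfl, by rw [tr_mul_inv_mul, hta] at h6; linear_combination -h6⟩
  exact ⟨_, _, hx, hf.relation hww, a, α, γ, hf, ha, hα, hγ⟩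

end PSLTwo

/-! ### The basis 1, a, α, aα and uniqueness of triples -/

namespace PSLTwo

open scoped MatrixGroups
open Matrix

variable {K : Type*} [Field K]

/-- The products `1`, `a`, `α`, `aα`. -/
def quad (a α : SL(2, K)) : Fin 4 → Matrix (Fin 2) (Fin 2) K := ![1, a.1, α.1, a.1 * α.1]

/-- The structure constants of the algebra spanned by `1`, `a`, `α`, `aα`, where `tr a = 1`,
`tr α = 0` and `tr (aα) = x`. -/
def structureConstant (x : K) : Fin 4 → Fin 4 → Fin 4 → K :=
  ![![![1, 0, 0, 0], ![0, 1, 0, 0], ![0, 0, 1, 0], ![0, 0, 0, 1]],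
    ![![0, 1, 0, 0], ![-1, 1, 0, 0], ![0, 0, 0, 1], ![0, 0, -1, 1]],
    ![![0, 0, 1, 0], ![x, 0, 1, -1], ![-1, 0, 0, 0], ![-1, 1, x, 0]],
    ![![0, 0, 0, 1], ![0, x, 1, 0], ![0, -1, 0, 0], ![-1, 0, 0, x]]]

section

variable {a α : SL(2, K)} {x d : K}

theorem val_mul_val_comm (h1 : tr a = 1) (h2 : tr α = 0) (h3 : tr (a * α) = x) :
    α.1 * a.1 = x • (1 : Matrix (Fin 2) (Fin 2) K) + α.1 - a.1 * α.1 := by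
  have e : (a⁻¹ * α⁻¹).1 = x • 1 - α.1 * a.1 := by
    rw [← _root_.mul_inv_rev, val_inv, tr_mul_comm, h3, val_mul]
  rw [val_mul, val_inv, val_inv, h1, h2, zero_smul, zero_sub, one_smul, sub_mul, one_mul, mul_neg,
    sub_neg_eq_add] at e
  rw [← sub_eq_zero] at e ⊢
  rw [← e]
  abel

theorem quad_mul_quad (h1 : tr a = 1) (h2 : tr α = 0) (h3 : tr (a * α) = x) (i j : Fin 4) :
    quad a α i * quad a α j = ∑ k, structureConstant x i j k • quad a α k := by
  have e11 : a.1 * a.1 = a.1 - 1 := by rw [val_mul_self, h1, one_smul]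
  have e22 : α.1 * α.1 = -1 := by rw [val_mul_self, h2, zero_smul, zero_sub]
  have e21 := val_mul_val_comm h1 h2 h3
  have e13 : a.1 * (a.1 * α.1) = a.1 * α.1 - α.1 := by rw [← mul_assoc, e11, sub_mul, one_mul]
  have e32 : a.1 * α.1 * α.1 = -a.1 := by rw [mul_assoc, e22, mul_neg, mul_one]
  have e31 : a.1 * α.1 * a.1 = x • a.1 + α.1 := by
    rw [mul_assoc, e21, mul_sub, mul_add, mul_smul_comm, mul_one, e13]; abel
  have e23 : α.1 * (a.1 * α.1) = x • α.1 - 1 + a.1 := by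
    rw [← mul_assoc, e21, sub_mul, add_mul, smul_mul_assoc, one_mul, e22, e32]; abel
  have e33 : a.1 * α.1 * (a.1 * α.1) = x • (a.1 * α.1) - 1 := by
    rw [mul_assoc, e23, mul_add, mul_sub, mul_smul_comm, mul_one, e11]; abel
  fin_cases i <;> fin_cases j <;>
    simp [quad, structureConstant, Fin.sum_univ_four, e11, e22, e21, e13, e32, e31, e23, e33] <;>
    abel

theorem trace_quad_mul_sum (h1 : tr a = 1) (h2 : tr α = 0) (h3 : tr (a * α) = x) (c : Fin 4 → K) :
    trace (∑ i, c i • quad a α i) = 2 * c 0 + c 1 + x * c 3 := by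
  have h3' : trace (a.1 * α.1) = x := h3
  have h1' : trace a.1 = 1 := h1
  have h2' : trace α.1 = 0 := h2
  simp [Fin.sum_univ_four, quad, h1', h2', h3']
  ring

/-- The coordinates of a matrix with respect to `1`, `a`, `α`, `aα`. -/
theorem coord_eq (hd : d * (x ^ 2 - 3) = 1) (h1 : tr a = 1) (h2 : tr α = 0) (h3 : tr (a * α) = x)
    (c : Fin 4 → K) {M : Matrix (Fin 2) (Fin 2) K} (hM : ∑ i, c i • quad a α i = M) :
    c = ![d * ((x ^ 2 - 1) * trace M - trace (a.1 * M) - x * trace (a.1 * α.1 * M)),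
      d * (-trace M + 2 * trace (a.1 * M) + x * trace (α.1 * M)),
      d * (x * trace (a.1 * M) + 2 * trace (α.1 * M) - trace (a.1 * α.1 * M)),
      d * (-x * trace M - trace (α.1 * M) + 2 * trace (a.1 * α.1 * M))] := by
  have key (j : Fin 4) : trace (quad a α j * M) =
      ∑ i, c i * (2 * structureConstant x j i 0 + structureConstant x j i 1 +
        x * structureConstant x j i 3) := by
    rw [← hM, Finset.mul_sum, trace_sum]
    refine Finset.sum_congr rfl fun i _ => ?_
    rw [mul_smul_comm, trace_smul, quad_mul_quad h1 h2 h3, trace_quad_mul_sum h1 h2 h3, smul_eq_mul]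
  have k0 := key 0
  have k1 := key 1
  have k2 := key 2
  have k3 := key 3
  simp [quad, structureConstant, Fin.sum_univ_four] at k0 k1 k2 k3
  rw [k0, k1, k2, k3]
  ext i
  fin_cases i <;> simp
  · linear_combination -c 0 * hd
  · linear_combination -c 1 * hd
  · linear_combination -c 2 * hd
  · linear_combination -c 3 * hd

/-- As x² − 3 is invertible, the trace form on these four matrices is nondegenerate and the
coordinates are recovered from traces. -/
theorem linearIndependent_quad (hd : d * (x ^ 2 - 3) = 1) (h1 : tr a = 1) (h2 : tr α = 0)
    (h3 : tr (a * α) = x) : LinearIndependent K (quad a α) := by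
  rw [Fintype.linearIndependent_iff]
  intro c hc i
  rw [coord_eq hd h1 h2 h3 c hc]
  fin_cases i <;> simp

/-- The basis `1`, `a`, `α`, `aα` of the matrix algebra. -/
noncomputable def quadBasis (hd : d * (x ^ 2 - 3) = 1) (h1 : tr a = 1) (h2 : tr α = 0)
    (h3 : tr (a * α) = x) : Module.Basis (Fin 4) K (Matrix (Fin 2) (Fin 2) K) :=
  basisOfLinearIndependentOfCardEqFinrank (linearIndependent_quad hd h1 h2 h3)
    (by simp [Module.finrank_matrix])

theorem quadBasis_apply (hd : d * (x ^ 2 - 3) = 1) (h1 : tr a = 1) (h2 : tr α = 0)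
    (h3 : tr (a * α) = x) (i : Fin 4) : quadBasis hd h1 h2 h3 i = quad a α i := by
  simp [quadBasis]

theorem eq_sum_quad (hd : d * (x ^ 2 - 3) = 1) (h1 : tr a = 1) (h2 : tr α = 0) (h3 : tr (a * α) = x)
    (M : Matrix (Fin 2) (Fin 2) K) :
    ∃ c : Fin 4 → K, ∑ i, c i • quad a α i = M :=
  ⟨(quadBasis hd h1 h2 h3).repr M, by
    conv_rhs => rw [← (quadBasis hd h1 h2 h3).sum_repr M]
    simp only [quadBasis_apply]⟩

/-- The structure constants in the basis depend only on x, so matching the two bases is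
multiplicative. -/
theorem exists_algEquiv_of_tr {a' α' : SL(2, K)} (hd : d * (x ^ 2 - 3) = 1)
    (h1 : tr a = 1) (h2 : tr α = 0) (h3 : tr (a * α) = x)
    (h1' : tr a' = 1) (h2' : tr α' = 0) (h3' : tr (a' * α') = x) :
    ∃ f : Matrix (Fin 2) (Fin 2) K ≃ₐ[K] Matrix (Fin 2) (Fin 2) K,
      f a.1 = a'.1 ∧ f α.1 = α'.1 := by
  let b := quadBasis hd h1 h2 h3
  let b' := quadBasis hd h1' h2' h3'
  let l := b.equiv b' (Equiv.refl _)
  have hl (i : Fin 4) : l (quad a α i) = quad a' α' i := by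
    have := b.equiv_apply i b' (Equiv.refl _)
    rwa [quadBasis_apply, Equiv.refl_apply, quadBasis_apply] at this
  have hmul (M N : Matrix (Fin 2) (Fin 2) K) : l (M * N) = l M * l N := by
    obtain ⟨c, rfl⟩ := eq_sum_quad hd h1 h2 h3 M
    obtain ⟨e, rfl⟩ := eq_sum_quad hd h1 h2 h3 N
    simp only [Finset.sum_mul, Finset.mul_sum, map_sum, map_smul, smul_mul_assoc, mul_smul_comm,
      quad_mul_quad h1 h2 h3, quad_mul_quad h1' h2' h3', hl]
  exact ⟨AlgEquiv.ofLinearEquiv l (hl 0) hmul, hl 1, hl 2⟩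

end

/-- The golden ratio `x` satisfies `x ^ 2 - 3 = x - 2`, which is a unit. -/
theorem unit_of_sq_eq {x : K} (hx : x ^ 2 = x + 1) : -(1 + x) * (x ^ 2 - 3) = 1 := by
  linear_combination (-x - 2) * hx

namespace IsFrame

variable {a α γ a' α' γ' : SL(2, K)} {w x z d : K}

/-- The traces of γ against 1, a, α, aα are 0, w, z, 0, so γ has coordinates depending only on the
parameters. -/
theorem val_γ (h : IsFrame a α γ w x z) (hd : d * (x ^ 2 - 3) = 1) :
    γ.1 = d • (-w • (1 : Matrix (Fin 2) (Fin 2) K) + (2 * w + x * z) • a.1 +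
      (x * w + 2 * z) • α.1 - z • (a.1 * α.1)) := by
  obtain ⟨c, hc⟩ := eq_sum_quad hd h.tr_a h.tr_α h.tr_aα γ.1
  have e := coord_eq hd h.tr_a h.tr_α h.tr_aα c hc
  have t0 : trace γ.1 = 0 := h.tr_γ
  have t1 : trace (a.1 * γ.1) = w := h.tr_aγ
  have t2 : trace (α.1 * γ.1) = z := h.tr_αγ
  have t3 : trace (a.1 * α.1 * γ.1) = 0 := h.tr_aαγ
  rw [t0, t1, t2, t3] at e
  rw [← hc, e]
  simp only [Fin.sum_univ_four, quad, cons_val_zero, cons_val_one, cons_val]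
  module

theorem exists_algEquiv (h : IsFrame a α γ w x z) (h' : IsFrame a' α' γ' w x z)
    (hd : d * (x ^ 2 - 3) = 1) : ∃ f : Matrix (Fin 2) (Fin 2) K ≃ₐ[K] Matrix (Fin 2) (Fin 2) K,
      f a.1 = a'.1 ∧ f α.1 = α'.1 ∧ f γ.1 = γ'.1 := by
  obtain ⟨f, fa, fα⟩ :=
    exists_algEquiv_of_tr hd h.tr_a h.tr_α h.tr_aα h'.tr_a h'.tr_α h'.tr_aα
  refine ⟨f, fa, fα, ?_⟩
  rw [h.val_γ hd, h'.val_γ hd]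
  simp only [map_add, map_sub, map_smul, map_mul, map_one, fa, fα]

end IsFrame

/-- The automorphism of `SL(2, K)` induced by an automorphism of the matrix algebra. -/
def slCongr (f : Matrix (Fin 2) (Fin 2) K ≃ₐ[K] Matrix (Fin 2) (Fin 2) K) :
    SL(2, K) ≃* SL(2, K) where
  toFun A := ⟨f A.1, by rw [det_map', A.2]⟩
  invFun A := ⟨f.symm A.1, by rw [det_map', A.2]⟩
  left_inv A := Subtype.ext (f.symm_apply_apply _)
  right_inv A := Subtype.ext (f.apply_symm_apply _)
  map_mul' A B := Subtype.ext (map_mul f A.1 B.1)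

/-- The automorphism of `PSL(2, K)` induced by an automorphism of the matrix algebra. -/
def pslCongr (f : Matrix (Fin 2) (Fin 2) K ≃ₐ[K] Matrix (Fin 2) (Fin 2) K) :
    PSL(2, K) ≃* PSL(2, K) :=
  QuotientGroup.congr _ _ (slCongr f)
    (Subgroup.characteristic_iff_map_eq.1 Subgroup.centerCharacteristic _)

theorem pslCongr_proj (f : Matrix (Fin 2) (Fin 2) K ≃ₐ[K] Matrix (Fin 2) (Fin 2) K)
    (A : SL(2, K)) : pslCongr f (proj A) = proj (slCongr f A) := rfl

theorem tr_slCongr (f : Matrix (Fin 2) (Fin 2) K ≃ₐ[K] Matrix (Fin 2) (Fin 2) K)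
    (A : SL(2, K)) : tr (slCongr f A) = tr A := trace_map' f A.1

theorem HasParam.pslCongr {σ₁ σ₂ σ₃ : PSL(2, K)} {w x z : K} (h : HasParam σ₁ σ₂ σ₃ w x z)
    (f : Matrix (Fin 2) (Fin 2) K ≃ₐ[K] Matrix (Fin 2) (Fin 2) K) :
    HasParam (pslCongr f σ₁) (pslCongr f σ₂) (pslCongr f σ₃) w x z := by
  obtain ⟨a, α, γ, hf, rfl, h2, h3⟩ := h
  refine ⟨slCongr f a, slCongr f α, slCongr f γ, ⟨?_, ?_, ?_, ?_, ?_, ?_, ?_⟩, rfl, ?_, ?_⟩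
  · rw [tr_slCongr, hf.tr_a]
  · rw [tr_slCongr, hf.tr_α]
  · rw [tr_slCongr, hf.tr_γ]
  · rw [← map_mul, tr_slCongr, hf.tr_aα]
  · rw [← map_mul, tr_slCongr, hf.tr_aγ]
  · rw [← map_mul, tr_slCongr, hf.tr_αγ]
  · rw [← map_mul, ← map_mul, tr_slCongr, hf.tr_αaγ]
  · rw [← map_mul, ← h2, pslCongr_proj]
  · rw [← map_mul, ← h3, pslCongr_proj]

/-- Triples with the same parameters are equivalent under automorphisms. -/
theorem HasParam.exists_mulEquiv {σ₁ σ₂ σ₃ τ₁ τ₂ τ₃ : PSL(2, K)} {w x z : K}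
    (hx : x ^ 2 = x + 1) (h : HasParam σ₁ σ₂ σ₃ w x z) (h' : HasParam τ₁ τ₂ τ₃ w x z) :
    ∃ φ : PSL(2, K) ≃* PSL(2, K), φ σ₁ = τ₁ ∧ φ σ₂ = τ₂ ∧ φ σ₃ = τ₃ := by
  obtain ⟨a, α, γ, hf, rfl, h2, h3⟩ := h
  obtain ⟨a', α', γ', hf', rfl, h2', h3'⟩ := h'
  obtain ⟨f, fa, fα, fγ⟩ := hf.exists_algEquiv hf' (unit_of_sq_eq hx)
  have ea : PSLTwo.pslCongr f (proj a) = proj a' := congrArg proj (Subtype.ext fa)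
  have eα : PSLTwo.pslCongr f (proj α) = proj α' := congrArg proj (Subtype.ext fα)
  have eγ : PSLTwo.pslCongr f (proj γ) = proj γ' := congrArg proj (Subtype.ext fγ)
  refine ⟨PSLTwo.pslCongr f, ?_, ea, ?_⟩
  · rw [h2, h2', map_mul, ea] at eα
    exact mul_right_cancel eα
  · rw [h3, h3', map_mul, ea] at eγ
    exact mul_left_cancel eγ

/-- The parameters of a triple are unique. -/
theorem HasParam.unique {σ₁ σ₂ σ₃ : PSL(2, K)} {w x z x' z' : K} (h2 : (2 : K) ≠ 0)
    (hw : w ^ 2 = 2) (hx : x ^ 2 = x + 1) (hx' : x' ^ 2 = x' + 1)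
    (h : HasParam σ₁ σ₂ σ₃ w x z) (h' : HasParam σ₁ σ₂ σ₃ w x' z') : x = x' ∧ z = z' := by
  obtain ⟨a, α, γ, hf, rfl, hα, hγ⟩ := h
  obtain ⟨a', α', γ', hf', ha', hα', hγ'⟩ := h'
  have hw0 : w ≠ 0 := fun e => h2 (by rw [← hw, e]; ring)
  have n1 : (1 : K) ≠ -1 := fun e => h2 (by linear_combination e)
  have nw : w ≠ -w := fun e => (mul_ne_zero h2 hw0) (by linear_combination e)
  -- The normalizations tr a = 1, tr(aγ) = w and x² = x + 1 fix the signs of the lifts a, γ and α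
  -- respectively.
  have ea : a' = a := by
    refine (proj_eq_proj_iff.1 ha').resolve_right fun e => n1 ?_
    rw [← hf.tr_a, ← tr_neg, ← e, hf'.tr_a, hf.tr_a]
  subst ea
  have eγ : γ' = γ := by
    refine (proj_eq_proj_iff.1 (hγ'.trans hγ.symm)).resolve_right fun e => nw ?_
    conv_lhs => rw [← hf'.tr_aγ, e, mul_neg, tr_neg, hf.tr_aγ]
  subst eγ
  have eα : α' = α := by
    refine (proj_eq_proj_iff.1 (hα'.trans hα.symm)).resolve_right fun e => ?_
    have : x' = -x := by rw [← hf'.tr_aα, e, mul_neg, tr_neg, hf.tr_aα]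
    rw [this] at hx'
    have h0 : x = 0 := by
      refine (mul_eq_zero.1 (?_ : 2 * x = 0)).resolve_left h2
      linear_combination hx' - hx
    rw [h0] at hx
    exact one_ne_zero (α := K) (by linear_combination -hx)
  subst eα
  exact ⟨hf.tr_aα.symm.trans hf'.tr_aα, hf.tr_αγ.symm.trans hf'.tr_αγ⟩

end PSLTwo

/-! ### Unipotent elements, generation of SL(2, p) and automorphisms of PSL(2, p) -/

namespace PSLTwo

open scoped MatrixGroups
open Matrix

section

variable {K : Type*} [Field K]

/-- The upper unitriangular matrices. -/
def upper (c : K) : SL(2, K) := Matrix.SpecialLinearGroup.transvection (zero_ne_one (α := Fin 2)) c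

/-- The lower unitriangular matrices. -/
def lower (c : K) : SL(2, K) := Matrix.SpecialLinearGroup.transvection (one_ne_zero (α := Fin 2)) c

theorem val_upper (c : K) : (upper c).1 = !![1, c; 0, 1] := by
  rw [upper, Matrix.SpecialLinearGroup.transvection_coe]
  ext i j
  fin_cases i <;> fin_cases j <;> simp [single]

theorem val_lower (c : K) : (lower c).1 = !![1, 0; c, 1] := by
  rw [lower, Matrix.SpecialLinearGroup.transvection_coe]
  ext i j
  fin_cases i <;> fin_cases j <;> simp [single]

theorem tr_upper (c : K) : tr (upper c) = 2 := by
  rw [tr, val_upper, trace_fin_two_of]; norm_num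

theorem tr_lower (c : K) : tr (lower c) = 2 := by
  rw [tr, val_lower, trace_fin_two_of]; norm_num

theorem tr_upper_mul_lower (c d : K) : tr (upper c * lower d) = c * d + 2 := by
  rw [tr, val_mul, val_upper, val_lower]
  simp [trace_fin_two]
  ring

theorem upper_pow (c : K) (n : ℕ) : upper c ^ n = upper (n * c) := by
  induction n with
  | zero => simp [upper, Matrix.SpecialLinearGroup.transvection_coeff_zero]
  | succ n ih =>
    rw [pow_succ, ih, upper, upper, upper, ← Matrix.SpecialLinearGroup.transvection_add]
    push_cast
    ring_nf

theorem lower_pow (c : K) (n : ℕ) : lower c ^ n = lower (n * c) := by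
  induction n with
  | zero => simp [lower, Matrix.SpecialLinearGroup.transvection_coeff_zero]
  | succ n ih =>
    rw [pow_succ, ih, lower, lower, lower, ← Matrix.SpecialLinearGroup.transvection_add]
    push_cast
    ring_nf

/-- Pairs of unipotent matrices whose product has trace `3` are equivalent. -/
theorem exists_slCongr_upper_lower {X Y : SL(2, K)} (hX : tr X = 2) (hY : tr Y = 2)
    (hXY : tr (X * Y) = 3) : ∃ f, slCongr f (upper (1 : K)) = X ∧ slCongr f (lower 1) = Y := by
  -- The elements XY⁻¹ and XY⁻¹X have the traces required of a and α, with x = −2. Then x² − 3 = 1,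
  -- so the uniqueness of such pairs applies with `d = 1`.
  have key {X Y : SL(2, K)} (hX : tr X = 2) (hY : tr Y = 2) (hXY : tr (X * Y) = 3) :
      tr (X * Y⁻¹) = 1 ∧ tr (X * Y⁻¹ * X) = 0 ∧ tr (X * Y⁻¹ * (X * Y⁻¹ * X)) = -2 := by
    have h1 : tr (X * Y⁻¹) = 1 := by
      rw [tr_mul_comm, tr_inv_mul, hX, hY, tr_mul_comm, hXY]; norm_num
    have h2 : tr (X * Y⁻¹ * X) = 0 := by
      have := tr_mul_add (X * Y⁻¹) X
      rw [h1, hX, show (X * Y⁻¹)⁻¹ * X = Y by group, hY] at this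
      linear_combination this
    refine ⟨h1, h2, ?_⟩
    have := tr_mul_add (X * Y⁻¹) (X * Y⁻¹ * X)
    rw [h2, inv_mul_cancel_left, hX] at this
    linear_combination this
  obtain ⟨h1, h2, h3⟩ := key hX hY hXY
  obtain ⟨k1, k2, k3⟩ := key (tr_upper 1) (tr_lower 1)
    (by rw [tr_upper_mul_lower]; norm_num : tr (upper (1 : K) * lower 1) = 3)
  obtain ⟨f, f1, f2⟩ := exists_algEquiv_of_tr (d := (1 : K)) (by norm_num) k1 k2 k3 h1 h2 h3
  have e1 : slCongr f (upper 1 * (lower 1)⁻¹) = X * Y⁻¹ := Subtype.ext f1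
  have e2 : slCongr f (upper 1 * (lower 1)⁻¹ * upper 1) = X * Y⁻¹ * X := Subtype.ext f2
  have e3 : slCongr f (upper 1) = X := by
    rw [map_mul, e1] at e2
    exact mul_left_cancel e2
  refine ⟨f, e3, ?_⟩
  rw [map_mul, e3, map_inv] at e1
  exact inv_injective (mul_left_cancel e1)

theorem val_pow_of_tr_eq_two {Y : SL(2, K)} (hY : tr Y = 2) (m : ℕ) :
    (Y ^ m).1 = (m : K) • Y.1 - ((m : K) - 1) • 1 := by
  induction m with
  | zero => simp
  | succ m ih =>
    rw [pow_succ, val_mul, ih, sub_mul, smul_mul_assoc, val_mul_self, hY, smul_mul_assoc, one_mul]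
    push_cast
    module

end

variable {p : ℕ} [Fact p.Prime]

/-- Transvections generate SL(2, p), and over a prime field each of them is a power of one with
entry 1. -/
theorem closure_upper_lower :
    Subgroup.closure {upper (1 : ZMod p), lower 1} = ⊤ := by
  rw [eq_top_iff]
  rintro A -
  refine SL2.transvection_induction _ (fun i j h c => ?_) (fun _ _ => mul_mem) A
  have hu : upper c ∈ Subgroup.closure {upper (1 : ZMod p), lower 1} := by
    have : upper c = upper (1 : ZMod p) ^ c.val := by
      rw [upper_pow, mul_one, ZMod.natCast_zmod_val]
    rw [this]
    exact pow_mem (Subgroup.subset_closure (by simp)) _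
  have hl : lower c ∈ Subgroup.closure {upper (1 : ZMod p), lower 1} := by
    have : lower c = lower (1 : ZMod p) ^ c.val := by
      rw [lower_pow, mul_one, ZMod.natCast_zmod_val]
    rw [this]
    exact pow_mem (Subgroup.subset_closure (by simp)) _
  fin_cases i <;> fin_cases j
  · exact absurd rfl h
  · exact hu
  · exact hl
  · exact absurd rfl h

/-- Two unipotent elements without a common fixed line generate `SL(2, p)`. -/
theorem eq_top_of_tr_eq_two {H : Subgroup SL(2, ZMod p)} {X Y : SL(2, ZMod p)} (hX : X ∈ H)
    (hY : Y ∈ H) (tX : tr X = 2) (tY : tr Y = 2) (h : tr (X * Y) ≠ 2) : H = ⊤ := by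
  -- The trace of XYᵐ is 2 + m(tr(XY) − 2); this m makes it 3.
  set m := ((tr (X * Y) - 2)⁻¹).val with hm
  have hmc : (m : ZMod p) * (tr (X * Y) - 2) = 1 := by
    rw [hm, ZMod.natCast_zmod_val, inv_mul_cancel₀ (sub_ne_zero.2 h)]
  have tYm : tr (Y ^ m) = 2 := by
    rw [tr, val_pow_of_tr_eq_two tY, trace_sub, trace_smul, trace_smul, trace_one, ← tr, tY]
    simp
    ring
  have tXY : tr (X * Y ^ m) = 3 := by
    have : tr (X * Y ^ m) = m * tr (X * Y) - (m - 1) * tr X := by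
      simp only [tr, val_mul]
      rw [val_pow_of_tr_eq_two tY, mul_sub, mul_smul_comm, mul_smul_comm, mul_one, trace_sub,
        trace_smul, trace_smul, smul_eq_mul, smul_eq_mul]
    rw [this, tX]
    linear_combination hmc
  obtain ⟨f, f1, f2⟩ := exists_slCongr_upper_lower tX tYm tXY
  have := congrArg (Subgroup.map (slCongr f).toMonoidHom) (closure_upper_lower (p := p))
  rw [MonoidHom.map_closure, Subgroup.map_top_of_surjective _ (slCongr f).surjective] at this
  rw [eq_top_iff, ← this, Subgroup.closure_le]
  rintro _ ⟨_, rfl | rfl, rfl⟩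
  · exact (by exact f1 : (slCongr f).toMonoidHom (upper 1) = X) ▸ hX
  · exact (by exact f2 : (slCongr f).toMonoidHom (lower 1) = Y ^ m) ▸ pow_mem hY m

/-- In characteristic p the hypothesis reads (X − 1)ᵖ = 0, and nilpotent matrices have trace 0. -/
theorem tr_eq_two_of_pow_eq_one {X : SL(2, ZMod p)} (h : X ^ p = 1) : tr X = 2 := by
  have hc : Commute X.1 1 := Commute.one_right _
  have : IsNilpotent (X.1 - 1) := ⟨p, by
    rw [sub_pow_char_of_commute _ hc, one_pow, ← val_pow, h, val_one, sub_self]⟩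
  have := (Matrix.isNilpotent_trace_of_isNilpotent this).eq_zero
  rw [trace_sub, trace_one] at this
  have h2 := sub_eq_zero.1 this
  simpa [tr] using h2

theorem exists_tr_eq_two_of_proj_pow_eq_one (h2 : (2 : ZMod p) ≠ 0) {σ : PSL(2, ZMod p)}
    (h : σ ^ p = 1) : ∃ X, proj X = σ ∧ tr X = 2 := by
  obtain ⟨X, rfl⟩ := exists_proj σ
  have hp : Odd p := (Fact.out : p.Prime).odd_of_ne_two (by
    rintro rfl
    exact h2 (by reduce_mod_char))
  rw [← map_pow, proj_eq_one_iff] at h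
  rcases h with h | h
  · exact ⟨X, rfl, tr_eq_two_of_pow_eq_one h⟩
  · exact ⟨-X, proj_neg X, tr_eq_two_of_pow_eq_one (by rw [hp.neg_pow, h, neg_neg])⟩

/-- The automorphisms of `PSL(2, p)` are induced by automorphisms of the matrix algebra. -/
theorem exists_eq_pslCongr (h2 : (2 : ZMod p) ≠ 0) (φ : PSL(2, ZMod p) →* PSL(2, ZMod p))
    (hφ : Function.Injective φ) :
    ∃ f, φ = (pslCongr f).toMonoidHom := by
  obtain ⟨X, hX, tX⟩ := exists_tr_eq_two_of_proj_pow_eq_one h2 (σ := φ (proj (upper 1))) (by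
    rw [← map_pow, ← map_pow, upper_pow]
    simp [upper, Matrix.SpecialLinearGroup.transvection_coeff_zero])
  obtain ⟨Y, hY, tY⟩ := exists_tr_eq_two_of_proj_pow_eq_one h2 (σ := φ (proj (lower 1))) (by
    rw [← map_pow, ← map_pow, lower_pow]
    simp [lower, Matrix.SpecialLinearGroup.transvection_coeff_zero])
  -- The images of the two unipotents are unipotent, and only the trace of their product is unknown.
  -- The Weyl element has projective order 2, which the injective φ preserves; for the image, trace
  -- 0 amounts to tr(XY) = 3.
  have tW : tr (upper (1 : ZMod p) * (lower 1)⁻¹ * upper 1) = 0 := by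
    rw [tr_mul_inv_mul, tr_lower, tr_mul_comm (upper 1 * lower 1), ← mul_assoc, ← pow_two, upper_pow, tr_upper,
      tr_upper_mul_lower]
    norm_num
  have oW := orderOf_proj_eq_two h2 tW
  rw [← orderOf_injective φ hφ, map_mul, map_mul, map_mul, map_mul, map_inv, map_inv, ← hX, ← hY,
    ← map_inv, ← map_mul, ← map_mul] at oW
  have t0 : tr (X * Y⁻¹ * X) = 0 := by
    refine (proj_pow_two_eq_one_iff fun e => ?_).1 (orderOf_dvd_iff_pow_eq_one.1 oW.dvd)
    rw [e, orderOf_one] at oW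
    omega
  have tXY : tr (X * Y) = 3 := by
    have e1 : tr (X * Y⁻¹) = 4 - tr (X * Y) := by
      rw [tr_mul_comm, tr_inv_mul, tX, tY, tr_mul_comm]; norm_num
    have := tr_mul_add (X * Y⁻¹) X
    rw [t0, e1, show (X * Y⁻¹)⁻¹ * X = Y by group, tX, tY] at this
    refine mul_left_cancel₀ h2 ?_
    linear_combination this
  obtain ⟨f, f1, f2⟩ := exists_slCongr_upper_lower tX tY tXY
  refine ⟨f, ?_⟩
  have : φ.comp proj = (pslCongr f).toMonoidHom.comp proj := by
    refine MonoidHom.eq_of_eqOn_dense closure_upper_lower ?_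
    rintro _ (rfl | rfl)
    · exact hX.symm.trans (by rw [← f1]; rfl)
    · exact hY.symm.trans (by rw [← f2]; rfl)
  refine MonoidHom.ext fun σ => ?_
  obtain ⟨A, rfl⟩ := exists_proj σ
  exact DFunLike.congr_fun this A

theorem HasParam.map {σ₁ σ₂ σ₃ : PSL(2, ZMod p)} {w x z : ZMod p} (h : HasParam σ₁ σ₂ σ₃ w x z)
    (h2 : (2 : ZMod p) ≠ 0) (φ : PSL(2, ZMod p) →* PSL(2, ZMod p)) (hφ : Function.Injective φ) :
    HasParam (φ σ₁) (φ σ₂) (φ σ₃) w x z := by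
  obtain ⟨f, rfl⟩ := exists_eq_pslCongr h2 φ hφ
  exact h.pslCongr f

end PSLTwo

/-! ### Existence of frames and the mirror image -/

namespace PSLTwo

open scoped MatrixGroups
open Matrix

section

variable {K : Type*} [Field K]

theorem tr_mul_mul_self (A B : SL(2, K)) : tr (A * A * B) = tr A * tr (A * B) - tr B := by
  have := tr_mul_add A (A * B)
  rw [inv_mul_cancel_left, ← mul_assoc] at this
  linear_combination this

theorem tr_mul_mul_mul (A B C : SL(2, K)) :
    tr (A * B * A * C) = tr (A * B) * tr (A * C) - tr (B⁻¹ * C) := by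
  have := tr_mul_add (A * B) (A * C)
  rw [← mul_assoc, show (A * B)⁻¹ * (A * C) = B⁻¹ * C by group] at this
  linear_combination this

theorem inv_eq_neg_of_tr_eq_zero {A : SL(2, K)} (h : tr A = 0) : A⁻¹ = -A :=
  Subtype.ext (by rw [val_inv, h, zero_smul, zero_sub, val_neg])

theorem mul_self_of_tr_eq_zero {A : SL(2, K)} (h : tr A = 0) : A * A = -1 :=
  Subtype.ext (by rw [val_mul, val_mul_self, h, zero_smul, zero_sub, val_neg, val_one])

theorem trace_quad_mul_sum_quad {a α : SL(2, K)} {x : K} (h1 : tr a = 1) (h2 : tr α = 0)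
    (h3 : tr (a * α) = x) (c : Fin 4 → K) (j : Fin 4) :
    trace (quad a α j * ∑ i, c i • quad a α i) =
      ∑ i, c i * (2 * structureConstant x j i 0 + structureConstant x j i 1 +
        x * structureConstant x j i 3) := by
  rw [Finset.mul_sum, trace_sum]
  refine Finset.sum_congr rfl fun i _ => ?_
  rw [mul_smul_comm, trace_smul, quad_mul_quad h1 h2 h3, trace_quad_mul_sum h1 h2 h3, smul_eq_mul]

theorem det_sum_quad {a α : SL(2, K)} {x : K} (h1 : tr a = 1) (h2 : tr α = 0)
    (h3 : tr (a * α) = x) (c : Fin 4 → K) :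
    det (∑ i, c i • quad a α i) = c 0 ^ 2 + c 1 ^ 2 + c 2 ^ 2 + c 3 ^ 2 + c 0 * c 1 +
      x * (c 0 * c 3) - x * (c 1 * c 2) + c 2 * c 3 := by
  have ha := a.2
  have hα := α.2
  simp only [Fin.sum_univ_four, quad, cons_val_zero, cons_val_one, cons_val]
  simp only [tr, val_mul, det_fin_two, trace_fin_two, mul_apply, Fin.sum_univ_two, Matrix.add_apply,
    Matrix.smul_apply, smul_eq_mul, one_apply_eq, one_apply_ne zero_ne_one, one_apply_ne one_ne_zero]
    at h1 h2 h3 ha hα ⊢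
  generalize a.1 0 0 = a1, a.1 0 1 = a2, a.1 1 0 = a3, a.1 1 1 = a4 at *
  generalize α.1 0 0 = b1, α.1 0 1 = b2, α.1 1 0 = b3, α.1 1 1 = b4 at *
  obtain rfl : a4 = 1 - a1 := by linear_combination h1
  obtain rfl : b4 = -b1 := by linear_combination h2
  subst h3
  linear_combination (c 1 ^ 2 + c 3 ^ 2 * (b1 * -b1 - b2 * b3)) * ha +
    (c 2 ^ 2 + c 3 ^ 2 + c 2 * c 3) * hα

namespace IsFrame

variable {a α γ : SL(2, K)} {w x z : K}

theorem isRotaryTriple (h : IsFrame a α γ w x z) (hx : x ^ 2 = x + 1) (hw : w ^ 2 = 2)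
    (h2 : (2 : K) ≠ 0) (h3 : (3 : K) ≠ 0) (h5 : (5 : K) ≠ 0) :
    IsRotaryTriple (proj (α * a⁻¹)) (proj a) (proj (a⁻¹ * γ)) where
  orderOf_fst := by
    refine orderOf_proj_eq_five h5 (Or.inr ?_)
    rw [tr_mul_comm, tr_inv_mul, h.tr_a, h.tr_α, h.tr_aα]
    linear_combination hx
  orderOf_snd := orderOf_proj_eq_three h3 (by rw [h.tr_a, one_pow])
  orderOf_thd := by
    refine orderOf_proj_eq_four h2 ?_
    rw [tr_inv_mul, h.tr_a, h.tr_γ, h.tr_aγ]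
    linear_combination hw
  sq_fst_snd := by
    rw [← map_mul, inv_mul_cancel_right]
    exact orderOf_dvd_iff_pow_eq_one.1 (orderOf_proj_eq_two h2 h.tr_α).dvd
  sq_snd_thd := by
    rw [← map_mul, mul_inv_cancel_left]
    exact orderOf_dvd_iff_pow_eq_one.1 (orderOf_proj_eq_two h2 h.tr_γ).dvd
  sq_fst_snd_thd := by
    rw [← map_mul, inv_mul_cancel_right, ← map_mul, ← mul_assoc]
    refine orderOf_dvd_iff_pow_eq_one.1 (orderOf_proj_eq_two h2 ?_).dvd
    rw [tr_mul_inv_mul, h.tr_a, h.tr_αγ, h.tr_αaγ, one_mul, sub_self]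

/-- The frame of the mirrored triple. -/
theorem mirror (h : IsFrame a α γ w x z) :
    IsFrame (-(α * a⁻¹ * α)) (-α) (-(α * a⁻¹ * (α * a⁻¹) * γ)) w x (-x * w - z) := by
  -- The three matrices lift σ₁²σ₂, σ₁σ₂ and σ₁²σ₂σ₃, with signs restoring the normalization. The
  -- new third parameter −xw − z is the other root of the quadratic satisfied by z.
  have hb : tr (a⁻¹) = 1 := by rw [tr_inv, h.tr_a]
  have hbα : tr (a⁻¹ * α) = -x := by rw [tr_inv_mul, h.tr_a, h.tr_α, h.tr_aα]; ring
  have hbγ : tr (a⁻¹ * γ) = -w := by rw [tr_inv_mul, h.tr_a, h.tr_γ, h.tr_aγ]; ring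
  have hαbγ : tr (α * a⁻¹ * γ) = 0 := by
    rw [tr_mul_inv_mul, h.tr_a, h.tr_αγ, h.tr_αaγ, one_mul, sub_self]
  have hsq := mul_self_of_tr_eq_zero h.tr_α
  have hinv := inv_eq_neg_of_tr_eq_zero h.tr_α
  have hα := h.tr_α
  have hγ := h.tr_γ
  have hαγ := h.tr_αγ
  generalize a⁻¹ = b at *
  have hssγ : tr (α * b * (α * b) * γ) = 0 := by
    rw [tr_mul_mul_self, hαbγ, hγ]; ring
  have hbαbγ : tr (b * α * b * γ) = x * w + z := by
    rw [tr_mul_mul_mul, hbα, hbγ, hinv, neg_mul α, tr_neg, hαγ]; ring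
  refine ⟨?_, ?_, ?_, ?_, ?_, ?_, ?_⟩
  · rw [tr_neg, tr_mul_comm, ← mul_assoc, hsq, neg_one_mul, tr_neg, hb, neg_neg]
  · rw [tr_neg, hα, neg_zero]
  · rw [tr_neg, hssγ, neg_zero]
  · rw [neg_mul_neg, mul_assoc, hsq, mul_neg_one, tr_neg, tr_mul_comm, hbα, neg_neg]
  · have e : -(α * b * α) * -(α * b * (α * b) * γ) = -(α * (b * b * α * b * γ)) := by
      rw [neg_mul_neg, show α * b * α * (α * b * (α * b) * γ) =
        α * b * (α * α) * (b * α * b * γ) by group, hsq, mul_neg_one, neg_mul]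
      group
    rw [e, tr_neg, tr_mul_comm, show b * b * α * b * γ * α = b * b * (α * b * γ * α) by group,
      tr_mul_mul_self, hb, tr_mul_comm (α * b * γ) α, tr_mul_comm b,
      show α * b * γ * α * b = α * (b * γ * (α * b)) by group, tr_mul_comm α]
    rw [show b * γ * (α * b) * α = b * γ * (α * b * α) by group, tr_mul_comm (b * γ),
      show α * b * α * (b * γ) = α * b * (α * b) * γ by group, hssγ,
      show α * (α * b * γ) = α * α * (b * γ) by group, hsq, neg_one_mul, tr_neg, hbγ]
    ring
  · rw [neg_mul_neg, show α * (α * b * (α * b) * γ) = α * α * (b * α * b * γ) by group, hsq,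
      neg_one_mul, tr_neg, hbαbγ]
    ring
  · rw [neg_mul_neg, show α * (α * b * α) = α * α * (b * α) by group, hsq, neg_one_mul,
      neg_mul_neg, show b * α * (α * b * (α * b) * γ) = b * (α * α) * (b * α * b * γ) by group, hsq,
      mul_neg_one, neg_mul, tr_neg, show b * (b * α * b * γ) = b * b * (α * b * γ) by group,
      tr_mul_mul_self, hb, show b * (α * b * γ) = b * α * b * γ by group, hbαbγ, hαbγ]
    ring

end IsFrame

end

variable {p : ℕ} [Fact p.Prime]

/-- With a and α found, γ is forced by the coordinates of `IsFrame.val_γ`; its determinant is 1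
precisely because of the quadratic relation and w² = 2. -/
theorem exists_isFrame (h2 : (2 : ZMod p) ≠ 0) {w x z : ZMod p} (hx : x ^ 2 = x + 1)
    (hw : w ^ 2 = 2) (h : z ^ 2 + x * w * z + x ^ 2 - 1 = 0) :
    ∃ a α γ : SL(2, ZMod p), IsFrame a α γ w x z := by
  -- With α the standard rotation by a right angle, the traces of a and aα leave the two unknowns s,
  -- t, and det a = 1 becomes s² + t² = x² − 3, solvable over a finite field.
  obtain ⟨s, t, hst⟩ := ZMod.sq_add_sq p (x ^ 2 - 3)
  let α : SL(2, ZMod p) := ⟨!![0, -1; 1, 0], by simp [det_fin_two]⟩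
  let a : SL(2, ZMod p) := ⟨!![(s + 1) / 2, (t + x) / 2; (t - x) / 2, (1 - s) / 2], by
    rw [det_fin_two_of]
    field_simp
    linear_combination -hst⟩
  have h1 : tr a = 1 := by
    rw [tr, trace_fin_two_of]; field_simp; ring
  have h0 : tr α = 0 := by
    rw [tr, trace_fin_two_of]; ring
  have h3 : tr (a * α) = x := by
    rw [tr, val_mul]
    simp only [a, α, trace_fin_two, mul_apply, Fin.sum_univ_two, of_apply, cons_val', cons_val_zero,
      cons_val_one, cons_val_fin_one]
    field_simp
    ring
  have hd := unit_of_sq_eq hx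
  set d := -(1 + x) with hdd
  let c : Fin 4 → ZMod p := ![d * -w, d * (2 * w + x * z), d * (x * w + 2 * z), d * -z]
  let γ : SL(2, ZMod p) := ⟨∑ i, c i • quad a α i, by
    rw [det_sum_quad h1 h0 h3]
    simp only [c, cons_val_zero, cons_val_one, cons_val]
    linear_combination d ^ 2 * (3 - x ^ 2) * (h + hw) + (d * (x ^ 2 - 3) + 1) * hd⟩
  have key (j : Fin 4) := trace_quad_mul_sum_quad h1 h0 h3 c j
  have k0 : tr γ = 0 := by
    rw [← one_mul γ]
    refine (key 0).trans ?_
    simp [c, structureConstant, Fin.sum_univ_four]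
    ring
  have k1 : tr (a * γ) = w := by
    refine (key 1).trans ?_
    simp [c, structureConstant, Fin.sum_univ_four]
    linear_combination w * hd
  have k2 : tr (α * γ) = z := by
    refine (key 2).trans ?_
    simp [c, structureConstant, Fin.sum_univ_four]
    linear_combination z * hd
  have k3 : tr (a * α * γ) = 0 := by
    refine (key 3).trans ?_
    simp [c, structureConstant, Fin.sum_univ_four]
    ring
  refine ⟨a, α, γ, h1, h0, k0, h3, k1, k2, ?_⟩
  have := tr_mul_mul_add_tr_mul_mul a α γ
  rw [k3, h1, h0, k0, k2, k1, h3, mul_assoc a γ α, tr_mul_comm a, mul_assoc γ α a, tr_mul_comm γ]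
    at this
  linear_combination this

/-- The parameters of a rotary triple distinguish it from its mirror image. -/
theorem HasParam.not_exists_mirror {σ₁ σ₂ σ₃ : PSL(2, ZMod p)} (h2 : (2 : ZMod p) ≠ 0)
    {w x z : ZMod p} (hx : x ^ 2 = x + 1) (hw : w ^ 2 = 2)
    (hz : z ^ 2 + x * w * z + x ^ 2 - 1 = 0) (h : HasParam σ₁ σ₂ σ₃ w x z) :
    ¬ ∃ ψ : PSL(2, ZMod p) →* PSL(2, ZMod p), Function.Injective ψ ∧ ψ σ₁ = σ₁⁻¹ ∧
      ψ σ₂ = σ₁ ^ 2 * σ₂ ∧ ψ σ₃ = σ₃ := by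
  rintro ⟨ψ, hψ, e1, e2, e3⟩
  have h' := h.map h2 ψ hψ
  rw [e1, e2, e3] at h'
  obtain ⟨a, α, γ, hf, rfl, hα, hγ⟩ := h
  have hs : σ₁ = proj (α * a⁻¹) := by rw [map_mul, map_inv, hα, mul_inv_cancel_right]
  have h'' : HasParam σ₁⁻¹ (σ₁ ^ 2 * proj a) σ₃ w x (-x * w - z) := by
    refine ⟨_, _, _, hf.mirror, ?_, ?_, ?_⟩
    · rw [proj_neg, map_mul, ← hs, hα, pow_two, mul_assoc]
    · rw [proj_neg, hα]; group
    · rw [proj_neg, map_mul, map_mul, ← hs, hγ, pow_two, mul_assoc, mul_assoc, mul_assoc]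
  have hz' := (h'.unique h2 hw hx hx h'').2
  -- A mirror-invariant z would be a double root, but the discriminant of its quadratic is 2 − 2x,
  -- and x = 1 is not a root of x² = x + 1.
  have h1 : 2 * (x - 1) = 0 := by
    linear_combination 4 * hz + (-(2 * z - x * w) - 2 * x * w) * (hz' ) + x ^ 2 * hw - 2 * hx
  have h1 := sub_eq_zero.1 ((mul_eq_zero.1 h1).resolve_left h2)
  rw [h1] at hx
  exact one_ne_zero (α := ZMod p) (by linear_combination -hx)

end PSLTwo

/-! ### The binary icosahedral group over ℤ[x] -/

/-- Left multiplication by `a`, in coordinates with respect to `1`, `a`, `α`, `aα` over `ℤ[x]`,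
where `a ^ 2 = a - 1`, `α ^ 2 = -1`, `α * a = x + α - a * α` and `x ^ 2 = x + 1`; the pair `(m, n)`
stands for `m + n * x`. -/
def Icosian.leftA (c : (ℤ × ℤ) × (ℤ × ℤ) × (ℤ × ℤ) × (ℤ × ℤ)) :
    (ℤ × ℤ) × (ℤ × ℤ) × (ℤ × ℤ) × (ℤ × ℤ) :=
  (-c.2.1, c.1 + c.2.1, -c.2.2.2, c.2.2.1 + c.2.2.2)

/-- Multiplication by `x` in `ℤ[x]`. -/
def Icosian.mulX (c : ℤ × ℤ) : ℤ × ℤ := (c.2, c.1 + c.2)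

/-- Left multiplication by `α`. -/
def Icosian.leftB (c : (ℤ × ℤ) × (ℤ × ℤ) × (ℤ × ℤ) × (ℤ × ℤ)) :
    (ℤ × ℤ) × (ℤ × ℤ) × (ℤ × ℤ) × (ℤ × ℤ) :=
  (mulX c.2.1 - (c.2.2.1 + c.2.2.2), c.2.2.2, c.1 + c.2.1 + mulX c.2.2.2, -c.2.1)

/-- The reduced trace. -/
def Icosian.trace (c : (ℤ × ℤ) × (ℤ × ℤ) × (ℤ × ℤ) × (ℤ × ℤ)) : ℤ × ℤ :=
  c.1 + c.1 + c.2.1 + mulX c.2.2.2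

/-- Representatives of the cosets of `⟨a⟩` in the binary icosahedral group. -/
def Icosian.cosetReps : List ((ℤ × ℤ) × (ℤ × ℤ) × (ℤ × ℤ) × (ℤ × ℤ)) :=
   [((1, 0), (0, 0), (0, 0), (0, 0)),
    ((0, 0), (0, 0), (1, 0), (0, 0)),
    ((0, 1), (0, 0), (1, 0), (-1, 0)),
    ((0, 1), (0, 0), (0, 0), (-1, 0)),
    ((-1, 0), (1, 0), (0, 1), (0, 0)),
    ((0, 1), (0, 0), (0, 1), (0, -1)),
    ((0, 0), (1, 0), (0, 1), (0, 0)),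
    ((1, 1), (-1, 0), (0, 0), (0, -1)),
    ((0, 1), (1, 0), (0, 1), (0, -1)),
    ((0, -1), (0, 1), (0, 1), (0, 0)),
    ((0, 0), (0, 1), (1, 1), (-1, 0)),
    ((0, -1), (0, 1), (0, 1), (1, 0)),
    ((1, 1), (0, 0), (0, 1), (-1, -1)),
    ((1, 0), (0, 1), (1, 1), (0, -1)),
    ((1, 1), (0, -1), (-1, 0), (0, -1)),
    ((1, 1), (0, 0), (1, 0), (-1, -1)),
    ((0, -1), (1, 1), (1, 1), (0, 0)),
    ((0, 1), (1, 0), (1, 1), (-1, -1)),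
    ((0, 2), (0, -1), (0, 0), (-1, -1)),
    ((0, 0), (1, 1), (0, 2), (0, -1))]

/-- The elements of the binary icosahedral group. -/
def Icosian.elements : List ((ℤ × ℤ) × (ℤ × ℤ) × (ℤ × ℤ) × (ℤ × ℤ)) :=
  cosetReps.flatMap fun c =>
    [c, leftA c, leftA (leftA c), -c, -leftA c, -leftA (leftA c)]

/-- The list has 20 · 6 entries because a³ = −1. Being closed under left multiplication by a, α, a⁻¹
= 1 − a and α⁻¹ = −α, and containing 1, it covers the group generated by a and α in any field with a
root x; this finite check is done once over ℤ[x]. -/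
theorem Icosian.leftA_mem : ∀ c ∈ elements, leftA c ∈ elements := by
  decide +kernel

theorem Icosian.leftB_mem : ∀ c ∈ elements, leftB c ∈ elements := by
  decide +kernel

theorem Icosian.sub_leftA_mem : ∀ c ∈ elements, c - leftA c ∈ elements := by
  decide +kernel

theorem Icosian.neg_leftB_mem : ∀ c ∈ elements, -leftB c ∈ elements := by
  decide +kernel

theorem Icosian.trace_mem : ∀ c ∈ elements, trace c ∈
    ([(0, 0), (1, 0), (-1, 0), (0, 1), (0, -1), (-1, 1), (1, -1), (2, 0), (-2, 0)] :
      List (ℤ × ℤ)) := by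
  decide +kernel

namespace PSLTwo

open scoped MatrixGroups
open Matrix

section

variable {K : Type*} [Field K]

/-- The element of `ℤ[x]` with given coordinates. -/
def goldenEval (x : K) (c : ℤ × ℤ) : K := c.1 + c.2 * x

theorem goldenEval_add (x : K) (c d : ℤ × ℤ) :
    goldenEval x (c + d) = goldenEval x c + goldenEval x d := by
  simp [goldenEval]; ring

theorem goldenEval_neg (x : K) (c : ℤ × ℤ) : goldenEval x (-c) = -goldenEval x c := by
  simp [goldenEval]; ring

theorem goldenEval_sub (x : K) (c d : ℤ × ℤ) :
    goldenEval x (c - d) = goldenEval x c - goldenEval x d := by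
  simp [goldenEval]; ring

theorem goldenEval_mulX {x : K} (hx : x ^ 2 = x + 1) (c : ℤ × ℤ) :
    goldenEval x (Icosian.mulX c) = x * goldenEval x c := by
  simp [goldenEval, Icosian.mulX]; linear_combination -c.2 * hx

/-- The matrix with given coordinates with respect to `1`, `a`, `α`, `aα`. -/
def icosianEval (a α : SL(2, K)) (x : K) (c : (ℤ × ℤ) × (ℤ × ℤ) × (ℤ × ℤ) × (ℤ × ℤ)) :
    Matrix (Fin 2) (Fin 2) K :=
  goldenEval x c.1 • 1 + goldenEval x c.2.1 • a.1 + goldenEval x c.2.2.1 • α.1 +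
    goldenEval x c.2.2.2 • (a.1 * α.1)

variable {a α : SL(2, K)} {x : K}

theorem icosianEval_neg (c : (ℤ × ℤ) × (ℤ × ℤ) × (ℤ × ℤ) × (ℤ × ℤ)) :
    icosianEval a α x (-c) = -icosianEval a α x c := by
  simp only [icosianEval, Prod.fst_neg, Prod.snd_neg, goldenEval_neg]
  module

theorem icosianEval_sub (c d : (ℤ × ℤ) × (ℤ × ℤ) × (ℤ × ℤ) × (ℤ × ℤ)) :
    icosianEval a α x (c - d) = icosianEval a α x c - icosianEval a α x d := by
  simp only [icosianEval, Prod.fst_sub, Prod.snd_sub, goldenEval_sub]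
  module

theorem icosianEval_leftA (h1 : tr a = 1) (c : (ℤ × ℤ) × (ℤ × ℤ) × (ℤ × ℤ) × (ℤ × ℤ)) :
    icosianEval a α x (Icosian.leftA c) = a.1 * icosianEval a α x c := by
  simp only [icosianEval, Icosian.leftA, goldenEval_add, goldenEval_neg, mul_add, mul_smul_comm,
    ← mul_assoc, val_mul_self, h1, sub_mul, smul_mul_assoc, one_mul, mul_one]
  module

theorem icosianEval_leftB (hx : x ^ 2 = x + 1) (h1 : tr a = 1) (h2 : tr α = 0)
    (h3 : tr (a * α) = x) (c : (ℤ × ℤ) × (ℤ × ℤ) × (ℤ × ℤ) × (ℤ × ℤ)) :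
    icosianEval a α x (Icosian.leftB c) = α.1 * icosianEval a α x c := by
  simp only [icosianEval, Icosian.leftB, goldenEval_add, goldenEval_neg, goldenEval_sub,
    goldenEval_mulX hx, mul_add, mul_smul_comm, ← mul_assoc, val_mul_val_comm h1 h2 h3, sub_mul,
    add_mul, mul_assoc a.1 α.1 α.1, val_mul_self α, h2, smul_mul_assoc, one_mul, mul_one, mul_sub]
  module

theorem trace_icosianEval (hx : x ^ 2 = x + 1) (h1 : tr a = 1) (h2 : tr α = 0)
    (h3 : tr (a * α) = x) (c : (ℤ × ℤ) × (ℤ × ℤ) × (ℤ × ℤ) × (ℤ × ℤ)) :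
    trace (icosianEval a α x c) = goldenEval x (Icosian.trace c) := by
  rw [tr] at h1 h2 h3
  rw [val_mul] at h3
  simp only [icosianEval, Icosian.trace, trace_add, trace_smul, h1, h2, h3, trace_one,
    Fintype.card_fin, goldenEval_add, goldenEval_mulX hx, smul_eq_mul]
  push_cast
  ring

/-- The elements of the binary icosahedral group generated by `a` and `α` are icosians. -/
theorem exists_icosianEval_eq (hx : x ^ 2 = x + 1) (h1 : tr a = 1) (h2 : tr α = 0)
    (h3 : tr (a * α) = x) {A : SL(2, K)} (hA : A ∈ Subgroup.closure {a, α}) :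
    ∃ c ∈ Icosian.elements, A.1 = icosianEval a α x c := by
  induction hA using Subgroup.closure_induction_left with
  | one =>
    exact ⟨((1, 0), (0, 0), (0, 0), (0, 0)), by decide +kernel, by
      simp [icosianEval, goldenEval]⟩
  | mul_left y hy A _ ih =>
    obtain ⟨c, hc, e⟩ := ih
    rcases hy with rfl | rfl
    · exact ⟨_, Icosian.leftA_mem c hc, by rw [icosianEval_leftA h1, val_mul, e]⟩
    · exact ⟨_, Icosian.leftB_mem c hc, by rw [icosianEval_leftB hx h1 h2 h3, val_mul, e]⟩
  | inv_mul_cancel y hy A _ ih =>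
    obtain ⟨c, hc, e⟩ := ih
    rcases hy with rfl | rfl
    · exact ⟨_, Icosian.sub_leftA_mem c hc, by
        rw [icosianEval_sub, icosianEval_leftA h1, val_mul, val_inv, h1, e, one_smul, sub_mul,
          one_mul]⟩
    · exact ⟨_, Icosian.neg_leftB_mem c hc, by
        rw [icosianEval_neg, icosianEval_leftB hx h1 h2 h3, val_mul, val_inv, h2, e, zero_smul,
          zero_sub, neg_mul]⟩

/-- The squares of the traces of the elements of the binary icosahedral group. -/
theorem tr_sq_of_mem_closure (hx : x ^ 2 = x + 1) (h1 : tr a = 1) (h2 : tr α = 0)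
    (h3 : tr (a * α) = x) {A : SL(2, K)}
    (hA : proj A ∈ Subgroup.closure {proj a, proj α}) :
    tr A ^ 2 = 0 ∨ tr A ^ 2 = 1 ∨ tr A ^ 2 = x + 1 ∨ tr A ^ 2 = 2 - x ∨ tr A ^ 2 = 4 := by
  have : Subgroup.closure {proj a, proj α} = (Subgroup.closure {a, α}).map proj := by
    rw [MonoidHom.map_closure, Set.image_pair]
  -- Elements of the projective group lift to the binary group up to sign, which is invisible in the
  -- square of the trace.
  rw [this] at hA
  obtain ⟨B, hB, e⟩ := hA
  have hAB : tr A ^ 2 = tr B ^ 2 := by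
    rcases proj_eq_proj_iff.1 e with rfl | rfl
    · rfl
    · rw [tr_neg, neg_sq]
  obtain ⟨c, hc, e⟩ := exists_icosianEval_eq hx h1 h2 h3 hB
  have ht := Icosian.trace_mem c hc
  rw [hAB, tr, e, trace_icosianEval hx h1 h2 h3]
  simp only [List.mem_cons, List.not_mem_nil, or_false] at ht
  rcases ht with ht | ht | ht | ht | ht | ht | ht | ht | ht <;> rw [ht] <;> simp only [goldenEval]
  · exact Or.inl (by push_cast; ring)
  · exact Or.inr (Or.inl (by push_cast; ring))
  · exact Or.inr (Or.inl (by push_cast; ring))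
  · exact Or.inr (Or.inr (Or.inl (by push_cast; linear_combination hx)))
  · exact Or.inr (Or.inr (Or.inl (by push_cast; linear_combination hx)))
  · exact Or.inr (Or.inr (Or.inr (Or.inl (by push_cast; linear_combination hx))))
  · exact Or.inr (Or.inr (Or.inr (Or.inl (by push_cast; linear_combination hx))))
  · exact Or.inr (Or.inr (Or.inr (Or.inr (by push_cast; ring))))
  · exact Or.inr (Or.inr (Or.inr (Or.inr (by push_cast; ring))))

end

end PSLTwo

/-! ### Double cosets in the octahedral group -/

theorem eq_of_mem_zpowers_of_pow_three {G : Type*} [Group G] {r c : G} (hr : r ^ 3 = 1)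
    (hc : c ∈ Subgroup.zpowers r) : c = 1 ∨ c = r ∨ c = r⁻¹ := by
  obtain ⟨n, rfl⟩ := hc
  have h3 : r ^ (3 : ℤ) = 1 := by exact_mod_cast hr
  have h := Int.emod_add_mul_ediv n 3
  have e : r ^ n = r ^ (n % 3) := by
    conv_lhs => rw [← h, zpow_add, zpow_mul, h3, one_zpow, mul_one]
  change r ^ n = 1 ∨ r ^ n = r ∨ r ^ n = r⁻¹
  rw [e]
  have : n % 3 = 0 ∨ n % 3 = 1 ∨ n % 3 = 2 := by omega
  rcases this with h | h | h <;> rw [h]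
  · exact Or.inl (zpow_zero r)
  · exact Or.inr (Or.inl (zpow_one r))
  · refine Or.inr (Or.inr ?_)
    rw [show (2 : ℤ) = 3 + -1 by norm_num, zpow_add, h3, one_mul, zpow_neg_one]

/-- The double cosets of `⟨r⟩` in a group generated by an element `r` of order `3` and an
involution `s`, with `(r⁻¹s)⁴ = 1`. -/
theorem mem_of_mem_closure_of_octahedral {G : Type*} [Group G] {r s : G} (hr : r ^ 3 = 1)
    (hs : s ^ 2 = 1) (hrs : (r⁻¹ * s) ^ 4 = 1) {g : G} (hg : g ∈ Subgroup.closure {r, s}) :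
    ∃ c ∈ Subgroup.zpowers r, ∃ d ∈ Subgroup.zpowers r,
      g = c * d ∨ g = c * (s * r * s * r⁻¹ * s) * d ∨ g = c * (r⁻¹ * s) ^ 2 * d ∨
        g = c * s * d := by
  have hss : s * s = 1 := by rw [← pow_two, hs]
  have hsi : s⁻¹ = s := inv_eq_of_mul_eq_one_left hss
  have hrr : r * r = r⁻¹ := eq_inv_of_mul_eq_one_left (by rw [← hr, pow_succ, pow_two])
  have hri : r⁻¹ * r⁻¹ = r := by rw [← mul_inv_rev, hrr, inv_inv]
  have hss' (x : G) : s * (s * x) = x := by rw [← mul_assoc, hss, one_mul]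
  have hrr' (x : G) : r * (r * x) = r⁻¹ * x := by rw [← mul_assoc, hrr]
  have hri' (x : G) : r⁻¹ * (r⁻¹ * x) = r * x := by rw [← mul_assoc, hri]
  obtain ⟨v, hv⟩ : ∃ v, v = (r⁻¹ * s) ^ 2 := ⟨_, rfl⟩
  obtain ⟨t, ht⟩ : ∃ t, t = s * r * s * r⁻¹ * s := ⟨_, rfl⟩
  rw [← hv, ← ht]
  have d1 : v = r⁻¹ * (s * (r⁻¹ * s)) := by rw [hv, pow_two, mul_assoc]
  have d2 : v = s * (r * (s * r)) := by
    have hvv : v * v = 1 := by rw [hv, ← pow_add, hrs]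
    rw [eq_inv_of_mul_eq_one_left hvv, d1]
    simp only [mul_inv_rev, hsi, inv_inv, mul_assoc]
  simp only [mul_assoc] at ht
  have f1 : s * (r * s) = v * r⁻¹ := by rw [d2]; simp only [mul_assoc, mul_inv_cancel, mul_one]
  have f2 : s * (r⁻¹ * s) = r * v := by rw [d1, mul_inv_cancel_left]
  have f3 : s * v = r * (s * r) := by rw [d2, hss']
  have f4 : s * (r * v) = r⁻¹ * s := by rw [d1, mul_inv_cancel_left, hss']
  have f5 : s * (r⁻¹ * v) = t := by rw [d1, hri', ht]
  have f6 : s * t = r⁻¹ * v := by rw [ht, hss', f2, hrr']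
  -- Thus `t` inverts `r` under conjugation and its double coset is a single coset of ⟨r⟩.
  have f7 : r * (t * r) = t := by
    calc r * (t * r) = r * (s * (r * s) * (r⁻¹ * (s * r))) := by rw [ht]; simp only [mul_assoc]
      _ = r * (v * (r * (s * r))) := by rw [f1]; simp only [mul_assoc, hri']
      _ = s * (r⁻¹ * (s * (r * (s * r)))) := by rw [← mul_assoc r v, ← f2]; simp only [mul_assoc]
      _ = t := by rw [← d2, f5]
  have f8 : t * r = r⁻¹ * t := eq_inv_mul_of_mul_eq f7
  have f9 : r * t = t * r⁻¹ := eq_mul_inv_of_mul_eq (by rw [mul_assoc, f7])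
  have g1 := Subgroup.one_mem (Subgroup.zpowers r)
  have gr := Subgroup.mem_zpowers r
  have gi := inv_mem gr
  have hrmul {y g : G} (hy : y ∈ Subgroup.zpowers r) (h : ∃ c ∈ Subgroup.zpowers r,
      ∃ d ∈ Subgroup.zpowers r, g = c * d ∨ g = c * t * d ∨ g = c * v * d ∨ g = c * s * d) :
      ∃ c ∈ Subgroup.zpowers r, ∃ d ∈ Subgroup.zpowers r, y * g = c * d ∨ y * g = c * t * d ∨
        y * g = c * v * d ∨ y * g = c * s * d := by
    obtain ⟨c, hc, d, hd, h⟩ := h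
    refine ⟨y * c, mul_mem hy hc, d, hd, ?_⟩
    rcases h with rfl | rfl | rfl | rfl <;> simp [mul_assoc]
  -- The union of the four double cosets contains 1 and is stable under left multiplication by `r`;
  -- stability under `s` is a short table, so the union is everything.
  have hsmul {g : G} (h : ∃ c ∈ Subgroup.zpowers r,
      ∃ d ∈ Subgroup.zpowers r, g = c * d ∨ g = c * t * d ∨ g = c * v * d ∨ g = c * s * d) :
      ∃ c ∈ Subgroup.zpowers r, ∃ d ∈ Subgroup.zpowers r, s * g = c * d ∨ s * g = c * t * d ∨
        s * g = c * v * d ∨ s * g = c * s * d := by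
    obtain ⟨c, hc, d, hd, h⟩ := h
    rcases h with rfl | rfl | rfl | rfl
    · exact ⟨1, g1, c * d, mul_mem hc hd, Or.inr (Or.inr (Or.inr (by simp)))⟩
    · rcases eq_of_mem_zpowers_of_pow_three hr hc with rfl | rfl | rfl
      · exact ⟨r⁻¹, gi, d, hd, Or.inr (Or.inr (Or.inl (by rw [one_mul, ← mul_assoc, f6])))⟩
      · exact ⟨c⁻¹, gi, c⁻¹ * d, mul_mem gi hd, Or.inr (Or.inr (Or.inl (by
          rw [f9, ← mul_assoc, ← mul_assoc, f6, mul_assoc _ _ d])))⟩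
      · exact ⟨r⁻¹, gi, r * d, mul_mem gr hd, Or.inr (Or.inr (Or.inl (by
          rw [← f8, ← mul_assoc, ← mul_assoc, f6, mul_assoc _ _ d])))⟩
    · rcases eq_of_mem_zpowers_of_pow_three hr hc with rfl | rfl | rfl
      · exact ⟨r, gr, r * d, mul_mem gr hd, Or.inr (Or.inr (Or.inr (by
          rw [one_mul, ← mul_assoc, f3]; simp only [mul_assoc])))⟩
      · exact ⟨c⁻¹, gi, d, hd, Or.inr (Or.inr (Or.inr (by rw [← mul_assoc, f4])))⟩
      · exact ⟨1, g1, d, hd, Or.inr (Or.inl (by rw [← mul_assoc, f5, one_mul]))⟩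
    · rcases eq_of_mem_zpowers_of_pow_three hr hc with rfl | rfl | rfl
      · exact ⟨1, g1, d, hd, Or.inl (by simp only [one_mul, hss'])⟩
      · exact ⟨1, g1, c⁻¹ * d, mul_mem gi hd, Or.inr (Or.inr (Or.inl (by
          rw [← mul_assoc, f1]; simp only [mul_assoc, one_mul])))⟩
      · exact ⟨r, gr, d, hd, Or.inr (Or.inr (Or.inl (by rw [← mul_assoc, f2])))⟩
  induction hg using Subgroup.closure_induction_left with
  | one => exact ⟨1, g1, 1, g1, Or.inl (by simp)⟩
  | mul_left y hy g _ ih =>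
    rcases hy with rfl | rfl
    · exact hrmul gr ih
    · exact hsmul ih
  | inv_mul_cancel y hy g _ ih =>
    rcases hy with rfl | rfl
    · exact hrmul gi ih
    · rw [hsi]
      exact hsmul ih

/-! ### The intersection property -/

namespace PSLTwo

open scoped MatrixGroups
open Matrix

variable {K : Type*} [Field K]

namespace IsFrame

variable {a α γ : SL(2, K)} {w x z : K}

/-- The intersection property. -/
theorem inf_le (h : IsFrame a α γ w x z) (hx : x ^ 2 = x + 1) (hw : w ^ 2 = 2)
    (hz : z ^ 2 + x * w * z + x ^ 2 - 1 = 0) (h2 : (2 : K) ≠ 0) (h3 : (3 : K) ≠ 0)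
    (h5 : (5 : K) ≠ 0) (h11 : (11 : K) ≠ 0) :
    Subgroup.closure {proj a, proj (a⁻¹ * γ)} ⊓ Subgroup.closure {proj (α * a⁻¹), proj a} ≤
      Subgroup.zpowers (proj a) := by
  -- The polynomial x² − x − 1 takes the value −1 at 0 and 1, and the value 11 at −3 and 4; the
  -- latter is where characteristic 11 must be excluded.
  have n0 : x ≠ 0 := fun e => one_ne_zero (α := K) (by rw [e] at hx; linear_combination -hx)
  have n1 : x ≠ 1 := fun e => one_ne_zero (α := K) (by rw [e] at hx; linear_combination -hx)
  have n3 : x ≠ -3 := fun e => h11 (by rw [e] at hx; linear_combination hx)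
  have n4 : x ≠ 4 := fun e => h11 (by rw [e] at hx; linear_combination hx)
  have hT := h.isRotaryTriple hx hw h2 h3 h5
  rintro g ⟨hg0, hg3⟩
  have hr : proj a ^ 3 = 1 := hT.orderOf_snd ▸ pow_orderOf_eq_one _
  have hs : proj γ ^ 2 = 1 := by
    have := hT.sq_snd_thd
    rwa [← map_mul, mul_inv_cancel_left] at this
  have hrs : ((proj a)⁻¹ * proj γ) ^ 4 = 1 := by
    have := pow_orderOf_eq_one (proj (a⁻¹ * γ))
    rwa [hT.orderOf_thd, map_mul, map_inv] at this
  have e3 : Subgroup.closure {proj (α * a⁻¹), proj a} ≤ Subgroup.closure {proj a, proj α} := by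
    rw [Subgroup.closure_le]
    have h1 : proj a ∈ Subgroup.closure {proj a, proj α} := Subgroup.subset_closure (by simp)
    have h2 : proj α ∈ Subgroup.closure {proj a, proj α} := Subgroup.subset_closure (by simp)
    rintro _ (rfl | rfl)
    · rw [map_mul, map_inv]
      exact mul_mem h2 (inv_mem h1)
    · exact h1
  have e0 : Subgroup.closure {proj a, proj (a⁻¹ * γ)} ≤ Subgroup.closure {proj a, proj γ} := by
    rw [Subgroup.closure_le]
    have h1 : proj a ∈ Subgroup.closure {proj a, proj γ} := Subgroup.subset_closure (by simp)
    have h2 : proj γ ∈ Subgroup.closure {proj a, proj γ} := Subgroup.subset_closure (by simp)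
    rintro _ (rfl | rfl)
    · exact h1
    · rw [map_mul, map_inv]
      exact mul_mem (inv_mem h1) h2
  replace hg3 := e3 hg3
  replace hg0 := e0 hg0
  have ha3 : proj a ∈ Subgroup.closure {proj a, proj α} := Subgroup.subset_closure (by simp)
  have hα3 : proj α ∈ Subgroup.closure {proj a, proj α} := Subgroup.subset_closure (by simp)
  have key {A : SL(2, K)} := tr_sq_of_mem_closure (A := A) hx h.tr_a h.tr_α h.tr_aα
  have hγi := inv_eq_neg_of_tr_eq_zero h.tr_γ
  have hγα : tr (γ * α) = z := by rw [tr_mul_comm, h.tr_αγ]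
  have hγaα : tr (γ * (a * α)) = 0 := by rw [tr_mul_comm, h.tr_aαγ]
  have haγaα : tr (a * γ * (a * α)) = x * w + z := by
    rw [← mul_assoc, tr_mul_mul_mul, h.tr_aγ, h.tr_aα, hγi, neg_mul γ, tr_neg, hγα]
    ring
  -- The element tested is σ₃². Multiplied by aα it acquires a trace of square 1 − x, which is not
  -- among the five icosahedral values.
  have hv : (proj a⁻¹ * proj γ) ^ 2 ∉ Subgroup.closure {proj a, proj α} := fun hm => by
    have hm' := mul_mem hm (mul_mem ha3 hα3)
    rw [pow_two, ← map_mul, ← map_mul, ← map_mul, ← map_mul] at hm'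
    have e : tr (a⁻¹ * γ * (a⁻¹ * γ) * (a * α)) = x + w * z := by
      rw [tr_mul_mul_self, tr_inv_mul, mul_assoc a⁻¹, tr_inv_mul, hγaα, ← mul_assoc a γ, haγaα,
        h.tr_aα, h.tr_aγ, h.tr_γ]
      linear_combination x * hw
    have e2 : tr (a⁻¹ * γ * (a⁻¹ * γ) * (a * α)) ^ 2 = 1 - x := by
      rw [e]; linear_combination z ^ 2 * hw + 2 * hz - hx
    rcases key hm' with e' | e' | e' | e' | e' <;> rw [e2] at e'
    · exact n1 (by linear_combination -e')
    · exact n0 (by linear_combination -e')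
    · exact mul_ne_zero h2 n0 (by linear_combination -e')
    · exact one_ne_zero (α := K) (by linear_combination -e')
    · exact n3 (by linear_combination -e')
  -- If γ were in the icosahedral group, so would be a⁻¹γ and its square, the case just excluded.
  have hγ : proj γ ∉ Subgroup.closure {proj a, proj α} := fun hm =>
    hv (pow_mem (mul_mem (by rw [map_inv]; exact inv_mem ha3) hm) 2)
  have ht : proj γ * proj a * proj γ * (proj a)⁻¹ * proj γ ∉
      Subgroup.closure {proj a, proj α} := fun hm => by
    have ht (C : SL(2, K)) : tr (γ * a * γ * (a⁻¹ * γ * C)) =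
        -2 * tr (γ * C) - w * tr (a * C) + tr (a * γ * C) := by
      rw [tr_mul_mul_mul, mul_assoc a⁻¹ γ C, tr_inv_mul, ← mul_assoc γ a⁻¹, ← mul_assoc (γ * a⁻¹),
        tr_mul_mul_mul, inv_inv, tr_mul_comm γ a⁻¹, tr_inv_mul, tr_mul_comm γ a, tr_inv_mul, h.tr_aγ,
        h.tr_γ, h.tr_a, mul_assoc a γ, mul_inv_cancel_left]
      linear_combination (-tr (γ * C)) * hw
    have e1 : tr (γ * a * γ * a⁻¹ * γ * α) = -z - x * w := by
      have := ht α
      rw [hγα, h.tr_aα, tr_mul_comm (a * γ), ← mul_assoc α, h.tr_αaγ] at this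
      simp only [mul_assoc] at this ⊢
      rw [this]
      ring
    have e2 : tr (γ * a * γ * a⁻¹ * γ * (a * α)) = z := by
      have := ht (a * α)
      rw [hγaα, ← mul_assoc a a, tr_mul_mul_self, haγaα, h.tr_a, h.tr_aα, h.tr_α] at this
      simp only [mul_assoc] at this ⊢
      rw [this]
      ring
    rw [← map_inv, ← map_mul, ← map_mul, ← map_mul, ← map_mul] at hm
    have m1 := mul_mem hm hα3
    have m2 := mul_mem hm (mul_mem ha3 hα3)
    rw [← map_mul] at m1 m2
    rw [← map_mul] at m2
    have c1 := key m1
    have c2 := key m2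
    rw [e1] at c1
    rw [e2] at c2
    -- For the third representative a single trace would depend on z. The products with α and aα
    -- have traces whose squares A, B satisfy A + B = 2 and AB = x + 1, and none of the 25 pairs of
    -- icosahedral values satisfies both.
    have hs : (-z - x * w) ^ 2 + z ^ 2 = 2 := by
      linear_combination 2 * hz + x ^ 2 * hw
    have hp : (-z - x * w) ^ 2 * z ^ 2 = x + 1 := by
      linear_combination (z ^ 2 + x * w * z + 1 - x ^ 2) * hz + (x ^ 2 + x) * hx
    generalize (-z - x * w) ^ 2 = A at *
    generalize z ^ 2 = B at *
    have m0 := mul_ne_zero h2 n0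
    have m1 := mul_ne_zero h2 (sub_ne_zero.2 n1)
    have m3 := mul_ne_zero h2 h3
    have m := one_ne_zero (α := K)
    rcases c1 with rfl | rfl | rfl | rfl | rfl <;> rcases c2 with rfl | rfl | rfl | rfl | rfl <;>
      first
        | exact m (by linear_combination hs)
        | exact m (by linear_combination -hs)
        | exact h2 (by linear_combination hs)
        | exact h2 (by linear_combination -hs)
        | exact h3 (by linear_combination hs)
        | exact m3 (by linear_combination hs)
        | exact n0 (by linear_combination hs)
        | exact n0 (by linear_combination -hs)
        | exact n0 (by linear_combination -hp)
        | exact n1 (by linear_combination hs)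
        | exact n1 (by linear_combination -hs)
        | exact n3 (by linear_combination hs)
        | exact n4 (by linear_combination -hs)
        | exact m0 (by linear_combination hs)
        | exact m1 (by linear_combination -hs)
  obtain ⟨c, hc, d, hd, h⟩ := mem_of_mem_closure_of_octahedral hr hs hrs hg0
  have hc3 := (Subgroup.zpowers_le.2 ha3) hc
  have hd3 := (Subgroup.zpowers_le.2 ha3) hd
  rcases h with rfl | rfl | rfl | rfl
  · exact mul_mem hc hd
  · exact absurd ((Subgroup.mul_mem_cancel_left _ hc3).1
      ((Subgroup.mul_mem_cancel_right _ hd3).1 hg3)) ht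
  · exact absurd ((Subgroup.mul_mem_cancel_left _ hc3).1
      ((Subgroup.mul_mem_cancel_right _ hd3).1 hg3)) (by rwa [map_inv] at hv)
  · exact absurd ((Subgroup.mul_mem_cancel_left _ hc3).1
      ((Subgroup.mul_mem_cancel_right _ hd3).1 hg3)) hγ

end IsFrame

end PSLTwo

/-! ### Commuting elements and subgroups containing unipotents -/

namespace PSLTwo

open scoped MatrixGroups
open Matrix

section

variable {K : Type*} [Field K]

/-- Matrices commuting with a nonscalar 2 × 2 matrix are combinations of it and 1, hence commute
with each other. -/
theorem commute_of_commute {A B C : SL(2, K)} (hA : A ≠ 1) (hA' : A ≠ -1) (hB : Commute A B)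
    (hC : Commute A C) : Commute B C := by
  have ns : ¬ (A.1 0 1 = 0 ∧ A.1 1 0 = 0 ∧ A.1 0 0 = A.1 1 1) := by
    rintro ⟨h1, h2, h3⟩
    have e : A.1 = A.1 0 0 • (1 : Matrix (Fin 2) (Fin 2) K) := by
      ext i j
      fin_cases i <;> fin_cases j <;> simp [h1, h2, h3]
    rcases eq_one_or_eq_neg_one_of_val_eq_smul e with h | h
    · exact hA h
    · exact hA' h
  have eB : A.1 * B.1 = B.1 * A.1 := congrArg Subtype.val hB
  have eC : A.1 * C.1 = C.1 * A.1 := congrArg Subtype.val hC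
  have b0 := congrFun (congrFun eB 0) 0
  have b1 := congrFun (congrFun eB 0) 1
  have b2 := congrFun (congrFun eB 1) 0
  have c0 := congrFun (congrFun eC 0) 0
  have c1 := congrFun (congrFun eC 0) 1
  have c2 := congrFun (congrFun eC 1) 0
  refine Subtype.ext ?_
  change B.1 * C.1 = C.1 * B.1
  simp only [mul_apply, Fin.sum_univ_two] at b0 b1 b2 c0 c1 c2
  generalize A.1 0 0 = a1, A.1 0 1 = a2, A.1 1 0 = a3, A.1 1 1 = a4 at *
  -- Modulo scalars, a matrix commuting with A is a multiple of A.
  have par {b1 b2 b3 b4 : K} (e1 : a1 * b1 + a2 * b3 = b1 * a1 + b2 * a3)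
      (e2 : a1 * b2 + a2 * b4 = b1 * a2 + b2 * a4) (e3 : a3 * b1 + a4 * b3 = b3 * a1 + b4 * a3) :
      ∃ r, b2 = r * a2 ∧ b3 = r * a3 ∧ b1 - b4 = r * (a1 - a4) := by
    by_cases h1 : a2 = 0
    · by_cases h2 : a3 = 0
      · have h3 : a1 - a4 ≠ 0 := sub_ne_zero.2 fun h => ns ⟨h1, h2, h⟩
        refine ⟨(b1 - b4) / (a1 - a4), ?_, ?_, ?_⟩ <;> field_simp <;> grind
      · refine ⟨b3 / a3, ?_, ?_, ?_⟩ <;> field_simp <;> grind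
    · refine ⟨b2 / a2, ?_, ?_, ?_⟩ <;> field_simp <;> grind
  obtain ⟨r, r1, r2, r3⟩ := par b0 b1 b2
  obtain ⟨s, s1, s2, s3⟩ := par c0 c1 c2
  ext i j
  fin_cases i <;> fin_cases j <;> simp [mul_apply, Fin.sum_univ_two] <;> grind

/-- The conjugate C commutes with A and has the same trace, so (C − A)(C − A⁻¹) = 0. Both factors
singular would give tr(A)² = 4; hence one is invertible and the other vanishes. -/
theorem eq_or_eq_inv_of_commute {A B : SL(2, K)} (hA : tr A ^ 2 ≠ 4)
    (h : Commute (B * A * B⁻¹) A) : B * A * B⁻¹ = A ∨ B * A * B⁻¹ = A⁻¹ := by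
  have ht : tr (B * A * B⁻¹) = tr A := by rw [tr_mul_comm, inv_mul_cancel_left]
  generalize B * A * B⁻¹ = C at *
  have hc : C.1 * A.1 = A.1 * C.1 := congrArg Subtype.val h
  have hAA := val_mul_self A
  have hCC := val_mul_self C
  rw [ht] at hCC
  have hDD : (C.1 - A.1) * (C.1 - (A⁻¹).1) = 0 := by
    rw [val_inv, sub_mul, mul_sub, mul_sub, mul_sub, mul_sub, hCC, hAA, hc, mul_smul_comm,
      mul_smul_comm, mul_one, mul_one]
    abel
  have hdet : det (C.1 - A.1) * det (C.1 - (A⁻¹).1) = 0 := by rw [← det_mul, hDD, det_zero]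
  by_cases h1 : det (C.1 - A.1) = 0
  · by_cases h2 : det (C.1 - (A⁻¹).1) = 0
    · exfalso
      apply hA
      have t1 : tr C = tr A := ht
      have ha := A.2
      have hc' := C.2
      rw [val_inv] at h2
      simp only [tr, det_fin_two, trace_fin_two, Matrix.sub_apply, Matrix.smul_apply, smul_eq_mul,
        one_apply_eq, one_apply_ne zero_ne_one, one_apply_ne one_ne_zero] at *
      linear_combination -h1 - h2 + 2 * ha + 2 * hc' - (A.1 0 0 + A.1 1 1) * t1
    · refine Or.inl (Subtype.ext (sub_eq_zero.1 ?_))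
      have hu : IsUnit (C.1 - (A⁻¹).1) := (isUnit_iff_isUnit_det _).2 (isUnit_iff_ne_zero.2 h2)
      exact hu.mul_left_eq_zero.1 hDD
  · refine Or.inr (Subtype.ext (sub_eq_zero.1 ?_))
    have hu : IsUnit (C.1 - A.1) := (isUnit_iff_isUnit_det _).2 (isUnit_iff_ne_zero.2 h1)
    exact hu.mul_right_eq_zero.1 hDD

end

namespace IsFrame

variable {K : Type*} [Field K] {a α γ : SL(2, K)} {w x z : K}

/-- The trace of αaα a⁻¹ would give x² = 3, whereas x² − 3 is a unit. -/
theorem not_commute (h : IsFrame a α γ w x z) (hx : x ^ 2 = x + 1) : ¬ Commute a α := fun hc => by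
  have e : α * a * α * a⁻¹ = -1 := by
    rw [← hc.eq, mul_assoc a, mul_self_of_tr_eq_zero h.tr_α]
    simp
  have := tr_mul_mul_mul α a a⁻¹
  rw [e, tr_neg, tr_one, tr_mul_comm α a, h.tr_aα, tr_mul_comm α, tr_inv_mul, h.tr_a, h.tr_α,
    h.tr_aα, tr_inv_mul, tr_inv, mul_inv_cancel, tr_one,
    h.tr_a] at this
  have hu := unit_of_sq_eq hx
  rw [show x ^ 2 - 3 = 0 by linear_combination this, mul_zero] at hu
  exact zero_ne_one hu

end IsFrame

variable {p : ℕ} [Fact p.Prime] {a α γ : SL(2, ZMod p)} {w x z : ZMod p}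

/-- A subgroup containing `a`, `α` and a nontrivial unipotent element is the whole group. -/
theorem IsFrame.eq_top_of_unipotent_mem (h : IsFrame a α γ w x z) (hx : x ^ 2 = x + 1)
    {H : Subgroup SL(2, ZMod p)} (ha : a ∈ H) (hα : α ∈ H) {X : SL(2, ZMod p)} (hX : X ∈ H)
    (hX1 : X ≠ 1) (tX : tr X = 2) : H = ⊤ := by
  by_contra hH
  -- The unipotents X and gXg⁻¹ generate SL(2, p) unless tr(XgXg⁻¹) = 2, and this trace equals 2 −
  -- (tr(gX) − tr g)². Applied to 1, a, α, aα, the equality says that X has the coordinates of the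
  -- identity.
  have key {g : SL(2, ZMod p)} (hg : g ∈ H) : tr (g * X) = tr g := by
    by_contra hne
    refine hH (eq_top_of_tr_eq_two hX (mul_mem (mul_mem hg hX) (inv_mem hg)) tX ?_ ?_)
    · rw [tr_mul_comm, inv_mul_cancel_left, tX]
    · have e1 := tr_mul_mul_mul X g g⁻¹
      have e2 := tr_inv_mul g X
      have e3 := tr_mul_mul_self g⁻¹ 1
      rw [mul_one, mul_one, tr_inv, tr_one] at e3
      rw [tr_mul_comm g⁻¹ X] at e2
      rw [tr_mul_comm X g, e2, e3, tX] at e1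
      rw [← mul_assoc, ← mul_assoc, e1]
      intro h0
      apply hne
      have : (tr (g * X) - tr g) ^ 2 = 0 := by linear_combination -h0
      exact sub_eq_zero.1 (pow_eq_zero_iff two_ne_zero |>.1 this)
  have ka : trace (a.1 * X.1) = trace (a.1 * 1) := by rw [mul_one]; exact key ha
  have kα : trace (α.1 * X.1) = trace (α.1 * 1) := by rw [mul_one]; exact key hα
  have kaα : trace (a.1 * α.1 * X.1) = trace (a.1 * α.1 * 1) := by
    rw [mul_one]; exact key (mul_mem ha hα)
  have k1 : trace X.1 = trace (1 : Matrix (Fin 2) (Fin 2) (ZMod p)) := by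
    rw [trace_one]; simpa [tr] using tX
  obtain ⟨c, hc⟩ := eq_sum_quad (unit_of_sq_eq hx) h.tr_a h.tr_α h.tr_aα X.1
  obtain ⟨d, hd⟩ := eq_sum_quad (unit_of_sq_eq hx) h.tr_a h.tr_α h.tr_aα 1
  have ec := coord_eq (unit_of_sq_eq hx) h.tr_a h.tr_α h.tr_aα c hc
  have ed := coord_eq (unit_of_sq_eq hx) h.tr_a h.tr_α h.tr_aα d hd
  rw [ka, kα, kaα, k1, ← ed] at ec
  refine hX1 (Subtype.ext ?_)
  rw [← hc, ec, hd]
  rfl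

end PSLTwo

/-! ### Dickson's count of commuting classes -/

/-- The numerical contradiction in the count of the elements of a finite subgroup of `SL(2, K)` of
order prime to the characteristic, containing elements of projective orders `3`, `4` and `5`. -/
theorem false_of_sum_eq_one_sub {I : Type*} [Fintype I] (f v : I → ℚ) {m : ℚ} (hm : 0 < m)
    (hsum : ∑ i, f i = 1 - 2 * m) (hv : ∀ i, 0 < v i) (hv4 : ∀ i, v i = 1 / 4 ∨ v i ≤ 1 / 6)
    (hf : ∀ i, (f i = 1 - 2 * v i ∧ m ≤ v i / 2) ∨ (f i = 1 / 2 - v i ∧ m ≤ v i / 4))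
    {i₃ i₄ i₅ : I} (h3 : v i₃ ≤ 1 / 6) (h4 : v i₄ ≤ 1 / 8) (h5 : v i₅ ≤ 1 / 10)
    (h34 : i₃ = i₄ → v i₃ ≤ 1 / 24) (h45 : i₄ = i₅ → v i₄ ≤ 1 / 40)
    (h35 : i₃ = i₅ → v i₃ ≤ 1 / 30) (h345 : i₃ = i₄ → i₄ = i₅ → v i₃ ≤ 1 / 120) : False := by
  classical
  have hv' (i) : v i ≤ 1 / 4 := by rcases hv4 i with h | h <;> linarith
  have hlow (i) : 1 / 2 - v i ≤ f i := by
    rcases hf i with h | h <;> linarith [h.1, hv i, hv' i]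
  have hquarter (i) : 1 / 4 ≤ f i := by linarith [hlow i, hv' i]
  have hnonneg (i) : 0 ≤ f i := by linarith [hquarter i]
  have hle (s : Finset I) : ∑ i ∈ s, f i ≤ 1 - 2 * m :=
    hsum ▸ Finset.sum_le_univ_sum_of_nonneg hnonneg
  have heq (s : Finset I) (hs : ¬ ∃ k, k ∉ s) : ∑ i ∈ s, f i = 1 - 2 * m := by
    rw [← hsum, Finset.eq_univ_iff_forall.2 (not_exists_not.1 hs)]
  -- Two such classes take up at least 1 − (1/4 − 1/24) = 19/24; a third one, of at least 1/4, would
  -- exceed 1. If there is no third, the sum would be exactly 1 − 2m, contradicting the bounds on m.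
  have two {i j : I} (hij : i ≠ j) (h : v i + v j ≤ 1 / 4 - 1 / 24) (hi : v i ≤ 1 / 6)
      (hj : v j ≤ 1 / 6) : False := by
    by_cases hk : ∃ k, k ∉ ({i, j} : Finset I)
    · obtain ⟨k, hk⟩ := hk
      have := hle (insert k {i, j})
      rw [Finset.sum_insert hk, Finset.sum_pair hij] at this
      linarith [hlow i, hlow j, hquarter k]
    · have := heq _ hk
      rw [Finset.sum_pair hij] at this
      rcases hf i with ⟨e, g⟩ | ⟨e, g⟩ <;> rcases hf j with ⟨e', g'⟩ | ⟨e', g'⟩ <;>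
        linarith [hv i, hv j]
  by_cases e34 : i₃ = i₄
  · by_cases e45 : i₄ = i₅
    -- All three elements lie in one class, which fills at least 1/2 − 1/120. Every other class
    -- fills at least 1/4, so at most two others fit, and each configuration misses 1 − 2m.
    · have hi := h345 e34 e45
      generalize i₃ = i at hi
      by_cases hj : ∃ j, j ∉ ({i} : Finset I)
      · obtain ⟨j, hj⟩ := hj
        rcases hf i with ⟨ei, gi⟩ | ⟨ei, gi⟩
        · have := hle (insert j {i})
          rw [Finset.sum_insert hj, Finset.sum_singleton] at this
          linarith [hquarter j]
        · by_cases hk : ∃ k, k ∉ insert j ({i} : Finset I)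
          · obtain ⟨k, hk⟩ := hk
            have h2 := hle (insert k (insert j {i}))
            rw [Finset.sum_insert hk, Finset.sum_insert hj, Finset.sum_singleton] at h2
            by_cases hl : ∃ l, l ∉ insert k (insert j ({i} : Finset I))
            · obtain ⟨l, hl⟩ := hl
              have := hle (insert l (insert k (insert j {i})))
              rw [Finset.sum_insert hl, Finset.sum_insert hk, Finset.sum_insert hj,
                Finset.sum_singleton] at this
              linarith [hquarter j, hquarter k, hquarter l]
            · have := heq _ hl
              rw [Finset.sum_insert hk, Finset.sum_insert hj, Finset.sum_singleton] at this
              rcases hf j with ⟨ej, gj⟩ | ⟨ej, gj⟩ <;> rcases hf k with ⟨ek, gk⟩ | ⟨ek, gk⟩ <;>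
                rcases hv4 j with hj4 | hj4 <;> rcases hv4 k with hk4 | hk4 <;>
                linarith [hv i, hv' j, hv' k]
          · have := heq _ hk
            rw [Finset.sum_insert hj, Finset.sum_singleton] at this
            rcases hf j with ⟨ej, gj⟩ | ⟨ej, gj⟩ <;> rcases hv4 j with hj4 | hj4 <;>
              linarith [hv i, hv j]
      · have := heq _ hj
        rw [Finset.sum_singleton] at this
        rcases hf i with ⟨e, g⟩ | ⟨e, g⟩ <;> linarith [hv i]
    · exact two (i := i₃) (j := i₅) (fun e => e45 (e34 ▸ e)) (by linarith [h34 e34]) h3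
        (by linarith)
  · by_cases e45 : i₄ = i₅
    · exact two (i := i₃) (j := i₄) e34 (by linarith [h45 e45]) h3 (by linarith)
    · by_cases e35 : i₃ = i₅
      · exact two (i := i₃) (j := i₄) e34 (by linarith [h35 e35]) h3 (by linarith)
      -- Three different classes fill at least 1/3 + 3/8 + 2/5 > 1.
      · have := hle {i₃, i₄, i₅}
        rw [Finset.sum_insert (by simp [e34, e35]), Finset.sum_pair e45] at this
        linarith [hlow i₃, hlow i₄, hlow i₅]

namespace CommutingClasses

variable {G : Type*} [Group G] {Z : Subgroup G}

/-- The elements that map `a` to itself or its inverse under conjugation. -/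
def pmStabilizer (a : G) : Subgroup G where
  carrier := {g | g * a * g⁻¹ = a ∨ g * a * g⁻¹ = a⁻¹}
  one_mem' := by simp
  mul_mem' := by
    rintro g h hg hh
    have e : g * h * a * (g * h)⁻¹ = g * (h * a * h⁻¹) * g⁻¹ := by group
    have e' : g * a⁻¹ * g⁻¹ = (g * a * g⁻¹)⁻¹ := by group
    simp only [Set.mem_ofPred_eq, e]
    rcases hh with h1 | h1 <;> rw [h1]
    · exact hg
    · rw [e']
      rcases hg with h2 | h2 <;> rw [h2]
      · exact Or.inr rfl
      · exact Or.inl (inv_inv a)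
  inv_mem' := by
    rintro g (h | h)
    · refine Or.inl ?_
      conv_lhs => rw [← h]
      group
    · refine Or.inr ?_
      have e : a = g * a⁻¹ * g⁻¹ := by
        rw [show g * a⁻¹ * g⁻¹ = (g * a * g⁻¹)⁻¹ by group, h, inv_inv]
      calc g⁻¹ * a * g⁻¹⁻¹ = g⁻¹ * (g * a⁻¹ * g⁻¹) * g⁻¹⁻¹ := by rw [← e]
        _ = a⁻¹ := by group

theorem mem_pmStabilizer {a g : G} :
    g ∈ pmStabilizer a ↔ g * a * g⁻¹ = a ∨ g * a * g⁻¹ = a⁻¹ := Iff.rfl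

/-- The elements commuting with `a`. -/
def stabilizer (a : G) : Subgroup G := Subgroup.centralizer {a}

theorem mem_stabilizer {a g : G} : g ∈ stabilizer a ↔ Commute a g := by
  rw [stabilizer, Subgroup.mem_centralizer_singleton_iff]
  exact ⟨fun h => h.symm, fun h => h.symm⟩

theorem commute_conj_iff {a b g : G} : Commute (g * a * g⁻¹) b ↔ Commute a (g⁻¹ * b * g) := by
  have := Commute.conj_iff (a := a) (b := g⁻¹ * b * g) g
  rw [← this, show g * (g⁻¹ * b * g) * g⁻¹ = b by group]

theorem conj_notMem (hZ : Z ≤ Subgroup.center G) {a : G} (ha : a ∉ Z) (g : G) :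
    g * a * g⁻¹ ∉ Z := fun h => ha (by
  have := Subgroup.mem_center_iff.1 (hZ h) g
  have e : a = g * a * g⁻¹ := by
    have : g * (g * a * g⁻¹) * g⁻¹ = g * a * g⁻¹ := by rw [this]; group
    have := congrArg (fun y => g⁻¹ * y * g) this
    simpa [mul_assoc] using this.symm
  rw [e]; exact h)

/-- The equivalence relation generated by conjugacy and commuting. -/
def setoid (hZ : Z ≤ Subgroup.center G)
    (hct : ∀ a ∉ Z, ∀ b c : G, Commute a b → Commute a c → Commute b c) : Setoid {a : G // a ∉ Z} where
  r a b := ∃ g : G, Commute (g * a.1 * g⁻¹) b.1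
  iseqv := by
    refine ⟨fun a => ⟨1, by simp⟩, ?_, ?_⟩
    · rintro a b ⟨g, h⟩
      refine ⟨g⁻¹, ?_⟩
      rw [inv_inv]
      exact (commute_conj_iff.1 h).symm
    · rintro a b c ⟨g, h⟩ ⟨k, h'⟩
      refine ⟨k * g, hct _ (conj_notMem hZ b.2 k) _ _ ?_ h'⟩
      rw [show k * g * a.1 * (k * g)⁻¹ = k * (g * a.1 * g⁻¹) * k⁻¹ by group]
      exact ((Commute.conj_iff k).2 h).symm

variable [Finite G]

/-- The centralizer has index at most 2 here: any two elements inverting `a` differ by one that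
centralizes it. -/
theorem card_pmStabilizer {a : G} (ha : a ≠ a⁻¹) :
    Nat.card (pmStabilizer a) = Nat.card (stabilizer a) ∨
      Nat.card (pmStabilizer a) = 2 * Nat.card (stabilizer a) := by
  have hS (g : G) : g ∈ (stabilizer a : Set G) ↔ g * a * g⁻¹ = a := by
    rw [SetLike.mem_coe, mem_stabilizer, mul_inv_eq_iff_eq_mul]
    exact ⟨fun h => h.symm, fun h => h.symm⟩
  by_cases hex : ∃ k : G, k * a * k⁻¹ = a⁻¹
  · obtain ⟨k, hk⟩ := hex
    right
    have e : (pmStabilizer a : Set G) = (stabilizer a : Set G) ∪ (k * ·) '' stabilizer a := by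
      ext g
      rw [SetLike.mem_coe, mem_pmStabilizer, Set.mem_union, hS]
      refine or_congr Iff.rfl ⟨fun h => ⟨k⁻¹ * g, ?_, mul_inv_cancel_left _ _⟩, ?_⟩
      · rw [hS, show k⁻¹ * g * a * (k⁻¹ * g)⁻¹ = k⁻¹ * (g * a * g⁻¹) * k by group, h, ← hk]
        group
      · rintro ⟨t, ht, rfl⟩
        rw [hS] at ht
        change k * t * a * (k * t)⁻¹ = a⁻¹
        rw [show k * t * a * (k * t)⁻¹ = k * (t * a * t⁻¹) * k⁻¹ by group, ht, hk]
    have hd : Disjoint (stabilizer a : Set G) ((k * ·) '' stabilizer a) := by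
      rw [Set.disjoint_left]
      rintro _ h ⟨t, ht, rfl⟩
      rw [hS] at ht h
      rw [show k * t * a * (k * t)⁻¹ = k * (t * a * t⁻¹) * k⁻¹ by group, ht, hk] at h
      exact ha h.symm
    rw [← SetLike.coe_sort_coe, ← SetLike.coe_sort_coe, Nat.card_coe_set_eq, Nat.card_coe_set_eq, e,
      Set.ncard_union_eq hd, Set.ncard_image_of_injective _ (mul_right_injective k), two_mul]
  · left
    have : pmStabilizer a = stabilizer a := by
      ext g
      rw [mem_pmStabilizer, ← SetLike.mem_coe, hS]
      exact or_iff_left fun h => hex ⟨g, h⟩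
    rw [this]

omit [Finite G] in
theorem commute_conj_iff_mem_pmStabilizer (hZ : Z ≤ Subgroup.center G)
    (hct : ∀ a ∉ Z, ∀ b c : G, Commute a b → Commute a c → Commute b c)
    (hE : ∀ a ∉ Z, ∀ g : G, Commute (g * a * g⁻¹) a → g * a * g⁻¹ = a ∨ g * a * g⁻¹ = a⁻¹)
    {a b g k : G} (ha : a ∉ Z) (hb : b ∉ Z) (hk : Commute (k * a * k⁻¹) b) :
    Commute a (g⁻¹ * b * g) ↔ k⁻¹ * g ∈ pmStabilizer a := by
  have hb' := conj_notMem hZ hb k⁻¹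
  rw [inv_inv] at hb'
  have hk' := commute_conj_iff.1 hk
  rw [show g⁻¹ * b * g = (k⁻¹ * g)⁻¹ * (k⁻¹ * b * k) * (k⁻¹ * g) by group, ← commute_conj_iff,
    mem_pmStabilizer]
  generalize k⁻¹ * g = t
  constructor
  · intro h
    exact hE a ha t (hct _ hb' _ _ h.symm hk'.symm)
  · rintro (h | h) <;> rw [h]
    · exact hk'
    · exact hk'.inv_left

/-- Double counting of the pairs (b, g) with b in the class of a and g⁻¹bg commuting with a: for
fixed b the elements g form a coset of `pmStabilizer`, and for fixed g the elements b correspond to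
the noncentral part, outside `Z`, of the centralizer. -/
theorem card_class_mul (hZ : Z ≤ Subgroup.center G)
    (hct : ∀ a ∉ Z, ∀ b c : G, Commute a b → Commute a c → Commute b c)
    (hE : ∀ a ∉ Z, ∀ g : G, Commute (g * a * g⁻¹) a → g * a * g⁻¹ = a ∨ g * a * g⁻¹ = a⁻¹)
    (a : {a : G // a ∉ Z}) :
    Nat.card {b // setoid hZ hct a b} * Nat.card (pmStabilizer a.1) =
      Nat.card G * (Nat.card (stabilizer a.1) - Nat.card Z) := by
  classical
  have := Fintype.ofFinite G
  have h := Finset.card_mul_eq_card_mul (s := (Finset.univ : Finset {b // setoid hZ hct a b}))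
    (t := (Finset.univ : Finset G)) (fun b g => Commute a.1 (g⁻¹ * b.1.1 * g))
    (m := Nat.card (pmStabilizer a.1)) (n := Nat.card (stabilizer a.1) - Nat.card Z) ?_ ?_
  · rwa [Finset.card_univ, Finset.card_univ, ← Nat.card_eq_fintype_card, ← Nat.card_eq_fintype_card]
      at h
  · rintro ⟨b, k, hk⟩ -
    rw [Finset.bipartiteAbove, ← Fintype.card_subtype, ← Nat.card_eq_fintype_card]
    refine Nat.card_congr ?_
    refine (Equiv.mulLeft k⁻¹).subtypeEquiv fun g => ?_
    rw [Equiv.coe_mulLeft]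
    exact commute_conj_iff_mem_pmStabilizer hZ hct hE a.2 b.2 hk
  · rintro g -
    have hZS : (Z : Set G) ⊆ stabilizer a.1 := fun y hy =>
      mem_stabilizer.2 (Subgroup.mem_center_iff.1 (hZ hy) a.1)
    have e : Nat.card (stabilizer a.1) - Nat.card Z =
        Nat.card {y : G // Commute a.1 y ∧ y ∉ Z} := by
      rw [← SetLike.coe_sort_coe, ← SetLike.coe_sort_coe, Nat.card_coe_set_eq, Nat.card_coe_set_eq,
        ← Set.ncard_sdiff hZS, ← Nat.card_coe_set_eq]
      exact Nat.card_congr (Equiv.subtypeEquivRight fun y => by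
        rw [Set.mem_sdiff, SetLike.mem_coe, mem_stabilizer]; rfl)
    rw [e, Finset.bipartiteBelow, ← Fintype.card_subtype, ← Nat.card_eq_fintype_card]
    refine Nat.card_congr ⟨fun b => ⟨g⁻¹ * b.1.1.1 * g, b.2, ?_⟩,
      fun y => ⟨⟨⟨g * y.1 * g⁻¹, conj_notMem hZ y.2.2 g⟩, ⟨g, (Commute.conj_iff g).2 y.2.1⟩⟩, ?_⟩,
      ?_, ?_⟩
    · have := conj_notMem hZ b.1.1.2 g⁻¹
      rwa [inv_inv] at this
    · change Commute a.1 (g⁻¹ * (g * y.1 * g⁻¹) * g)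
      rw [show g⁻¹ * (g * y.1 * g⁻¹) * g = y.1 by group]
      exact y.2.1
    · rintro ⟨⟨⟨b, hb⟩, hb'⟩, hb''⟩
      refine Subtype.ext (Subtype.ext (Subtype.ext ?_))
      change g * (g⁻¹ * b * g) * g⁻¹ = b
      group
    · rintro ⟨y, hy⟩
      refine Subtype.ext ?_
      change g⁻¹ * (g * y * g⁻¹) * g = y
      group

/-- A finite group in which commuting is transitive outside a central subgroup of order two, with
noncentral elements whose centralizers have orders divisible by `6`, `8` and `10`, has a noncentral
element that is mapped to itself or its inverse by every conjugation. -/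
theorem exists_pmStabilizer_eq_top (hZ : Z ≤ Subgroup.center G) (hZ2 : Nat.card Z = 2)
    (hct : ∀ a ∉ Z, ∀ b c : G, Commute a b → Commute a c → Commute b c)
    (hE : ∀ a ∉ Z, ∀ g : G, Commute (g * a * g⁻¹) a → g * a * g⁻¹ = a ∨ g * a * g⁻¹ = a⁻¹)
    (hinv : ∀ a ∉ Z, a ≠ a⁻¹) {a₃ a₄ a₅ : G} (h3 : a₃ ∉ Z) (h4 : a₄ ∉ Z) (h5 : a₅ ∉ Z)
    (d3 : 6 ∣ Nat.card (stabilizer a₃)) (d4 : 8 ∣ Nat.card (stabilizer a₄))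
    (d5 : 10 ∣ Nat.card (stabilizer a₅)) : ∃ a ∉ Z, pmStabilizer a = ⊤ := by
  by_contra! hne
  classical
  have := Fintype.ofFinite G
  have hTeq {a b : {a : G // a ∉ Z}} (h : setoid hZ hct a b) :
      Nat.card (stabilizer a.1) = Nat.card (stabilizer b.1) := by
    obtain ⟨g, hg⟩ := h
    refine Nat.card_congr ((MulAut.conj g).toEquiv.subtypeEquiv fun y => ?_)
    rw [mem_stabilizer, mem_stabilizer]
    change _ ↔ Commute b.1 (g * y * g⁻¹)
    rw [← Commute.conj_iff g]
    exact ⟨fun h => hct _ (conj_notMem hZ a.2 g) _ _ hg h,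
      fun h => hct _ b.2 _ _ hg.symm h⟩
  have hZS (a : G) : Z ≤ stabilizer a := fun y hy =>
    mem_stabilizer.2 (Subgroup.mem_center_iff.1 (hZ hy) a)
  let I := Quotient (setoid hZ hct)
  have : Fintype I := Fintype.ofFinite I
  let T : I → ℕ := fun i => Nat.card (stabilizer i.out.1)
  have hT (a : {a : G // a ∉ Z}) : T (Quotient.mk _ a) = Nat.card (stabilizer a.1) :=
    hTeq (Quotient.mk_out (s := setoid hZ hct) a)
  let c : I → ℕ := fun i => Nat.card {b // setoid hZ hct i.out b}
  let M := Nat.card G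
  have hM0 : 0 < M := Nat.card_pos
  have hM : (M : ℚ) ≠ 0 := by exact_mod_cast hM0.ne'
  have hsum : ∑ i, c i + 2 = M := by
    have e1 : Nat.card {a : G // a ∉ Z} = ∑ i, c i := by
      rw [Nat.card_congr (Equiv.sigmaFiberEquiv (Quotient.mk (setoid hZ hct))).symm, Nat.card_sigma]
      refine Finset.sum_congr rfl fun i _ => Nat.card_congr (Equiv.subtypeEquivRight fun b => ?_)
      constructor
      · rintro rfl
        exact Quotient.mk_out (s := setoid hZ hct) b
      · intro h
        rw [← Quotient.out_eq i]
        exact (Quotient.sound h).symm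
    have e2 := Set.ncard_add_ncard_compl (Z : Set G)
    rw [← Nat.card_coe_set_eq, ← Nat.card_coe_set_eq] at e2
    have e3 : Nat.card ↥((Z : Set G)ᶜ) = ∑ i, c i := e1
    rw [e3] at e2
    have e4 : Nat.card (Z : Set G) = 2 := hZ2
    omega
  -- The centralizer properly contains the group `Z` of order 2, so its order is even and greater
  -- than 2.
  have hT4 (i : I) : T i = 4 ∨ 6 ≤ T i := by
    have h2 : 2 ∣ T i := hZ2 ▸ Subgroup.card_dvd_of_le (hZS _)
    have h0 : 2 < T i := by
      rw [← hZ2]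
      refine Set.ncard_lt_ncard (s := (Z : Set G)) (t := stabilizer i.out.1)
        ⟨hZS _, fun h => i.out.2 (h (mem_stabilizer.2 (Commute.refl _)))⟩
    omega
  have hcN (i : I) := card_class_mul hZ hct hE i.out
  have hN (i : I) := card_pmStabilizer (hinv i.out.1 i.out.2)
  -- The assumption that no `pmStabilizer` is the whole group makes its index at least 2; this
  -- yields the bounds on m = 1/M in the numerical lemma.
  have hNM (i : I) : 2 * Nat.card (pmStabilizer i.out.1) ≤ M := by
    obtain ⟨d, hd⟩ := Subgroup.card_subgroup_dvd_card (pmStabilizer i.out.1)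
    have hd0 : d ≠ 0 := by
      rintro rfl
      rw [mul_zero] at hd
      exact hM0.ne' hd
    have hd1 : d ≠ 1 := by
      rintro rfl
      rw [mul_one] at hd
      exact hne _ i.out.2 (Subgroup.eq_top_of_card_eq _ hd.symm)
    have : 2 ≤ d := by omega
    change _ ≤ Nat.card G
    rw [hd, mul_comm]
    exact Nat.mul_le_mul_left _ this
  have hTpos (i : I) : (0 : ℚ) < T i := by
    have := hT4 i
    exact_mod_cast (by omega : 0 < T i)
  have hbound {i : I} {k : ℕ} (hk : 0 < k) (h : k ∣ T i) : (1 : ℚ) / T i ≤ 1 / k := by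
    have h1 : k ≤ T i := Nat.le_of_dvd (by exact_mod_cast hTpos i) h
    exact one_div_le_one_div_of_le (by exact_mod_cast hk) (by exact_mod_cast h1)
  -- A class with centralizer order T fills the fraction 1 − 2/T of the group, or half of it,
  -- according to the index of the centralizer in `pmStabilizer`.
  refine false_of_sum_eq_one_sub (I := I) (fun i => (c i : ℚ) / M) (fun i => 1 / T i) (m := 1 / M)
    (i₃ := Quotient.mk _ ⟨a₃, h3⟩) (i₄ := Quotient.mk _ ⟨a₄, h4⟩) (i₅ := Quotient.mk _ ⟨a₅, h5⟩)
    (by positivity) ?_ (fun i => by have := hTpos i; positivity) ?_ ?_ ?_ ?_ ?_ ?_ ?_ ?_ ?_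
  · rw [← Finset.sum_div]
    have : (∑ i, (c i : ℚ)) + 2 = M := by exact_mod_cast hsum
    field_simp
    linear_combination this
  · intro i
    rcases hT4 i with h | h
    · left
      simp only [h]
      norm_num
    · right
      have : (6 : ℚ) ≤ T i := by exact_mod_cast h
      exact one_div_le_one_div_of_le (by norm_num) this
  · intro i
    have h1 := hcN i
    rw [hZ2] at h1
    have hTi : 2 ≤ T i := by have := hT4 i; omega
    have h2 : (c i : ℚ) * Nat.card (pmStabilizer i.out.1) = M * (T i - 2) := by
      have : ((c i * Nat.card (pmStabilizer i.out.1) : ℕ) : ℚ) = ((M * (T i - 2) : ℕ) : ℚ) := by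
        exact_mod_cast h1
      rw [Nat.cast_mul, Nat.cast_mul, Nat.cast_sub hTi] at this
      exact_mod_cast this
    have h3 : (2 : ℚ) * Nat.card (pmStabilizer i.out.1) ≤ M := by exact_mod_cast hNM i
    have hTp := hTpos i
    have hMp : (0 : ℚ) < M := by exact_mod_cast hM0
    rcases hN i with h | h
    · left
      rw [h] at h2 h3
      change (c i : ℚ) * (T i : ℚ) = _ at h2
      change 2 * (T i : ℚ) ≤ _ at h3
      constructor
      · field_simp
        linear_combination h2
      · rw [div_div, div_le_div_iff₀ hMp (by positivity)]
        linarith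
    · right
      rw [h] at h2 h3
      push_cast at h2 h3
      change (c i : ℚ) * (2 * (T i : ℚ)) = _ at h2
      change 2 * (2 * (T i : ℚ)) ≤ _ at h3
      constructor
      · field_simp
        linear_combination h2
      · rw [div_div, div_le_div_iff₀ hMp (by positivity)]
        linarith
  · exact_mod_cast hbound (k := 6) (by norm_num) (by rw [hT]; exact d3)
  · exact_mod_cast hbound (k := 8) (by norm_num) (by rw [hT]; exact d4)
  · exact_mod_cast hbound (k := 10) (by norm_num) (by rw [hT]; exact d5)
  · intro e
    have e3 := hT ⟨a₃, h3⟩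
    have e4 := hT ⟨a₄, h4⟩
    rw [← e] at e4
    exact_mod_cast hbound (k := 24) (by norm_num)
      ((by omega : ∀ n, 6 ∣ n → 8 ∣ n → 24 ∣ n) _ (e3 ▸ d3) (e4 ▸ d4))
  · intro e
    have e3 := hT ⟨a₄, h4⟩
    have e4 := hT ⟨a₅, h5⟩
    rw [← e] at e4
    exact_mod_cast hbound (k := 40) (by norm_num)
      ((by omega : ∀ n, 8 ∣ n → 10 ∣ n → 40 ∣ n) _ (e3 ▸ d4) (e4 ▸ d5))
  · intro e
    have e3 := hT ⟨a₃, h3⟩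
    have e4 := hT ⟨a₅, h5⟩
    rw [← e] at e4
    exact_mod_cast hbound (k := 30) (by norm_num)
      ((by omega : ∀ n, 6 ∣ n → 10 ∣ n → 30 ∣ n) _ (e3 ▸ d3) (e4 ▸ d5))
  · intro e e'
    have e3 := hT ⟨a₃, h3⟩
    have e4 := hT ⟨a₄, h4⟩
    have e5 := hT ⟨a₅, h5⟩
    rw [← e', ← e] at e5
    rw [← e] at e4
    exact_mod_cast hbound (k := 120) (by norm_num)
      ((by omega : ∀ n, 6 ∣ n → 8 ∣ n → 10 ∣ n → 120 ∣ n) _ (e3 ▸ d3) (e4 ▸ d4) (e5 ▸ d5))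

end CommutingClasses

/-! ### Generation of the whole group -/

namespace PSLTwo

open scoped MatrixGroups
open Matrix CommutingClasses

variable {p : ℕ} [Fact p.Prime] {a α γ : SL(2, ZMod p)} {w x z : ZMod p}

theorem orderOf_dvd_card_stabilizer {G : Type*} [Group G] [Finite G] (g : G) :
    orderOf g ∣ Nat.card (stabilizer g) := by
  have := orderOf_dvd_natCard (⟨g, mem_stabilizer.2 (Commute.refl g)⟩ : stabilizer g)
  rwa [Subgroup.orderOf_mk] at this

theorem eq_one_or_eq_neg_one_of_sq_eq_one {A : SL(2, ZMod p)} (h2 : (2 : ZMod p) ≠ 0)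
    (h : A * A = 1) : A = 1 ∨ A = -1 := by
  by_cases h0 : tr A = 0
  · have := mul_self_of_tr_eq_zero h0
    rw [h] at this
    have := congrArg tr this
    rw [tr_neg, tr_one] at this
    exact absurd (by linear_combination this : (2 : ZMod p) * 2 = 0) (mul_ne_zero h2 h2)
  · have e := val_mul_self A
    rw [← val_mul, h, val_one] at e
    refine eq_one_or_eq_neg_one_of_val_eq_smul (r := (tr A)⁻¹ * 2) ?_
    rw [mul_smul, eq_inv_smul_iff₀ h0, ← sub_eq_zero, two_smul]
    rw [← sub_eq_zero] at e
    rw [← neg_eq_zero, ← e]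
    abel

/-- A subgroup containing `a`, `α` and `γ` is the whole group. -/
theorem IsFrame.eq_top (h : IsFrame a α γ w x z) (hx : x ^ 2 = x + 1) (hw : w ^ 2 = 2)
    (h2 : (2 : ZMod p) ≠ 0) (h3 : (3 : ZMod p) ≠ 0) (h5 : (5 : ZMod p) ≠ 0)
    {H : Subgroup SL(2, ZMod p)} (ha : a ∈ H) (hα : α ∈ H) (hγ : γ ∈ H) : H = ⊤ := by
  by_contra hH
  have hn1 : -1 ∈ H := by
    rw [← mul_self_of_tr_eq_zero h.tr_α]
    exact mul_mem hα hα
  have hT := h.isRotaryTriple hx hw h2 h3 h5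
  -- A proper H contains no nontrivial unipotent, even up to sign. This is the hypothesis under
  -- which commuting conjugates are equal or inverse.
  have htr {A : SL(2, ZMod p)} (hA : A ∈ H) (n1 : A ≠ 1) (n2 : A ≠ -1) : tr A ^ 2 ≠ 4 := by
    intro e
    rcases sq_eq_sq_iff_eq_or_eq_neg.1 (by rw [e]; norm_num : tr A ^ 2 = 2 ^ 2) with e | e
    · exact hH (h.eq_top_of_unipotent_mem hx ha hα hA n1 e)
    · refine hH (h.eq_top_of_unipotent_mem hx ha hα (X := -A) ?_ ?_ (by rw [tr_neg, e, neg_neg]))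
      · rw [← neg_one_mul]
        exact mul_mem hn1 hA
      · exact fun e => n2 (by rw [← e, neg_neg])
  have n11 : (1 : SL(2, ZMod p)) ≠ -1 := fun e => by
    have := congrArg tr e
    rw [tr_neg, tr_one] at this
    exact mul_ne_zero h2 h2 (by linear_combination this)
  let Z : Subgroup H := (Subgroup.center SL(2, ZMod p)).subgroupOf H
  have memZ {A : H} : A ∈ Z ↔ A.1 = 1 ∨ A.1 = -1 := by
    rw [Subgroup.mem_subgroupOf, PSLTwo.mem_center_iff]
  have memZ' {A : H} : A ∉ Z ↔ A.1 ≠ 1 ∧ A.1 ≠ -1 := by rw [memZ, not_or]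
  have comm {A B : H} : Commute A B ↔ Commute A.1 B.1 := by
    rw [Commute, SemiconjBy, Subtype.ext_iff]; rfl
  have hZ : Z ≤ Subgroup.center H := fun A hA => Subgroup.mem_center_iff.2 fun B =>
    Subtype.ext (Subgroup.mem_center_iff.1 (Subgroup.mem_subgroupOf.1 hA) B.1)
  have hZ2 : Nat.card Z = 2 := by
    have : (Z : Set H) = {1, ⟨-1, hn1⟩} := by
      ext A
      rw [SetLike.mem_coe, memZ, Set.mem_insert_iff, Set.mem_singleton_iff, Subtype.ext_iff,
        Subtype.ext_iff]
      rfl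
    rw [← SetLike.coe_sort_coe, Nat.card_coe_set_eq, this, Set.ncard_pair]
    exact fun e => n11 (congrArg Subtype.val e)
  have memZproj {A : H} : A ∈ Z ↔ proj A.1 = 1 := by rw [memZ, proj_eq_one_iff]
  have m1 : α * a⁻¹ ∈ H := mul_mem hα (inv_mem ha)
  have m3 : a⁻¹ * γ ∈ H := mul_mem (inv_mem ha) hγ
  have dvd_of {A : H} {k : ℕ} (hk : k.Coprime 2) (hA : orderOf (proj A.1) = k) :
      2 * k ∣ Nat.card (stabilizer A) := by
    have d1 : k ∣ Nat.card (stabilizer A) := by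
      refine dvd_trans ?_ (orderOf_dvd_card_stabilizer A)
      rw [← hA]
      exact orderOf_map_dvd (proj.comp H.subtype) A
    have d2 : 2 ∣ Nat.card (stabilizer A) := hZ2.symm.dvd.trans (Subgroup.card_dvd_of_le fun y hy =>
      mem_stabilizer.2 (Subgroup.mem_center_iff.1 (hZ hy) A))
    exact Nat.Coprime.mul_dvd_of_dvd_of_dvd hk.symm d2 d1
  have hex : ∃ A ∉ Z, pmStabilizer A = ⊤ := by
    refine exists_pmStabilizer_eq_top hZ hZ2 (a₃ := ⟨a, ha⟩)
      (a₄ := ⟨_, m3⟩) (a₅ := ⟨_, m1⟩) ?_ ?_ ?_ ?_ ?_ ?_ ?_ ?_ ?_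
    · intro A hA B C hB hC
      rw [memZ'] at hA
      exact comm.2 (commute_of_commute hA.1 hA.2 (comm.1 hB) (comm.1 hC))
    · intro A hA B hB
      rw [memZ'] at hA
      rcases eq_or_eq_inv_of_commute (htr A.2 hA.1 hA.2) (comm.1 hB) with e | e
      · exact Or.inl (Subtype.ext e)
      · exact Or.inr (Subtype.ext e)
    · intro A hA e
      rw [memZ'] at hA
      have : A.1 * A.1 = 1 := by
        have := congrArg Subtype.val (mul_eq_one_iff_eq_inv.2 e)
        exact this
      rcases eq_one_or_eq_neg_one_of_sq_eq_one h2 this with e | e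
      · exact hA.1 e
      · exact hA.2 e
    · rw [memZproj]
      exact fun e => by
        have := hT.orderOf_snd
        rw [e, orderOf_one] at this
        omega
    · rw [memZproj]
      exact fun e => by
        have := hT.orderOf_thd
        rw [e, orderOf_one] at this
        omega
    · rw [memZproj]
      exact fun e => by
        have := hT.orderOf_fst
        rw [e, orderOf_one] at this
        omega
    · exact dvd_of (A := ⟨a, ha⟩) (by norm_num) hT.orderOf_snd
    · have ht : tr (a⁻¹ * γ) ^ 2 = 2 := by
        rw [tr_inv_mul, h.tr_a, h.tr_γ, h.tr_aγ]
        linear_combination hw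
      -- Projective order 4 becomes order 8 in SL(2, p). For the odd orders 3 and 5 the extra factor
      -- 2 comes from the centre instead.
      have e4 : (a⁻¹ * γ) ^ 4 = -1 := by
        refine Subtype.ext ?_
        rw [val_pow_four, ht, show tr (a⁻¹ * γ) ^ 3 - 2 * tr (a⁻¹ * γ) = 0 by
          linear_combination tr (a⁻¹ * γ) * ht, val_neg, val_one]
        norm_num
      have : orderOf (⟨_, m3⟩ : H) = 8 := by
        rw [Subgroup.orderOf_mk]
        refine orderOf_eq_prime_pow (p := 2) (n := 2) ?_ ?_
        · norm_num
          rw [e4]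
          exact n11.symm
        · norm_num
          rw [show (8 : ℕ) = 4 * 2 by norm_num, pow_mul, e4]
          norm_num
      exact this ▸ orderOf_dvd_card_stabilizer _
    · exact dvd_of (A := ⟨_, m1⟩) (by norm_num) hT.orderOf_fst
  obtain ⟨A, hA, hAtop⟩ := hex
  rw [memZ'] at hA
  -- Every B in H fixes or inverts A, so B² centralizes A; if an odd power of B is ±1, then B itself
  -- centralizes A. Hence a and αa⁻¹, of projective orders 3 and 5, both commute with A and
  -- therefore with each other, which is impossible.
  have odd {B : SL(2, ZMod p)} (hB : B ∈ H) {k : ℕ} (hk : B ^ (2 * k + 1) = 1 ∨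
      B ^ (2 * k + 1) = -1) : Commute A.1 B := by
    have hBm : (⟨B, hB⟩ : H) ∈ pmStabilizer A := hAtop ▸ Subgroup.mem_top _
    have hBA : B * A.1 * B⁻¹ = A.1 ∨ B * A.1 * B⁻¹ = A.1⁻¹ := by
      rcases hBm with e | e
      · exact Or.inl (congrArg Subtype.val e)
      · exact Or.inr (congrArg Subtype.val e)
    have hB2 : Commute A.1 (B ^ 2) := by
      have e : B ^ 2 * A.1 * (B ^ 2)⁻¹ = B * (B * A.1 * B⁻¹) * B⁻¹ := by
        rw [pow_two, _root_.mul_inv_rev]; simp only [mul_assoc]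
      have e' : B * A.1⁻¹ * B⁻¹ = (B * A.1 * B⁻¹)⁻¹ := by group
      have : B ^ 2 * A.1 * (B ^ 2)⁻¹ = A.1 := by
        rcases hBA with h | h
        · rw [e, h, h]
        · rw [e, h, e', h, inv_inv]
      exact (mul_inv_eq_iff_eq_mul.1 this).symm
    have hBk : Commute A.1 (B ^ (2 * k + 1)) := by
      rcases hk with e | e <;> rw [e]
      · exact Commute.one_right _
      · exact Commute.neg_one_right _
    rw [pow_succ, pow_mul] at hBk
    have := (hB2.pow_right k).inv_right.mul_right hBk
    rwa [inv_mul_cancel_left] at this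
  have pm {B : SL(2, ZMod p)} {n : ℕ} (hB : orderOf (proj B) = n) : B ^ n = 1 ∨ B ^ n = -1 := by
    rw [← proj_eq_one_iff, map_pow, ← hB, pow_orderOf_eq_one]
  have ca : Commute A.1 a := odd (k := 1) ha (pm hT.orderOf_snd)
  have cs : Commute A.1 (α * a⁻¹) := odd (k := 2) m1 (pm hT.orderOf_fst)
  have := commute_of_commute hA.1 hA.2 ca cs
  refine h.not_commute hx ?_
  have := this.mul_right (Commute.refl a)
  rwa [inv_mul_cancel_right] at this

end PSLTwo

/-! ### Based chiral polytopes correspond to parameters -/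

theorem IsRotaryGenerators.map {G G' : Type*} [Group G] [Group G'] {σ₁ σ₂ σ₃ : G}
    (h : IsRotaryGenerators σ₁ σ₂ σ₃) (e : G ≃* G') :
    IsRotaryGenerators (e σ₁) (e σ₂) (e σ₃) where
  orderOf_fst := by rw [e.orderOf_eq, h.orderOf_fst]
  orderOf_snd := by rw [e.orderOf_eq, h.orderOf_snd]
  orderOf_thd := by rw [e.orderOf_eq, h.orderOf_thd]
  sq_fst_snd := by rw [← map_mul, ← map_pow, h.sq_fst_snd, map_one]
  sq_snd_thd := by rw [← map_mul, ← map_pow, h.sq_snd_thd, map_one]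
  sq_fst_snd_thd := by rw [← map_mul, ← map_mul, ← map_pow, h.sq_fst_snd_thd, map_one]
  closure_eq_top := by
    have := congrArg (Subgroup.map e.toMonoidHom) h.closure_eq_top
    rw [MonoidHom.map_closure, Subgroup.map_top_of_surjective _ e.surjective] at this
    rw [← this]
    congr 1
    simp [Set.image_insert_eq]
  inf_le := by
    have h1 := Subgroup.map_mono (f := e.toMonoidHom) h.inf_le
    rw [Subgroup.map_inf _ _ _ e.injective, MonoidHom.map_closure, MonoidHom.map_closure,
      MonoidHom.map_zpowers] at h1
    simpa [Set.image_insert_eq] using h1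

namespace PSLTwo

open scoped MatrixGroups
open Matrix AbstractPolytope

variable {p : ℕ} [Fact p.Prime]

theorem natCast_ne_zero_of_ne {q : ℕ} (hq : q.Prime) (h : p ≠ q) : (q : ZMod p) ≠ 0 := fun e =>
  h ((Nat.prime_dvd_prime_iff_eq Fact.out hq).1 ((ZMod.natCast_eq_zero_iff q p).1 e))

theorem mod_eight_of_sq_eq_two (h2 : (2 : ZMod p) ≠ 0) {w : ZMod p} (hw : w ^ 2 = 2) :
    p % 8 = 1 ∨ p % 8 = 7 :=
  (ZMod.exists_sq_eq_two_iff (by rintro rfl; exact h2 (by reduce_mod_char))).1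
    ⟨w, by rw [← hw, pow_two]⟩

theorem IsFrame.isRotaryGenerators {a α γ : SL(2, ZMod p)} {w x z : ZMod p}
    (h : IsFrame a α γ w x z) (hx : x ^ 2 = x + 1) (hw : w ^ 2 = 2)
    (hz : z ^ 2 + x * w * z + x ^ 2 - 1 = 0) (h2 : (2 : ZMod p) ≠ 0) :
    IsRotaryGenerators (proj (α * a⁻¹)) (proj a) (proj (a⁻¹ * γ)) := by
  -- The existence of √2 forces p ≡ ±1 modulo 8, which excludes the bad characteristics 3, 5 and 11.
  have h8 := mod_eight_of_sq_eq_two h2 hw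
  have h3 : (3 : ZMod p) ≠ 0 := by
    exact_mod_cast natCast_ne_zero_of_ne (q := 3) (by norm_num) (by rintro rfl; omega)
  have h5 : (5 : ZMod p) ≠ 0 := by
    exact_mod_cast natCast_ne_zero_of_ne (q := 5) (by norm_num) (by rintro rfl; omega)
  have h11 : (11 : ZMod p) ≠ 0 := by
    exact_mod_cast natCast_ne_zero_of_ne (q := 11) (by norm_num) (by rintro rfl; omega)
  refine { h.isRotaryTriple hx hw h2 h3 h5 with
    closure_eq_top := ?_, inf_le := h.inf_le hx hw hz h2 h3 h5 h11 }
  set C := Subgroup.closure {proj (α * a⁻¹), proj a, proj (a⁻¹ * γ)} with hC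
  have m1 : proj (α * a⁻¹) ∈ C := Subgroup.subset_closure (by simp)
  have m2 : proj a ∈ C := Subgroup.subset_closure (by simp)
  have m3 : proj (a⁻¹ * γ) ∈ C := Subgroup.subset_closure (by simp)
  have : C.comap proj = ⊤ := by
    refine h.eq_top hx hw h2 h3 h5 m2 ?_ ?_
    · have := mul_mem m1 m2
      rwa [← map_mul, inv_mul_cancel_right] at this
    · have := mul_mem m2 m3
      rwa [← map_mul, mul_inv_cancel_left] at this
  rw [eq_top_iff]
  rintro σ -
  obtain ⟨A, rfl⟩ := exists_proj σ
  exact Subgroup.mem_comap.1 (this ▸ Subgroup.mem_top A)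

/-- A based chiral polytope of type `[5, 3, 4]` with group `PSL(2, p)` and given parameters. -/
def Realizes (w : ZMod p) (A : BasedPolytope.{u} 4) (q : ZMod p × ZMod p) : Prop :=
  ∃ hA : A.polytope.IsChiral, A.polytope.HasType ![5, 3, 4] ∧
    ∃ θ : A.polytope.AutomorphismGroup ≃* PSL(2, ZMod p),
      HasParam (θ (rotation hA A.baseFlag 0 1)) (θ (rotation hA A.baseFlag 1 2))
        (θ (rotation hA A.baseFlag 2 3)) w q.1 q.2

/-- The parameters that occur. -/
def params (w : ZMod p) : Set (ZMod p × ZMod p) :=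
  {q | q.1 ^ 2 = q.1 + 1 ∧ q.2 ^ 2 + q.1 * w * q.2 + q.1 ^ 2 - 1 = 0}

theorem exists_realizes (h2 : (2 : ZMod p) ≠ 0) {w : ZMod p} (hw : w ^ 2 = 2)
    {q : ZMod p × ZMod p} (hq : q ∈ params w) : ∃ A : BasedPolytope.{u} 4, Realizes w A q := by
  obtain ⟨hx, hz⟩ := hq
  obtain ⟨a, α, γ, h⟩ := exists_isFrame h2 hx hw hz
  have hp : HasParam (proj (α * a⁻¹)) (proj a) (proj (a⁻¹ * γ)) w q.1 q.2 :=
    ⟨a, α, γ, h, rfl, by rw [← map_mul, inv_mul_cancel_right],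
      by rw [← map_mul, mul_inv_cancel_left]⟩
  have hg := h.isRotaryGenerators hx hw hz h2
  have hm := hp.not_exists_mirror h2 hx hw hz
  generalize proj (α * a⁻¹) = σ₁, proj a = σ₂, proj (a⁻¹ * γ) = σ₃ at hp hg hm
  -- The coset polytope lives in the universe of its group, so the group is lifted to universe `u`.
  let e : PSL(2, ZMod p) ≃* ULift.{u} PSL(2, ZMod p) := MulEquiv.ulift.symm
  obtain ⟨A, hA, hAt, θ, h1, h2, h3⟩ := (hg.map e).exists_basedPolytope (by
    rintro ⟨ψ, hψ, e1, e2, e3⟩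
    refine hm ⟨(e.symm : ULift.{u} PSL(2, ZMod p) →* PSL(2, ZMod p)).comp
      (ψ.comp (e : PSL(2, ZMod p) →* ULift.{u} PSL(2, ZMod p))),
      e.symm.injective.comp (hψ.comp e.injective), ?_, ?_, ?_⟩
    · change e.symm (ψ (e σ₁)) = _
      rw [e1, ← map_inv, e.symm_apply_apply]
    · change e.symm (ψ (e σ₂)) = _
      rw [e2, ← map_pow, ← map_mul, e.symm_apply_apply]
    · change e.symm (ψ (e σ₃)) = _
      rw [e3, e.symm_apply_apply])
  refine ⟨A, hA, hAt, θ.trans e.symm, ?_⟩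
  simp only [MulEquiv.trans_apply, h1, h2, h3, e.symm_apply_apply]
  exact hp

theorem isRotaryTriple_rotation {P : AbstractPolytope.{u} 4} (hP : P.IsChiral) (Φ : Flag P.Face)
    (ht : P.HasType ![5, 3, 4]) :
    IsRotaryTriple (rotation hP Φ 0 1) (rotation hP Φ 1 2) (rotation hP Φ 2 3) where
  orderOf_fst := orderOf_rotation hP Φ ht 0 rfl rfl
  orderOf_snd := orderOf_rotation hP Φ ht 1 rfl rfl
  orderOf_thd := orderOf_rotation hP Φ ht 2 rfl rfl
  sq_fst_snd := by rw [rotation_mul]; exact rotation_sq hP Φ (by decide)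
  sq_snd_thd := by rw [rotation_mul]; exact rotation_sq hP Φ (by decide)
  sq_fst_snd_thd := by rw [rotation_mul, rotation_mul]; exact rotation_sq hP Φ (by decide)

theorem _root_.IsRotaryTriple.map {G G' : Type*} [Group G] [Group G'] {σ₁ σ₂ σ₃ : G}
    (h : IsRotaryTriple σ₁ σ₂ σ₃) (e : G ≃* G') : IsRotaryTriple (e σ₁) (e σ₂) (e σ₃) where
  orderOf_fst := by rw [e.orderOf_eq, h.orderOf_fst]
  orderOf_snd := by rw [e.orderOf_eq, h.orderOf_snd]
  orderOf_thd := by rw [e.orderOf_eq, h.orderOf_thd]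
  sq_fst_snd := by rw [← map_mul, ← map_pow, h.sq_fst_snd, map_one]
  sq_snd_thd := by rw [← map_mul, ← map_pow, h.sq_snd_thd, map_one]
  sq_fst_snd_thd := by rw [← map_mul, ← map_mul, ← map_pow, h.sq_fst_snd_thd, map_one]

theorem exists_realizes_of_isChiral {A : BasedPolytope.{u} 4} (hA : A.polytope.IsChiral)
    (ht : A.polytope.HasType ![5, 3, 4])
    (θ : A.polytope.AutomorphismGroup ≃* PSL(2, ZMod p)) :
    (2 : ZMod p) ≠ 0 ∧ (∃ w : ZMod p, w ^ 2 = 2) ∧ ∀ w : ZMod p, w ^ 2 = 2 →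
      ∃ q ∈ params w, Realizes w A q := by
  obtain ⟨h2, hw, h⟩ :=
    ((isRotaryTriple_rotation hA A.baseFlag ht).map θ).exists_hasParam
  refine ⟨h2, hw, fun w hw => ?_⟩
  obtain ⟨x, z, hx, hz, hp⟩ := h w hw
  exact ⟨(x, z), ⟨hx, hz⟩, hA, ht, θ, hp⟩

/-- An isomorphism of based polytopes matches the rotations through an automorphism of PSL(2, p),
under which parameters are invariant. -/
theorem Realizes.eq_of_iso (h2 : (2 : ZMod p) ≠ 0) {w : ZMod p} (hw : w ^ 2 = 2)
    {A B : BasedPolytope.{u} 4} {q r : ZMod p × ZMod p} (hq : q ∈ params w) (hr : r ∈ params w)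
    (hA : Realizes w A q) (hB : Realizes w B r) (h : A.Iso B) : q = r := by
  obtain ⟨hA, -, θ, hθ⟩ := hA
  obtain ⟨hB, -, θ', hθ'⟩ := hB
  obtain ⟨f, hf⟩ := h
  have e (i j : Fin 4) : θ.symm.trans ((automorphismGroupCongr f).trans θ')
      (θ (rotation hA A.baseFlag i j)) = θ' (rotation hB B.baseFlag i j) := by
    rw [MulEquiv.trans_apply, MulEquiv.trans_apply, θ.symm_apply_apply,
      automorphismGroupCongr_rotation f hf]
  have := hθ.map h2 (θ.symm.trans ((automorphismGroupCongr f).trans θ')).toMonoidHom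
    (MulEquiv.injective _)
  simp only [MulEquiv.toMonoidHom_eq_coe, MonoidHom.coe_coe, e] at this
  obtain ⟨h1, h2⟩ := this.unique h2 hw hq.1 hr.1 hθ'
  exact Prod.ext h1 h2

theorem Realizes.iso {w : ZMod p} {A B : BasedPolytope.{u} 4} {q : ZMod p × ZMod p}
    (hq : q ∈ params w) (hA : Realizes w A q) (hB : Realizes w B q) : A.Iso B := by
  obtain ⟨hA, -, θ, hθ⟩ := hA
  obtain ⟨hB, -, θ', hθ'⟩ := hB
  obtain ⟨φ, e1, e2, e3⟩ := hθ.exists_mulEquiv hq.1 hθ'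
  let ψ := θ.trans (φ.trans θ'.symm)
  have f1 : ψ (rotation hA A.baseFlag 0 1) = rotation hB B.baseFlag 0 1 := by
    change θ'.symm (φ (θ _)) = _
    rw [e1, θ'.symm_apply_apply]
  have f2 : ψ (rotation hA A.baseFlag 1 2) = rotation hB B.baseFlag 1 2 := by
    change θ'.symm (φ (θ _)) = _
    rw [e2, θ'.symm_apply_apply]
  have f3 : ψ (rotation hA A.baseFlag 2 3) = rotation hB B.baseFlag 2 3 := by
    change θ'.symm (φ (θ _)) = _
    rw [e3, θ'.symm_apply_apply]
  -- All rotations are words in those starting at rank 0, and these are products of the three basic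
  -- ones.
  have f0 (j : Fin 4) : ψ (rotation hA A.baseFlag 0 j) = rotation hB B.baseFlag 0 j := by
    fin_cases j
    · change ψ (rotation hA A.baseFlag 0 0) = rotation hB B.baseFlag 0 0
      rw [rotation_self, rotation_self, map_one]
    · exact f1
    · change ψ (rotation hA A.baseFlag 0 2) = rotation hB B.baseFlag 0 2
      rw [← rotation_mul hA _ 0 1 2, ← rotation_mul hB _ 0 1 2, map_mul, f1, f2]
    · change ψ (rotation hA A.baseFlag 0 3) = rotation hB B.baseFlag 0 3
      rw [← rotation_mul hA _ 0 1 3, ← rotation_mul hB _ 0 1 3, ← rotation_mul hA _ 1 2 3,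
        ← rotation_mul hB _ 1 2 3, map_mul, map_mul, f1, f2, f3]
  refine exists_orderIso_of_mulEquiv (hP := hA) (hQ := hB) (by norm_num) ψ fun i j => ?_
  rw [← rotation_mul hA _ i 0 j, ← rotation_mul hB _ i 0 j, ← rotation_inv hA _ 0 i,
    ← rotation_inv hB _ 0 i, map_mul, map_inv, f0, f0]

theorem encard_chiralForms (h2 : (2 : ZMod p) ≠ 0) {w : ZMod p} (hw : w ^ 2 = 2) :
    (chiralForms.{u} 4 ![5, 3, 4] PSL(2, ZMod p)).encard = (params w).encard := by
  choose F hF using fun q : params w => exists_realizes.{u} h2 hw q.2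
  have hrange : chiralForms.{u} 4 ![5, 3, 4] PSL(2, ZMod p) =
      Set.range fun q => Quotient.mk _ (F q) := by
    ext c
    constructor
    · rintro ⟨A, rfl, hA, ht, ⟨θ⟩⟩
      obtain ⟨q, hq, hr⟩ := (exists_realizes_of_isChiral hA ht θ).2.2 w hw
      exact ⟨⟨q, hq⟩, Quotient.sound ((hF ⟨q, hq⟩).iso hq hr)⟩
    · rintro ⟨q, rfl⟩
      obtain ⟨hA, ht, θ, -⟩ := hF q
      exact ⟨F q, rfl, hA, ht, ⟨θ⟩⟩
  have hinj : Function.Injective fun q => (Quotient.mk _ (F q) :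
      Quotient (BasedPolytope.isoSetoid.{u} 4)) := fun q r h =>
    Subtype.ext ((hF q).eq_of_iso h2 hw q.2 r.2 (hF r) (Quotient.exact h))
  rw [hrange, ← Set.image_univ, hinj.injOn.encard_image, Set.encard_univ]
  rfl

end PSLTwo

/-! ### Counting the parameters -/

namespace PSLTwo

variable {p : ℕ} [Fact p.Prime]

theorem isSquare_mul_of_not_isSquare {a b : ZMod p} (ha : ¬ IsSquare a) (hb : ¬ IsSquare b) :
    IsSquare (a * b) := by
  have ha0 : a ≠ 0 := by rintro rfl; exact ha (IsSquare.zero)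
  have hb0 : b ≠ 0 := by rintro rfl; exact hb (IsSquare.zero)
  have h2 : ringChar (ZMod p) ≠ 2 := fun h => ha (FiniteField.isSquare_of_char_two h a)
  rw [← quadraticChar_one_iff_isSquare (mul_ne_zero ha0 hb0), map_mul,
    quadraticChar_neg_one_iff_not_isSquare.2 ha, quadraticChar_neg_one_iff_not_isSquare.2 hb]
  norm_num

theorem isSquare_five_iff (h2 : p ≠ 2) (h5 : p ≠ 5) :
    IsSquare (5 : ZMod p) ↔ p % 5 = 1 ∨ p % 5 = 4 := by
  have key : ∀ r : ℕ, r < 5 → r ≠ 0 → (IsSquare (r : ZMod 5) ↔ r = 1 ∨ r = 4) := by decide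
  have : Fact (Nat.Prime 5) := ⟨by norm_num⟩
  have h := ZMod.exists_sq_eq_prime_iff_of_mod_four_eq_one (p := 5) (q := p) (by norm_num) h2
  rw [Nat.cast_ofNat] at h
  rw [← h, ← ZMod.natCast_mod p 5]
  have h0 : p % 5 ≠ 0 := fun h0 => h5
    ((Nat.prime_dvd_prime_iff_eq (by norm_num) Fact.out).1 (Nat.dvd_of_mod_eq_zero h0)).symm
  exact key _ (Nat.mod_lt p (by norm_num)) h0

variable {w : ZMod p}

/-- Completing the square: with w² = 2 and x² = x + 1 the discriminant simplifies to 2 − 2x. -/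
theorem mem_params_iff (h2 : (2 : ZMod p) ≠ 0) (hw : w ^ 2 = 2) {q : ZMod p × ZMod p} :
    q ∈ params w ↔ q.1 ^ 2 = q.1 + 1 ∧ (2 * q.2 + q.1 * w) ^ 2 = 2 - 2 * q.1 := by
  refine and_congr_right fun hx => ⟨fun h => ?_, fun h => ?_⟩
  · linear_combination 4 * h + q.1 ^ 2 * hw - 2 * hx
  · refine (mul_eq_zero.1 (?_ : (2 : ZMod p) * 2 * _ = 0)).resolve_left (mul_ne_zero h2 h2)
    linear_combination h - q.1 ^ 2 * hw + 2 * hx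

/-- The two parameters with a given first component. -/
def paramPair (w x u : ZMod p) : Set (ZMod p × ZMod p) :=
  {(x, (u - x * w) / 2), (x, (-u - x * w) / 2)}

theorem encard_paramPair (h2 : (2 : ZMod p) ≠ 0) (x : ZMod p) {u : ZMod p} (hu : u ≠ 0) :
    (paramPair w x u).encard = 2 := by
  refine Set.encard_pair fun h => mul_ne_zero h2 hu ?_
  have := congrArg Prod.snd h
  simp only at this
  field_simp at this
  linear_combination this

theorem mem_paramPair_iff (h2 : (2 : ZMod p) ≠ 0) {x u : ZMod p} (hu : u ^ 2 = 2 - 2 * x)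
    {q : ZMod p × ZMod p} :
    q ∈ paramPair w x u ↔ q.1 = x ∧ (2 * q.2 + q.1 * w) ^ 2 = 2 - 2 * q.1 := by
  obtain ⟨y, z⟩ := q
  simp only [paramPair, Set.mem_insert_iff, Set.mem_singleton_iff, Prod.mk.injEq]
  rw [← and_or_left]
  refine and_congr_right ?_
  rintro rfl
  rw [← hu, sq_eq_sq_iff_eq_or_eq_neg, eq_div_iff h2, eq_div_iff h2, eq_sub_iff_add_eq,
    eq_sub_iff_add_eq, mul_comm z]

theorem sq_eq_add_one_iff (h2 : (2 : ZMod p) ≠ 0) {s : ZMod p} (hs : s ^ 2 = 5) {x : ZMod p} :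
    x ^ 2 = x + 1 ↔ x = (1 + s) / 2 ∨ x = (1 - s) / 2 := by
  rw [eq_div_iff h2, eq_div_iff h2, ← sub_eq_zero, ← sub_eq_zero (b := 1 + s),
    ← sub_eq_zero (b := 1 - s), ← mul_eq_zero]
  constructor
  · intro h
    linear_combination 4 * h - hs
  · intro h
    refine (mul_eq_zero.1 (?_ : (2 : ZMod p) * 2 * _ = 0)).resolve_left (mul_ne_zero h2 h2)
    linear_combination h + hs

/-- The two values of x have discriminants 1 − s and 1 + s. Both are nonzero because their product
is −4, so each contributes two parameters. -/
theorem encard_params_eq_four (h2 : (2 : ZMod p) ≠ 0) (h5 : (5 : ZMod p) ≠ 0) (hw : w ^ 2 = 2)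
    {s : ZMod p} (hs : s ^ 2 = 5) (h₁ : IsSquare (1 + s)) (h₂ : IsSquare (1 - s)) :
    (params w).encard = 4 := by
  obtain ⟨v, hv⟩ := h₁
  obtain ⟨u, hu⟩ := h₂
  have hu' : u ^ 2 = 2 - 2 * ((1 + s) / 2) := by field_simp; linear_combination -hu
  have hv' : v ^ 2 = 2 - 2 * ((1 - s) / 2) := by field_simp; linear_combination -hv
  have huv : u * v ≠ 0 := fun h => mul_ne_zero h2 h2 (by
    linear_combination -(u * v) * h - (1 - s) * hv - v * v * hu - hs)
  have e : params w = paramPair w ((1 + s) / 2) u ∪ paramPair w ((1 - s) / 2) v := by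
    ext q
    rw [mem_params_iff h2 hw, sq_eq_add_one_iff h2 hs, Set.mem_union, mem_paramPair_iff h2 hu',
      mem_paramPair_iff h2 hv', or_and_right]
  have hd : Disjoint (paramPair w ((1 + s) / 2) u) (paramPair w ((1 - s) / 2) v) := by
    rw [Set.disjoint_left]
    intro q hq hr
    have := ((mem_paramPair_iff h2 hu').1 hq).1.symm.trans ((mem_paramPair_iff h2 hv').1 hr).1
    field_simp at this
    have hs0 : 2 * s = 0 := by linear_combination this
    have hs0 := (mul_eq_zero.1 hs0).resolve_left h2
    rw [hs0] at hs
    exact h5 (by rw [← hs]; ring)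
  rw [e, Set.encard_union_eq hd, encard_paramPair h2 _ (left_ne_zero_of_mul huv),
    encard_paramPair h2 _ (right_ne_zero_of_mul huv)]
  norm_num

theorem encard_params_eq_two (h2 : (2 : ZMod p) ≠ 0) (hw : w ^ 2 = 2)
    {s : ZMod p} (hs : s ^ 2 = 5) (h₁ : ¬ IsSquare (1 + s)) (h₂ : IsSquare (1 - s)) :
    (params w).encard = 2 := by
  obtain ⟨u, hu⟩ := h₂
  have hu' : u ^ 2 = 2 - 2 * ((1 + s) / 2) := by field_simp; linear_combination -hu
  have hu0 : u ≠ 0 := by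
    rintro rfl
    exact mul_ne_zero h2 h2 (by linear_combination -(1 + s) * hu - hs)
  have e : params w = paramPair w ((1 + s) / 2) u := by
    ext q
    rw [mem_params_iff h2 hw, sq_eq_add_one_iff h2 hs, mem_paramPair_iff h2 hu', or_and_right]
    refine or_iff_left fun ⟨hx, hz⟩ => h₁ ⟨2 * q.2 + q.1 * w, ?_⟩
    rw [← pow_two, hz, hx]
    field_simp
    ring
  rw [e, encard_paramPair h2 _ hu0]

end PSLTwo

theorem mainTheorem6 (p : ℕ) [Fact p.Prime] :
    ((p % 40 = 1 ∨ p % 40 = 9) →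
      (∃ s : ZMod p, s ^ 2 = 5 ∧ IsSquare (1 + s) ∧ IsSquare (1 - s)) →
        (chiralForms.{u} 4 ![5, 3, 4]
          (Matrix.ProjectiveSpecialLinearGroup (Fin 2) (ZMod p))).encard = 4) ∧
    ((p % 40 = 31 ∨ p % 40 = 39) →
        (chiralForms.{u} 4 ![5, 3, 4]
          (Matrix.ProjectiveSpecialLinearGroup (Fin 2) (ZMod p))).encard = 2) ∧
    (¬ ((p % 40 = 1 ∨ p % 40 = 9) ∧
          ∃ s : ZMod p, s ^ 2 = 5 ∧ IsSquare (1 + s) ∧ IsSquare (1 - s)) →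
      ¬ (p % 40 = 31 ∨ p % 40 = 39) →
        chiralForms.{u} 4 ![5, 3, 4]
          (Matrix.ProjectiveSpecialLinearGroup (Fin 2) (ZMod p)) = ∅) := by
  have two_ne {h : p ≠ 2} : (2 : ZMod p) ≠ 0 := by
    exact_mod_cast PSLTwo.natCast_ne_zero_of_ne (q := 2) Nat.prime_two h
  have five_ne {h : p ≠ 5} : (5 : ZMod p) ≠ 0 := by
    exact_mod_cast PSLTwo.natCast_ne_zero_of_ne (q := 5) Nat.prime_five h
  refine ⟨?_, ?_, ?_⟩
  · rintro hp ⟨s, hs, h₁, h₂⟩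
    have hp2 : p ≠ 2 := by omega
    obtain ⟨w, hw⟩ := (ZMod.exists_sq_eq_two_iff hp2).2 (by omega)
    rw [← pow_two] at hw
    rw [PSLTwo.encard_chiralForms (two_ne (h := hp2)) hw.symm]
    exact PSLTwo.encard_params_eq_four (two_ne (h := hp2)) (five_ne (h := by omega)) hw.symm hs h₁ h₂
  · intro hp
    have hp2 : p ≠ 2 := by omega
    have h2 := two_ne (h := hp2)
    obtain ⟨w, hw⟩ := (ZMod.exists_sq_eq_two_iff hp2).2 (by omega)
    rw [← pow_two] at hw
    rw [PSLTwo.encard_chiralForms h2 hw.symm]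
    obtain ⟨s, hs⟩ := (PSLTwo.isSquare_five_iff hp2 (by omega)).2 (by omega)
    have hneg : ¬ IsSquare (-1 : ZMod p) := fun h => ZMod.exists_sq_eq_neg_one_iff.1 h (by omega)
    -- Here p ≡ 3 modulo 4, so −4 is not a square and exactly one of the two factors is; which one
    -- depends on the sign of s.
    have hprod : (1 + s) * (1 - s) = 2 ^ 2 * -1 := by linear_combination hs
    have hnot : ¬ IsSquare ((1 + s) * (1 - s)) := by
      rintro ⟨t, ht⟩
      refine hneg ⟨t / 2, ?_⟩
      field_simp
      linear_combination ht - hprod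
    by_cases h₁ : IsSquare (1 + s)
    · refine PSLTwo.encard_params_eq_two h2 hw.symm (s := -s) (by rw [neg_sq, pow_two, ← hs]) ?_ ?_
      · rw [← sub_eq_add_neg]
        exact fun h₂ => hnot (h₁.mul h₂)
      · rwa [sub_neg_eq_add]
    · refine PSLTwo.encard_params_eq_two h2 hw.symm (s := s) (by rw [pow_two, ← hs]) h₁ ?_
      by_contra h₂
      exact hnot (PSLTwo.isSquare_mul_of_not_isSquare h₁ h₂)
  · intro h₁ h₂
    rw [Set.eq_empty_iff_forall_notMem]
    rintro c ⟨A, rfl, hA, ht, ⟨θ⟩⟩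
    obtain ⟨h2, ⟨w, hw⟩, h⟩ := PSLTwo.exists_realizes_of_isChiral hA ht θ
    obtain ⟨⟨x, z⟩, hq, -⟩ := h w hw
    have h8 := PSLTwo.mod_eight_of_sq_eq_two h2 hw
    obtain ⟨hx, hz⟩ := (PSLTwo.mem_params_iff h2 hw).1 hq
    simp only at hx hz
    have hs : (2 * x - 1) ^ 2 = 5 := by linear_combination 4 * hx
    have h5 := (PSLTwo.isSquare_five_iff (by rintro rfl; omega) (by rintro rfl; omega)).1
      ⟨2 * x - 1, by rw [← hs, pow_two]⟩
    -- The classes ±1 modulo 8 and modulo 5 combine to 1, 9, 31, 39 modulo 40, and the last two are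
    -- excluded by assumption.
    have h40 : p % 40 = 1 ∨ p % 40 = 9 := by omega
    refine h₁ ⟨h40, 2 * x - 1, hs, ?_, 2 * z + x * w, by linear_combination -hz⟩
    -- With s = 2x − 1 the factor 1 − s is the square of 2z + xw. Since (1 + s)(1 − s) = −4 and −1 =
    -- i², the other factor is the square of 2i / (2z + xw).
    obtain ⟨i, hi⟩ := (ZMod.exists_sq_eq_neg_one_iff (p := p)).2 (by omega)
    have hx1 : 2 - 2 * x ≠ 0 := fun e => by
      have e := (mul_eq_zero.1 (by linear_combination e : (2 : ZMod p) * (1 - x) = 0)).resolve_left h2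
      rw [← sub_eq_zero.1 e] at hx
      exact one_ne_zero (α := ZMod p) (by linear_combination -hx)
    have hy : 2 * z + x * w ≠ 0 := fun e => hx1 (by rw [← hz, e]; ring)
    refine ⟨2 * i / (2 * z + x * w), ?_⟩
    rw [div_mul_div_comm, eq_div_iff (mul_ne_zero hy hy)]
    linear_combination (2 * x) * hz + 4 * hi - 4 * hx
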